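/- Let $n\ge 2$. **Moduli space.** A *stable colored rooted ribbon tree* $T$ with $n$ leaves is a planar rooted tree with semi-infinite edges (the root $e_0$ and the leaves $e_1,\dots,e_n$, in this planar order), together with a set of colored vertices such that every path from a leaf to the root contains exactly one colored vertex, every colored vertex has valence at least $2$ and every other vertex has valence at least $3$. A *stable nodal quilted disk* of combinatorial type $T$ consists of a disk for each vertex $v$ of $T$, with boundary special points (markings or nodes) corresponding to the edges at $v$ in the cyclic order given by the planar structure, and, if $v$ is colored, a circle (seam) in the disk tangent to the boundary at the special point $p_v$ in the direction of the root. Isomorphisms are holomorphic isomorphisms of the components preserving special points and seams. Equivalently, identifying each component with the upper half plane so that $p_v=\infty$: the other special points are real numbers $z_1<\dots<z_m$ (one for each edge at $v$ away from the root), the seam is a horizontal line of height $y>0$, and isomorphisms are maps $z\mapsto az+b$ ($a>0$, $b\in\mathbb{R}$) on each component. Let $M_{n,1,T}$ be the set of isomorphism classes of type $T$ and $\overline{M}_{n,1}=\bigsqcup_T M_{n,1,T}$. Its topology is the one pulled back from a product of extended real lines by all of the following functions. * For $0\le i<j<k<l\le n$, $\rho_{ijkl}=\dfrac{(w_j-w_k)(w_l-w_i)}{(w_i-w_j)(w_k-w_l)}$,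 where $w_i,w_j,w_k,w_l$ are the images of the four markings in a component where no three of them coincide; the value is $-\infty$ if $w_i=w_j$ or $w_k=w_l$, and $0$ if $w_j=w_k$ or $w_i=w_l$. * For $1\le i<j\le n$, let $v$ be the vertex of $T$ at which the paths from the leaves $i$ and $j$ to the root meet. Then $\rho_{ij}=y/(z_j-z_i)$ if $v$ is colored, where $z_i<z_j$ are the images of the markings in the component $v$ and $y$ is the height of its seam; $\rho_{ij}=0$ if $v$ is on the root side of the colored vertices, and $\rho_{ij}=\infty$ if $v$ is on the leaf side. **Weight vectors.** Let $T$ be a maximal colored tree with $n$ leaves, i.e. its colored vertices are bivalent and all others trivalent. For $1\le i\le n-1$ let $v_i$ be the vertex at which the paths from the leaves $i$ and $i+1$ to the root meet, let $a_i$ and $b_i$ be the numbers of leaves on the left and on the right branch at $v_i$, and let $\delta_i=1$ if $v_i$ lies on the root side of the colored vertices and $\delta_i=0$ if it lies on the leaf side. Put $$\mu_T=\Bigl(a_1b_1(1+\delta_1),\dots,a_{n-1}b_{n-1}(1+\delta_{n-1}),\,-\sum_{i=1}^{n-1}\delta_ia_ib_i\Bigr)\in\mathbb{Z}^n\subset\mathbb{R}^n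 .$$ **Statement.** The convex hull $P$ of the (finitely many) vectors $\mu_T$, $T$ ranging over the maximal colored trees with $n$ leaves, is a convex polytope of dimension $n-1$, and $\overline{M}_{n,1}$ is CW-isomorphic to $P$. That is: $\overline{M}_{n,1}$ is a CW complex whose open cells are the sets $M_{n,1,T}$, where $T$ ranges over all stable colored rooted ribbon trees with $n$ leaves; $P$ is a CW complex whose open $k$-cells are the relative interiors of its $k$-dimensional non-empty faces; and there is a homeomorphism $\overline{M}_{n,1}\to P$ that maps, for every $k$, the open $k$-cells of $\overline{M}_{n,1}$ bijectively onto the open $k$-cells of $P$. -/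

import Mathlib

open Set Topology

noncomputable section

namespace Multiplihedron

/-! ### Coloured rooted ribbon trees

A rooted ribbon tree is a planar tree: every vertex carries the ordered list of its branches on the
side away from the root.  The leaves (semi-infinite edges other than the root) carry labels. -/

/-- The part of a stable coloured rooted ribbon tree that lies on the leaf side of the coloured
vertices: every vertex has at least two branches (valence at least three). -/
inductive UTree : Type
  | leaf (i : ℕ) : UTree
  | node (k : ℕ) (c : Fin (k + 2) → UTree) : UTree

/-- Stable coloured rooted ribbon trees.  Every path from a leaf to the root meets exactly one
coloured vertex; a coloured vertex has at least one branch (valence at least two), every other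
vertex at least two branches (valence at least three). -/
inductive CTree : Type
  | colored (k : ℕ) (c : Fin (k + 1) → UTree) : CTree
  | node (k : ℕ) (c : Fin (k + 2) → CTree) : CTree

/-- The labels of the leaves, in the planar order. -/
def UTree.leaves : UTree → List ℕ
  | .leaf i => [i]
  | .node _ c => (List.ofFn fun a => (c a).leaves).flatten

/-- The labels of the leaves, in the planar order. -/
def CTree.leaves : CTree → List ℕ
  | .colored _ c => (List.ofFn fun a => (c a).leaves).flatten
  | .node _ c => (List.ofFn fun a => (c a).leaves).flatten

/-- Combinatorial types of stable `(n+1)`-marked nodal quilted disks: stable coloured rooted ribbon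
trees whose leaves are `1, …, n` in this order (the root carries the marking `0`). -/
def CombType (n : ℕ) : Type := {T : CTree // T.leaves = List.range' 1 n}

/-- Vertices of a tree. -/
inductive UTree.Vert : UTree → Type
  | top {k : ℕ} {c : Fin (k + 2) → UTree} : UTree.Vert (.node k c)
  | sub {k : ℕ} {c : Fin (k + 2) → UTree} (a : Fin (k + 2)) (v : UTree.Vert (c a)) :
      UTree.Vert (.node k c)

/-- Vertices of a coloured tree. -/
inductive CTree.Vert : CTree → Type
  | seam {k : ℕ} {c : Fin (k + 1) → UTree} : CTree.Vert (.colored k c)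
  | inner {k : ℕ} {c : Fin (k + 1) → UTree} (a : Fin (k + 1)) (v : UTree.Vert (c a)) :
      CTree.Vert (.colored k c)
  | top {k : ℕ} {c : Fin (k + 2) → CTree} : CTree.Vert (.node k c)
  | sub {k : ℕ} {c : Fin (k + 2) → CTree} (a : Fin (k + 2)) (v : CTree.Vert (c a)) :
      CTree.Vert (.node k c)

/-- Position of a vertex relative to the coloured vertices: `above` is the root side, `below` is
the leaf side. -/
inductive Level : Type
  | above
  | colored
  | below

/-- The level of a vertex. -/
def CTree.Vert.level : {T : CTree} → T.Vert → Level
  | _, .seam => .colored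
  | _, .inner _ _ => .below
  | _, .top => .above
  | _, .sub _ v => v.level

/-- For every branch at a vertex (in the planar order), the list of leaves on that branch. -/
def UTree.Vert.branches : {T : UTree} → T.Vert → List (List ℕ)
  | _, @UTree.Vert.top _ c => List.ofFn fun a => (c a).leaves
  | _, .sub _ v => v.branches

/-- For every branch at a vertex (in the planar order), the list of leaves on that branch. -/
def CTree.Vert.branches : {T : CTree} → T.Vert → List (List ℕ)
  | _, @CTree.Vert.seam _ c => List.ofFn fun a => (c a).leaves
  | _, .inner _ v => v.branches
  | _, @CTree.Vert.top _ c => List.ofFn fun a => (c a).leaves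
  | _, .sub _ v => v.branches

/-- The number of branches at a vertex (its valence minus one). -/
def CTree.Vert.arity {T : CTree} (v : T.Vert) : ℕ := v.branches.length

open Classical in
/-- The branch at `v` on which the marking `j` lies; `none` if `j` lies in the direction of the
root, as the marking `0` always does. -/
def CTree.Vert.branchOf {T : CTree} (v : T.Vert) (j : ℕ) : Option (Fin v.arity) :=
  if h : ∃ a : Fin v.arity, j ∈ v.branches.get a then some h.choose else none

/-- The leaves `i` and `j` lie on different branches at `v`, i.e. `v` is the vertex at which the
paths from `i` and `j` to the root meet. -/
def CTree.Vert.Separates {T : CTree} (v : T.Vert) (i j : ℕ) : Prop :=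
  v.branchOf i ≠ none ∧ v.branchOf j ≠ none ∧ v.branchOf i ≠ v.branchOf j

open Classical in
/-- The (unique, if it exists) vertex at which the paths from `i` and `j` to the root meet. -/
def CTree.meet (T : CTree) (i j : ℕ) : Option T.Vert :=
  if h : ∃ v : T.Vert, v.Separates i j then some h.choose else none

/-! ### Stable nodal quilted disks

The disk attached to a vertex is identified with the upper half plane so that its special point in
the direction of the root (the marking `0` or a node) is `∞`.  Its other special points are then
real numbers, one for each branch, in increasing order, and the seam of a quilted disk, a circle
tangent to the boundary at the root point, is a horizontal line of height `y > 0`.  Holomorphic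
isomorphisms that fix `∞` are the maps `z ↦ a z + b` with `a > 0`, `b` real. -/

/-- A stable nodal quilted disk of combinatorial type `T`. -/
@[ext]
structure NodalQuiltedDisk (T : CTree) where
  /-- the special points, other than the root point, of the component `v` -/
  z (v : T.Vert) : Fin v.arity → ℝ
  /-- they are distinct and in the order given by the ribbon structure -/
  strictMono (v : T.Vert) : StrictMono (z v)
  /-- the height of the seam of a quilted component -/
  y (v : T.Vert) (hv : v.level = .colored) : ℝ
  y_pos (v : T.Vert) (hv : v.level = .colored) : 0 < y v hv

namespace NodalQuiltedDisk

variable {T : CTree}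

/-- Isomorphism of nodal quilted disks: an isomorphism `z ↦ a z + b` for each component, which
preserves special points and seams. -/
def Iso (S S' : NodalQuiltedDisk T) : Prop :=
  ∀ v : T.Vert, ∃ a b : ℝ, 0 < a ∧ (∀ m, S'.z v m = a * S.z v m + b) ∧
    ∀ hv, S'.y v hv = a * S.y v hv

/-- Isomorphism is an equivalence relation. -/
instance setoid (T : CTree) : Setoid (NodalQuiltedDisk T) where
  r := Iso
  iseqv :=
    { refl := fun _ _ => ⟨1, 0, one_pos, fun _ => by ring, fun _ => by ring⟩
      symm := by
        intro S S' h v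
        obtain ⟨a, b, ha, hz, hy⟩ := h v
        refine ⟨a⁻¹, -(a⁻¹ * b), inv_pos.2 ha, fun m => ?_, fun hv => ?_⟩
        · rw [hz]; field_simp; ring
        · rw [hy]; field_simp
      trans := by
        intro S S' S'' h h' v
        obtain ⟨a, b, ha, hz, hy⟩ := h v
        obtain ⟨a', b', ha', hz', hy'⟩ := h' v
        refine ⟨a' * a, a' * b + b', mul_pos ha' ha, fun m => ?_, fun hv => ?_⟩
        · rw [hz', hz]; ring
        · rw [hy', hy]; ring }

/-- The image of the marking `j` in the component `v`. -/
def image (S : NodalQuiltedDisk T) (v : T.Vert) (j : ℕ) : OnePoint ℝ :=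
  (v.branchOf j).map (S.z v)

end NodalQuiltedDisk

/-! ### Cross-ratios -/

/-- The determinant of `w, w'` in the homogeneous coordinates `x = (x : 1)`, `∞ = (1 : 0)`. -/
def bracket : OnePoint ℝ → OnePoint ℝ → ℝ
  | some x, some x' => x - x'
  | none, some _ => 1
  | some _, none => -1
  | none, none => 0

/-- The difference `w - w'` of two real numbers (`0` if one of the arguments is `∞`). -/
def diff : OnePoint ℝ → OnePoint ℝ → ℝ
  | some x, some x' => x - x'
  | _, _ => 0

open Classical in
/-- The cross-ratio `(w₂ - w₃) (w₄ - w₁) / ((w₁ - w₂) (w₃ - w₄))` of points of the real projective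
line no three of which coincide.  It is used for points in (weak) cyclic order only, where it takes
values in `[-∞, 0]`. -/
def crossRatio (w₁ w₂ w₃ w₄ : OnePoint ℝ) : EReal :=
  if w₁ = w₂ ∨ w₃ = w₄ then ⊥
  else if w₂ = w₃ ∨ w₁ = w₄ then 0
  else if w₁ = w₃ ∨ w₂ = w₄ then 1
  else ((bracket w₂ w₃ * bracket w₄ w₁ / (bracket w₁ w₂ * bracket w₃ w₄) : ℝ) : EReal)

/-- No three of the four entries coincide. -/
def NoThreeEqual {α : Type*} (w : Fin 4 → α) : Prop :=
  ∀ a b c : Fin 4, a ≠ b → a ≠ c → b ≠ c → ¬ (w a = w b ∧ w b = w c)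

namespace NodalQuiltedDisk

variable {T : CTree}

open Classical in
/-- The cross-ratio `ρ_{ijkl}` of the markings `p 0, p 1, p 2, p 3`: the cross-ratio of their images
in a component where no three of these images coincide.  The value is `-∞` (resp. `0`) if a node
separates `p 0, p 1` from `p 2, p 3` (resp. `p 1, p 2` from `p 0, p 3`). -/
def rhoFour (S : NodalQuiltedDisk T) (p : Fin 4 → ℕ) : EReal :=
  if h : ∃ v : T.Vert, NoThreeEqual fun m => v.branchOf (p m) then
    crossRatio (S.image h.choose (p 0)) (S.image h.choose (p 1)) (S.image h.choose (p 2))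
      (S.image h.choose (p 3))
  else 0

/-- The cross-ratio `ρ_{ij}` of the markings `i`, `j` and the seam: on the component where `i`, `j`
and the root are separated it is `y / (z_j - z_i)` if the component is quilted, `0` if it lies on
the root side of the quilted components and `∞` if it lies on the leaf side. -/
def rhoTwo (S : NodalQuiltedDisk T) (i j : ℕ) : EReal :=
  match T.meet i j with
  | none => 0
  | some v =>
    match hv : v.level with
    | .above => 0
    | .below => ⊤
    | .colored => ((S.y v hv / diff (S.image v j) (S.image v i) : ℝ) : EReal)

/-- The affine map `z ↦ a z + b` on the real projective line. -/
def affMap (a b : ℝ) : OnePoint ℝ → OnePoint ℝ := Option.map fun x => a * x + b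

theorem affMap_injective {a : ℝ} (ha : 0 < a) (b : ℝ) : Function.Injective (affMap a b) :=
  Option.map_injective fun x x' h => by
    have h' : a * x + b = a * x' + b := h
    exact mul_left_cancel₀ ha.ne' (by linarith)

theorem crossRatio_affMap {a : ℝ} (ha : 0 < a) (b : ℝ) (w₁ w₂ w₃ w₄ : OnePoint ℝ) :
    crossRatio (affMap a b w₁) (affMap a b w₂) (affMap a b w₃) (affMap a b w₄) =
      crossRatio w₁ w₂ w₃ w₄ := by
  have hi : ∀ x x', affMap a b x = affMap a b x' ↔ x = x' :=
    fun x x' => (affMap_injective ha b).eq_iff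
  have h1 : (affMap a b w₁ = affMap a b w₂ ∨ affMap a b w₃ = affMap a b w₄) ↔
      (w₁ = w₂ ∨ w₃ = w₄) := or_congr (hi _ _) (hi _ _)
  have h2 : (affMap a b w₂ = affMap a b w₃ ∨ affMap a b w₁ = affMap a b w₄) ↔
      (w₂ = w₃ ∨ w₁ = w₄) := or_congr (hi _ _) (hi _ _)
  have h3 : (affMap a b w₁ = affMap a b w₃ ∨ affMap a b w₂ = affMap a b w₄) ↔
      (w₁ = w₃ ∨ w₂ = w₄) := or_congr (hi _ _) (hi _ _)
  unfold crossRatio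
  by_cases c1 : w₁ = w₂ ∨ w₃ = w₄
  · rw [if_pos c1, if_pos (h1.2 c1)]
  rw [if_neg c1, if_neg (fun h => c1 (h1.1 h))]
  by_cases c2 : w₂ = w₃ ∨ w₁ = w₄
  · rw [if_pos c2, if_pos (h2.2 c2)]
  rw [if_neg c2, if_neg (fun h => c2 (h2.1 h))]
  by_cases c3 : w₁ = w₃ ∨ w₂ = w₄
  · rw [if_pos c3, if_pos (h3.2 c3)]
  rw [if_neg c3, if_neg (fun h => c3 (h3.1 h))]
  clear h1 h2 h3 hi
  push Not at c1 c2 c3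
  have ha' := ha.ne'
  congr 1
  rcases w₁ with _ | w₁ <;> rcases w₂ with _ | w₂ <;> rcases w₃ with _ | w₃ <;>
    rcases w₄ with _ | w₄ <;> simp [affMap, bracket, ← mul_sub] at c1 c2 c3 ⊢
  all_goals first
    | (rw [mul_mul_mul_comm, mul_mul_mul_comm a _ a, mul_div_mul_left _ _ (mul_ne_zero ha' ha')])
    | (rw [neg_div, mul_div_mul_left _ _ ha', ← neg_div, neg_sub])
    | (rw [div_neg, mul_div_mul_left _ _ ha', ← div_neg, neg_sub])

theorem image_of_iso {S S' : NodalQuiltedDisk T} {v : T.Vert} {a b : ℝ}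
    (hz : ∀ m, S'.z v m = a * S.z v m + b) (j : ℕ) :
    S'.image v j = affMap a b (S.image v j) := by
  unfold image affMap
  rw [Option.map_map]
  congr 1
  funext m
  exact hz m

theorem rhoFour_congr {S S' : NodalQuiltedDisk T} (h : Iso S S') (p : Fin 4 → ℕ) :
    S.rhoFour p = S'.rhoFour p := by
  unfold rhoFour
  split_ifs with hv
  · obtain ⟨a, b, ha, hz, -⟩ := h hv.choose
    simp only [image_of_iso hz, crossRatio_affMap ha]
  · rfl

theorem rhoTwo_congr {S S' : NodalQuiltedDisk T} (h : Iso S S') (i j : ℕ) :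
    S.rhoTwo i j = S'.rhoTwo i j := by
  unfold rhoTwo
  rcases T.meet i j with _ | v
  · rfl
  · obtain ⟨a, b, ha, hz, hy⟩ := h v
    dsimp only
    split
    · rfl
    · rfl
    · rename_i hv
      rw [image_of_iso hz, image_of_iso hz, hy hv]
      congr 1
      rcases S.image v j with _ | x <;> rcases S.image v i with _ | x' <;>
        simp [affMap, diff, ← mul_sub, mul_div_mul_left _ _ ha.ne']

end NodalQuiltedDisk

/-! ### The moduli space -/

/-- The set `M_{n,1,T}` of isomorphism classes of stable nodal quilted disks of type `T`. -/
def ModuliOfType (T : CTree) : Type := Quotient (NodalQuiltedDisk.setoid T)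

/-- The moduli space of stable `(n+1)`-marked nodal quilted disks: the union of the sets
`M_{n,1,T}` over all combinatorial types `T`. -/
def Mbar (n : ℕ) : Type := Σ T : CombType n, ModuliOfType T.1

namespace Mbar

variable {n : ℕ}

/-- The set `M_{n,1,T}` as a subset of the moduli space. -/
def stratum (T : CombType n) : Set (Mbar n) := {S | S.1 = T}

/-- The cross-ratio `ρ_{ijkl}` on the moduli space. -/
def rhoFour (S : Mbar n) (p : Fin 4 → ℕ) : EReal :=
  Quotient.lift (fun s : NodalQuiltedDisk S.1.1 => s.rhoFour p)
    (fun _ _ h => NodalQuiltedDisk.rhoFour_congr h p) S.2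

/-- The cross-ratio `ρ_{ij}` on the moduli space. -/
def rhoTwo (S : Mbar n) (i j : ℕ) : EReal :=
  Quotient.lift (fun s : NodalQuiltedDisk S.1.1 => s.rhoTwo i j)
    (fun _ _ h => NodalQuiltedDisk.rhoTwo_congr h i j) S.2

/-- All the cross-ratios `ρ_{ijkl}` with `0 ≤ i < j < k < l ≤ n` and `ρ_{ij}` with
`1 ≤ i < j ≤ n`. -/
def crossRatios (S : Mbar n) :
    ((Fin 4 ↪o Fin (n + 1)) → EReal) ×
      ({p : Fin (n + 1) × Fin (n + 1) // 0 < p.1 ∧ p.1 < p.2} → EReal) :=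
  (fun p => S.rhoFour fun m => p m, fun p => S.rhoTwo p.1.1 p.1.2)

/-- The topology of the moduli space is pulled back along the cross-ratios. -/
instance : TopologicalSpace (Mbar n) := TopologicalSpace.induced crossRatios inferInstance

end Mbar

/-! ### Weight vectors -/

/-- A maximal coloured tree: coloured vertices are bivalent, all others trivalent. -/
def CTree.IsMaximal (T : CTree) : Prop :=
  ∀ v : T.Vert, (v.level = .colored → v.arity = 1) ∧ (v.level ≠ .colored → v.arity = 2)

/-- The number of leaves on the branch at `v` that contains the leaf `j`. -/
def CTree.Vert.leafCount {T : CTree} (v : T.Vert) (j : ℕ) : ℕ :=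
  match v.branchOf j with
  | none => 0
  | some a => (v.branches.get a).length

/-- The product `a_i b_i` of the numbers of leaves on the left and on the right side of `v_i`, the
vertex at which the paths from the leaves `i` and `i + 1` to the root meet. -/
def CTree.leafProd (T : CTree) (i : ℕ) : ℤ :=
  match T.meet i (i + 1) with
  | none => 0
  | some v => v.leafCount i * v.leafCount (i + 1)

/-- `δ_i` is `1` if `v_i` lies above the coloured vertices (on the root side), `0` if below. -/
def CTree.delta (T : CTree) (i : ℕ) : ℤ :=
  match T.meet i (i + 1) with
  | none => 0
  | some v =>
    match v.level with
    | .above => 1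
    | _ => 0

/-- The weight vector
`μ_T = (a₁ b₁ (1 + δ₁), …, a_{n-1} b_{n-1} (1 + δ_{n-1}), - ∑ δ_i a_i b_i)` of a maximal
coloured tree with leaves `1, …, n`; the entry with index `m : Fin n` is the `(m + 1)`-st one. -/
def weight {n : ℕ} (T : CombType n) (m : Fin n) : ℤ :=
  if (m : ℕ) + 1 < n then T.1.leafProd (m + 1) * (1 + T.1.delta (m + 1))
  else - ∑ i ∈ Finset.Ico 1 n, T.1.delta i * T.1.leafProd i

/-- The set of weight vectors in `ℝⁿ`. -/
def weightVectors (n : ℕ) : Set (EuclideanSpace ℝ (Fin n)) :=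
  {x | ∃ T : CombType n, T.1.IsMaximal ∧ ∀ m, x m = weight T m}

/-- The convex hull of the weight vectors. -/
def weightPolytope (n : ℕ) : Set (EuclideanSpace ℝ (Fin n)) := convexHull ℝ (weightVectors n)

/-! ### CW structures -/

/-- The collection of open `k`-cells of a CW complex. -/
def openCells {X : Type} [TopologicalSpace X] {C : Set X} (K : CWComplex C) (k : ℕ) :
    Set (Set X) :=
  {e | ∃ i : K.cell k, e = K.map k i '' Metric.ball 0 1}

/-- `F` is a non-empty face of the convex set `P` of dimension `k`. -/
def IsFaceOfDim {E : Type*} [NormedAddCommGroup E] [NormedSpace ℝ E] (P F : Set E) (k : ℕ) : Prop :=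
  F.Nonempty ∧ IsExposed ℝ P F ∧ Module.finrank ℝ (vectorSpan ℝ F) = k

end Multiplihedron

end

/-! A quilted disk with n leaves is described by n positive quantities up to a common scale: the
lengths of the n-1 gaps between neighbouring leaves and the height of the seam. Degeneration means
that these quantities acquire different orders of magnitude. Within a set of such quantities only
the ratios among those of highest order survive, that is, a probability distribution supported on
the highest ones. An order `u` together with weights `t` thus gives a distribution `cond u t s` on
every set `s`, and the resulting families are the conditional systems of `systems`. The sets that
matter here are the intervals of gaps between two leaves, with and without the seam (`family`).

The moduli space is the space of conditional systems on `family n`. The order determines the tree: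
cut at the highest gaps first, and insert the colored vertex once no remaining gap is higher than
the seam (`CTree.exists_realizes_of_height`, `CTree.eq_of_realizes`); the weights give the special
points and the seams. So `Mbar.system` is a bijection onto `systems (family n)`, and the supports of
the distributions are a complete invariant of the combinatorial type (`combType_eq_iff`). The
cross-ratios are continuous functions of the system which determine it (`Mbar.crossRatios_eq`,
`invariants_injOn`); as the space of systems is compact, they induce its own topology
(`Mbar.isInducing_system`).

The space of systems is in turn a polytope, by the moment map that adds up all distributions. Its
image is a Minkowski sum of simplices: it is onto because a regularised log-partition function has a
minimum (`exists_system_sum_eq`), and one-to-one by stochastic domination under monotone likelihood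
ratios (`eq_of_sum_eq`). The face of the sum in direction `u` is the sum of the faces of the
summands, and its relative interior is the image of the systems supported exactly on these faces
(`moment_cond_mem_intrinsicInterior_iff`). Hence strata correspond to open faces.

For a maximal tree all distributions are point masses. Each of the a_i b_i pairs of leaves that meet
at v_i contributes a unit at gap i, and a second one at gap i or at the seam according to δ_i; after
translation by `offset` the sum is μ_T (`Fits.weight_eq`). Functionals without ties are maximised at
maximal trees, so the convex hull of the weight vectors is the whole Minkowski sum
(`weightPolytope_eq`). Both CW structures come from the faces of this one polytope through
`FaceComplex.exists_cwComplex`. -/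

noncomputable section

namespace Multiplihedron

/-! ### Conditional systems -/

section Cond

variable {ι : Type*}

open Classical in
/-- The elements of `s` at which `u` is maximal. -/
def top (u : ι → ℝ) (s : Finset ι) : Finset ι := s.filter fun g => ∀ h ∈ s, u h ≤ u g

open Classical in
/-- The probability distribution on `s` that is proportional to `t` on the elements of highest
level `u` and vanishes elsewhere. -/
def cond (u t : ι → ℝ) (s : Finset ι) (g : ι) : ℝ :=
  if g ∈ top u s then t g / ∑ h ∈ top u s, t h else 0

theorem mem_top {u : ι → ℝ} {s : Finset ι} {g : ι} :
    g ∈ top u s ↔ g ∈ s ∧ ∀ h ∈ s, u h ≤ u g := by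
  simp [top]

theorem top_subset (u : ι → ℝ) (s : Finset ι) : top u s ⊆ s := Finset.filter_subset _ _

theorem top_nonempty (u : ι → ℝ) {s : Finset ι} (hs : s.Nonempty) : (top u s).Nonempty := by
  obtain ⟨g, hg, h⟩ := s.exists_max_image u hs
  exact ⟨g, mem_top.2 ⟨hg, h⟩⟩

theorem top_zero (s : Finset ι) : top (0 : ι → ℝ) s = s := by
  ext; simp [mem_top]

variable {u t : ι → ℝ} {s s' : Finset ι} {g : ι}

theorem cond_of_mem (h : g ∈ top u s) : cond u t s g = t g / ∑ h ∈ top u s, t h := if_pos h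

theorem cond_of_notMem (h : g ∉ top u s) : cond u t s g = 0 := if_neg h

theorem cond_of_notMem_set (h : g ∉ s) : cond u t s g = 0 :=
  cond_of_notMem fun h' => h (top_subset _ _ h')

theorem sum_top_pos (ht : ∀ g, 0 < t g) (hs : s.Nonempty) : 0 < ∑ h ∈ top u s, t h :=
  Finset.sum_pos (fun _ _ => ht _) (top_nonempty _ hs)

theorem cond_pos (ht : ∀ g, 0 < t g) (h : g ∈ top u s) : 0 < cond u t s g := by
  rw [cond_of_mem h]
  exact div_pos (ht g) (sum_top_pos ht ⟨g, top_subset _ _ h⟩)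

theorem cond_nonneg (ht : ∀ g, 0 < t g) : 0 ≤ cond u t s g := by
  by_cases h : g ∈ top u s
  · exact (cond_pos ht h).le
  · exact (cond_of_notMem h).ge

theorem cond_pos_iff (ht : ∀ g, 0 < t g) : 0 < cond u t s g ↔ g ∈ top u s :=
  ⟨fun h => by_contra fun h' => h.ne' (cond_of_notMem h'), cond_pos ht⟩

theorem sum_cond (ht : ∀ g, 0 < t g) (hs : s.Nonempty) : ∑ g ∈ s, cond u t s g = 1 := by
  rw [← Finset.sum_subset (top_subset u s) fun g _ h => cond_of_notMem h,
    Finset.sum_congr rfl fun g h => cond_of_mem h, ← Finset.sum_div,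
    div_self (sum_top_pos ht hs).ne']

/-- A conditional distribution is determined up to scaling by its restriction to the support. -/
theorem cond_eq_div {w : ι → ℝ} {c : ℝ} (hc : 0 < c)
    (h1 : ∀ g ∈ top u s, w g = c * t g) (h0 : ∀ g ∈ s, g ∉ top u s → w g = 0) (hg : g ∈ s) :
    cond u t s g = w g / ∑ h ∈ s, w h := by
  have hsum : ∑ h ∈ s, w h = c * ∑ h ∈ top u s, t h := by
    rw [← Finset.sum_subset (top_subset u s) h0, Finset.sum_congr rfl h1, Finset.mul_sum]
  by_cases h : g ∈ top u s
  · rw [cond_of_mem h, hsum, h1 g h, mul_div_mul_left _ _ hc.ne']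
  · rw [cond_of_notMem h, h0 g hg h, zero_div]

/-- Compatibility of the conditional distributions on `s ⊆ s'`. -/
theorem cond_consistent (ht : ∀ g, 0 < t g) (hss : s ⊆ s') (hg : g ∈ s) :
    cond u t s' g = (∑ h ∈ s, cond u t s' h) * cond u t s g := by
  have hs : s.Nonempty := ⟨g, hg⟩
  -- If `s` meets the support of the distribution on `s'`, the highest elements of `s` are exactly
  -- the highest elements of `s'` that lie in `s`. Otherwise `s` has mass zero and both sides
  -- vanish.
  by_cases hk : ∃ k ∈ s, k ∈ top u s'
  · obtain ⟨k, hks, hk⟩ := hk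
    have hkpos : 0 < ∑ h ∈ top u s', t h := sum_top_pos ht (hs.mono hss)
    have key : ∀ h ∈ s, h ∈ top u s' ↔ h ∈ top u s := by
      intro h hh
      simp only [mem_top] at hk ⊢
      constructor
      · exact fun h' => ⟨hh, fun m hm => h'.2 m (hss hm)⟩
      · exact fun h' => ⟨hss hh, fun m hm => (hk.2 m hm).trans (h'.2 k hks)⟩
    have h2 : 0 < ∑ h ∈ s, cond u t s' h :=
      Finset.sum_pos' (fun _ _ => cond_nonneg ht) ⟨k, hks, cond_pos ht hk⟩
    rw [cond_eq_div (w := cond u t s') (inv_pos.2 hkpos) ?_ ?_ hg, mul_div_cancel₀ _ h2.ne']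
    · intro h hh
      rw [cond_of_mem ((key h (top_subset _ _ hh)).2 hh)]
      ring
    · intro h hh hh'
      exact cond_of_notMem fun h'' => hh' ((key h hh).1 h'')
  · push Not at hk
    rw [cond_of_notMem (hk g hg), Finset.sum_eq_zero fun h hh => cond_of_notMem (hk h hh), zero_mul]

end Cond

/-! ### The space of conditional systems -/

section Systems

variable {ι A : Type*}

/-- The conditional systems on the family `S` of finite sets. -/
def systems (S : A → Finset ι) : Set (A → ι → ℝ) :=
  {x | ∃ u t : ι → ℝ, (∀ g, 0 < t g) ∧ x = fun α => cond u t (S α)}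

/-- The conditional systems all of whose distributions have full support. -/
def openSystems (S : A → Finset ι) : Set (A → ι → ℝ) :=
  {x | ∃ t : ι → ℝ, (∀ g, 0 < t g) ∧ x = fun α => cond 0 t (S α)}

/-- The weights `t * exp (k u)` turn levels into orders of growth. After division by `exp (k * u
m)`, with `m` on the top level, the terms of lower level tend to zero and the others are constant.
-/
theorem tendsto_cond {u t : ι → ℝ} (ht : ∀ g, 0 < t g) (s : Finset ι) (g : ι) :
    Filter.Tendsto (fun k : ℕ => cond 0 (fun h => t h * Real.exp (k * u h)) s g) Filter.atTop
      (𝓝 (cond u t s g)) := by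
  by_cases hg : g ∈ s
  swap
  · simp only [cond_of_notMem_set hg]
    exact tendsto_const_nhds
  have hs : s.Nonempty := ⟨g, hg⟩
  obtain ⟨m, hm⟩ := top_nonempty u hs
  have hm' := mem_top.1 hm
  have hterm : ∀ h ∈ s, Filter.Tendsto (fun k : ℕ => t h * Real.exp (k * (u h - u m))) Filter.atTop
      (𝓝 (if u h = u m then t h else 0)) := by
    intro h hh
    split_ifs with heq
    · simp [heq]
    · have hlt : u h - u m < 0 := sub_neg.2 (lt_of_le_of_ne (hm'.2 h hh) heq)
      have : Filter.Tendsto (fun k : ℕ => (k : ℝ) * (u h - u m)) Filter.atTop Filter.atBot :=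
        Filter.Tendsto.atTop_mul_const_of_neg hlt tendsto_natCast_atTop_atTop
      simpa using (Real.tendsto_exp_atBot.comp this).const_mul (t h)
  have htop : ∀ h ∈ s, h ∈ top u s ↔ u h = u m := by
    intro h hh
    rw [mem_top]
    constructor
    · exact fun h' => le_antisymm (hm'.2 h hh) (h'.2 m hm'.1)
    · exact fun h' => ⟨hh, fun k hk => h' ▸ hm'.2 k hk⟩
  have h0 : ∀ k : ℕ, cond 0 (fun h => t h * Real.exp (k * u h)) s g =
      t g * Real.exp (k * (u g - u m)) / ∑ h ∈ s, t h * Real.exp (k * (u h - u m)) := by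
    intro k
    refine cond_eq_div (w := fun h => t h * Real.exp (k * (u h - u m)))
      (Real.exp_pos (-(k * u m))) ?_ ?_ hg
    · intro h _
      rw [mul_left_comm, ← Real.exp_add]
      ring_nf
    · intro h hh hh'
      rw [top_zero] at hh'
      exact absurd hh hh'
  have h1 : cond u t s g = (if u g = u m then t g else 0) /
      ∑ h ∈ s, if u h = u m then t h else 0 := by
    refine cond_eq_div (w := fun h => if u h = u m then t h else 0) one_pos ?_ ?_ hg
    · intro h hh
      rw [if_pos ((htop h (top_subset _ _ hh)).1 hh), one_mul]
    · intro h hh hh'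
      exact if_neg fun h' => hh' ((htop h hh).2 h')
  simp only [h0, h1]
  refine (hterm g hg).div (tendsto_finsetSum _ hterm) (ne_of_gt ?_)
  refine Finset.sum_pos' (fun h _ => ?_) ⟨m, hm'.1, ?_⟩
  · split_ifs
    · exact (ht h).le
    · exact le_rfl
  · simpa using ht m

/-- Closed conditions need only be verified for systems of full support; injectivity of the moment
map is proved this way. -/
theorem systems_subset_closure (S : A → Finset ι) : systems S ⊆ closure (openSystems S) := by
  rintro _ ⟨u, t, ht, rfl⟩
  refine mem_closure_of_tendsto (f := fun (k : ℕ) α => cond 0 (fun h => t h * Real.exp (k * u h))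
    (S α)) (b := Filter.atTop) ?_ (Filter.Eventually.of_forall fun k => ?_)
  · rw [tendsto_pi_nhds]
    intro α
    rw [tendsto_pi_nhds]
    exact fun g => tendsto_cond ht _ g
  · exact ⟨_, fun g => mul_pos (ht g) (Real.exp_pos _), rfl⟩

/-- A compatible family of distributions on all finite sets is a conditional system. -/
theorem mem_systems_of_consistent [Fintype ι] {x : Finset ι → ι → ℝ} (h0 : ∀ s g, 0 ≤ x s g)
    (hout : ∀ s, ∀ g ∉ s, x s g = 0) (h1 : ∀ s : Finset ι, s.Nonempty → ∑ g ∈ s, x s g = 1)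
    (hc : ∀ s s' : Finset ι, s ⊆ s' → ∀ g ∈ s, x s' g = (∑ h ∈ s, x s' h) * x s g) :
    x ∈ systems (id : Finset ι → Finset ι) := by
  classical
  have hle : ∀ s s' : Finset ι, s ⊆ s' → ∀ g ∈ s, 0 < x s' g → 0 < x s g := by
    intro s s' hss g hg h
    rcases (h0 s g).lt_or_eq with h' | h'
    · exact h'
    · rw [hc s s' hss g hg, ← h', mul_zero] at h
      exact absurd h (lt_irrefl _)
  have hge : ∀ s s' : Finset ι, s ⊆ s' → ∀ g ∈ s, 0 < x s g → ∀ h ∈ s, 0 < x s' h → 0 < x s' g := by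
    intro s s' hss g hg h k hk hk'
    rw [hc s s' hss g hg]
    exact mul_pos (Finset.sum_pos' (fun _ _ => h0 _ _) ⟨k, hk, hk'⟩) h
  -- the union of all sets in which `g` has positive probability
  let D : ι → Finset ι := fun g => Finset.univ.filter fun h => ∃ s : Finset ι, h ∈ s ∧ 0 < x s g
  have mem_of_pos : ∀ s g, 0 < x s g → g ∈ s := fun s g h =>
    by_contra fun h' => h.ne' (hout s g h')
  have hunion : ∀ g (s s' : Finset ι), 0 < x s g → 0 < x s' g → 0 < x (s ∪ s') g := by
    intro g s s' hs hs'
    have hg := mem_of_pos s g hs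
    have hg' := mem_of_pos s' g hs'
    obtain ⟨k, hk, hk'⟩ : ∃ k ∈ s ∪ s', 0 < x (s ∪ s') k := by
      by_contra! h
      have := h1 (s ∪ s') ⟨g, Finset.mem_union_left _ hg⟩
      rw [Finset.sum_eq_zero fun k hk => le_antisymm (h k hk) (h0 _ _)] at this
      exact zero_ne_one this
    rcases Finset.mem_union.1 hk with hk2 | hk2
    · exact hge _ _ Finset.subset_union_left g hg hs k hk2 hk'
    · exact hge _ _ Finset.subset_union_right g hg' hs' k hk2 hk'
  have hself : ∀ g, 0 < x {g} g := fun g => by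
    have := h1 {g} (Finset.singleton_nonempty g)
    rw [Finset.sum_singleton] at this
    rw [this]; exact one_pos
  have hDsub : ∀ s g, 0 < x s g → s ⊆ D g := fun s g hs h hh => by
    simp only [D, Finset.mem_filter, Finset.mem_univ, true_and]
    exact ⟨s, hh, hs⟩
  -- The sets that give `g` positive probability are closed under union by `hunion`, so their finite
  -- union `D g` is again one of them.
  have hD : ∀ g, 0 < x (D g) g := by
    intro g
    have : ∀ B : Finset ι, B ⊆ D g → ∃ s, B ⊆ s ∧ 0 < x s g := by
      intro B
      induction B using Finset.induction_on with
      | empty => exact fun _ => ⟨{g}, Finset.empty_subset _, hself g⟩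
      | insert a B ha ih =>
        intro hB
        obtain ⟨s, hs, hs'⟩ := ih ((Finset.subset_insert _ _).trans hB)
        have ha' := hB (Finset.mem_insert_self a B)
        simp only [D, Finset.mem_filter, Finset.mem_univ, true_and] at ha'
        obtain ⟨s', has', hxs'⟩ := ha'
        refine ⟨s ∪ s', ?_, hunion g s s' hs' hxs'⟩
        rw [Finset.insert_subset_iff]
        exact ⟨Finset.mem_union_right _ has', hs.trans Finset.subset_union_left⟩
    obtain ⟨s, hs, hs'⟩ := this (D g) subset_rfl
    rwa [hs.antisymm (hDsub s g hs')]
  -- `D h` is contained in `D g` for `h ∈ D g`, with equality iff `h` is in the support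
  have hDD : ∀ g h, h ∈ D g → D h ⊆ D g ∧ (0 < x (D g) h ↔ D h = D g) := by
    intro g h hh
    have hg := mem_of_pos _ _ (hD g)
    have hh' := mem_of_pos _ _ (hD h)
    have heq : 0 < x (D g) h → D h = D g := by
      intro hpos
      refine Finset.Subset.antisymm (hDsub _ _ ?_) (hDsub _ _ hpos)
      have := hunion h _ _ (hD h) hpos
      exact hge (D g) (D h ∪ D g) Finset.subset_union_right g hg (hD g) h hh this |> fun h2 =>
        hle (D h) (D h ∪ D g) Finset.subset_union_left g
          (by have := hDsub _ _ hpos hg; exact this) h2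
    refine ⟨?_, heq, fun h2 => h2 ▸ hD h⟩
    by_cases hpos : 0 < x (D g) h
    · exact (heq hpos).subset
    obtain ⟨k, hk, hk'⟩ : ∃ k ∈ D g ∪ D h, 0 < x (D g ∪ D h) k := by
      by_contra! hn
      have := h1 (D g ∪ D h) ⟨g, Finset.mem_union_left _ hg⟩
      rw [Finset.sum_eq_zero fun k hk => le_antisymm (hn k hk) (h0 _ _)] at this
      exact zero_ne_one this
    have : ¬ 0 < x (D g ∪ D h) h := fun h2 =>
      hpos (hle _ _ Finset.subset_union_left h hh h2)
    rcases Finset.mem_union.1 hk with hk2 | hk2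
    · have h3 := hge _ _ Finset.subset_union_left g hg (hD g) k hk2 hk'
      exact Finset.subset_union_right.trans (hDsub _ _ h3)
    · exact absurd (hge _ _ Finset.subset_union_right h hh' (hD h) k hk2 hk') this
  -- By `hDD` a lower level means a strictly smaller set `D g`, so its cardinality serves as the
  -- level. Elements of equal level inside a common `D g` share this set, so their weights come from
  -- one distribution.
  refine ⟨fun g => ((D g).card : ℝ), fun g => x (D g) g, hD, ?_⟩
  funext s g
  by_cases hg : g ∈ s
  swap
  · rw [hout s g hg]; exact (cond_of_notMem_set hg).symm
  obtain ⟨m, hm⟩ := top_nonempty (fun g => ((D g).card : ℝ)) ⟨g, hg⟩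
  obtain ⟨k, hk, hkpos⟩ : ∃ k ∈ s, 0 < x s k := by
    by_contra! h
    have := h1 s ⟨g, hg⟩
    rw [Finset.sum_eq_zero fun k hk => le_antisymm (h k hk) (h0 _ _)] at this
    exact zero_ne_one this
  -- The distribution on `s` is that on `D k` conditioned to `s`, so both sides become `x (D k)`
  -- normalised over `s`.
  have hsD := hDsub s k hkpos
  have htop : ∀ h ∈ s, h ∈ top (fun g => ((D g).card : ℝ)) s ↔ 0 < x (D k) h := by
    intro h hh
    rw [mem_top, (hDD k h (hsD hh)).2]
    constructor
    · intro h2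
      exact Finset.eq_of_subset_of_card_le (hDD k h (hsD hh)).1 (by exact_mod_cast h2.2 k hk)
    · intro h2
      refine ⟨hh, fun l hl => ?_⟩
      rw [h2]
      exact_mod_cast Finset.card_le_card (hDD k l (hsD hl)).1
  have hpos : 0 < ∑ h ∈ s, x (D k) h := Finset.sum_pos' (fun _ _ => h0 _ _) ⟨k, hk, hD k⟩
  have e1 : cond (fun g => ((D g).card : ℝ)) (fun g => x (D g) g) s g =
      x (D k) g / ∑ h ∈ s, x (D k) h := by
    refine cond_eq_div one_pos ?_ ?_ hg
    · intro h hh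
      have hh' := top_subset _ _ hh
      have := (hDD k h (hsD hh')).2.1 ((htop h hh').1 hh)
      rw [one_mul, this]
    · intro h hh hh'
      exact le_antisymm (not_lt.1 fun h2 => hh' ((htop h hh).2 h2)) (h0 _ _)
  refine Eq.trans ?_ e1.symm
  rw [hc s (D k) hsD g hg, mul_div_cancel_left₀ _ hpos.ne']

end Systems

/-! ### Compactness of the space of conditional systems -/

section Systems

variable {ι A : Type*} [Fintype ι]

/-- On the family of all finite sets, conditional systems are characterised by closed conditions
(nonnegativity, support, total mass, compatibility), by `mem_systems_of_consistent`; all entries lie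
in [0, 1]. -/
theorem isCompact_systems_id : IsCompact (systems (id : Finset ι → Finset ι)) := by
  have hcl : IsClosed (systems (id : Finset ι → Finset ι)) := by
    refine isClosed_of_closure_subset fun x hx => ?_
    replace hx := closure_mono (t := {x : Finset ι → ι → ℝ | (∀ s g, 0 ≤ x s g) ∧
      (∀ s, ∀ g ∉ s, x s g = 0) ∧ (∀ s : Finset ι, s.Nonempty → ∑ g ∈ s, x s g = 1) ∧
      ∀ s s' : Finset ι, s ⊆ s' → ∀ g ∈ s, x s' g = (∑ h ∈ s, x s' h) * x s g}) ?_ hx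
    · rw [IsClosed.closure_eq] at hx
      · exact mem_systems_of_consistent hx.1 hx.2.1 hx.2.2.1 hx.2.2.2
      · simp only [ofPred_and, ofPred_forall]
        refine IsClosed.inter ?_ (IsClosed.inter ?_ (IsClosed.inter ?_ ?_))
        · exact isClosed_iInter fun s => isClosed_iInter fun g =>
            isClosed_le continuous_const (by fun_prop)
        · exact isClosed_iInter fun s => isClosed_iInter fun g => isClosed_iInter fun _ =>
            isClosed_eq (by fun_prop) continuous_const
        · exact isClosed_iInter fun s => isClosed_iInter fun _ =>
            isClosed_eq (by fun_prop) continuous_const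
        · exact isClosed_iInter fun s => isClosed_iInter fun s' => isClosed_iInter fun _ =>
            isClosed_iInter fun g => isClosed_iInter fun _ =>
            isClosed_eq (by fun_prop) (by fun_prop)
    · rintro _ ⟨u, t, ht, rfl⟩
      exact ⟨fun s g => cond_nonneg ht, fun s g hg => cond_of_notMem_set hg,
        fun s hs => sum_cond ht hs, fun s s' hss g hg => cond_consistent ht hss hg⟩
  have hsub : systems (id : Finset ι → Finset ι) ⊆
      Set.pi univ fun _ : Finset ι => Set.pi univ fun _ : ι => Icc (0 : ℝ) 1 := by
    rintro _ ⟨u, t, ht, rfl⟩ s - g -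
    refine ⟨cond_nonneg ht, ?_⟩
    by_cases hg : g ∈ s
    · rw [← sum_cond (u := u) ht ⟨g, hg⟩]
      exact Finset.single_le_sum (f := fun g => cond u t s g) (fun _ _ => cond_nonneg ht) hg
    · exact (cond_of_notMem_set hg).trans_le zero_le_one
  exact (isCompact_univ_pi fun _ => isCompact_univ_pi fun _ => isCompact_Icc).of_isClosed_subset
    hcl hsub

/-- For a general family, compatibility within the family does not force a common order: it is
vacuous for three pairs in a three-element set. Compactness is therefore inherited by projection
from the family of all sets. -/
theorem isCompact_systems (S : A → Finset ι) : IsCompact (systems S) := by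
  have : systems S = (fun (x : Finset ι → ι → ℝ) α => x (S α)) '' systems id := by
    ext x
    constructor
    · rintro ⟨u, t, ht, rfl⟩
      exact ⟨_, ⟨u, t, ht, rfl⟩, rfl⟩
    · rintro ⟨_, ⟨u, t, ht, rfl⟩, rfl⟩
      exact ⟨u, t, ht, rfl⟩
  rw [this]
  exact isCompact_systems_id.image (by fun_prop)

end Systems

/-! ### Injectivity of the moment map -/

section Injective

variable {A : Type*} {n : ℕ}

/-- The pairs of systems for which the second one gives larger probability to all upper sets of a
linear order on the ground set. -/
def dominated (A : Type*) {n : ℕ} (σ : Equiv.Perm (Fin n)) :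
    Set ((A → Fin n → ℝ) × (A → Fin n → ℝ)) :=
  {p | ∀ α (m : ℕ), ∑ g with m ≤ (σ g : ℕ), p.1 α g ≤ ∑ g with m ≤ (σ g : ℕ), p.2 α g}

theorem isClosed_dominated (A : Type*) {n : ℕ} (σ : Equiv.Perm (Fin n)) :
    IsClosed (dominated A σ) := by
  simp only [dominated, ofPred_forall]
  exact isClosed_iInter fun α => isClosed_iInter fun m => isClosed_le (by fun_prop) (by fun_prop)

/-- Monotone likelihood ratio: let `σ` order the ground set by `t' / t`. On every set of the family
the ratio of the two distributions is a constant times `t' / t`, so passing from `t` to `t'` moves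
mass upwards. The order does not depend on the set, so one `σ` serves all indices. -/
theorem exists_mem_dominated {S : A → Finset (Fin n)} {x x' : A → Fin n → ℝ}
    (hx : x ∈ openSystems S) (hx' : x' ∈ openSystems S) : ∃ σ, (x, x') ∈ dominated A σ := by
  classical
  obtain ⟨t, ht, rfl⟩ := hx
  obtain ⟨t', ht', rfl⟩ := hx'
  refine ⟨(Tuple.sort fun g => t' g / t g).symm, fun α m => ?_⟩
  have hmono := Tuple.monotone_sort fun g => t' g / t g
  set τ := Tuple.sort fun g => t' g / t g
  set U : Finset (Fin n) := Finset.univ.filter fun g => m ≤ ((τ.symm g : Fin n) : ℕ) with hU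
  have hr : ∀ g ∈ U, ∀ h ∉ U, t' h * t g ≤ t' g * t h := by
    intro g hg h hh
    simp only [hU, Finset.mem_filter, Finset.mem_univ, true_and, not_le] at hg hh
    have := hmono (show τ.symm h ≤ τ.symm g from Fin.le_def.2 (hh.le.trans hg))
    simp only [Function.comp_apply, Equiv.apply_symm_apply] at this
    rwa [div_le_div_iff₀ (ht _) (ht _)] at this
  by_cases hs : (S α).Nonempty
  swap
  · rw [Finset.not_nonempty_iff_eq_empty] at hs
    simp [hs, cond_of_notMem_set]
  have hval : ∀ t : Fin n → ℝ, (∀ g, 0 < t g) → ∑ g ∈ U, cond 0 t (S α) g =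
      (∑ g ∈ S α with g ∈ U, t g) / (∑ g ∈ S α with g ∈ U, t g + ∑ g ∈ S α with g ∉ U, t g) := by
    intro t ht
    rw [Finset.sum_filter_add_sum_filter_not, Finset.sum_div]
    rw [← Finset.sum_filter_add_sum_filter_not U (· ∈ S α),
      Finset.sum_eq_zero (s := U.filter fun x => x ∉ S α) fun g hg =>
        cond_of_notMem_set (Finset.mem_filter.1 hg).2, add_zero,
        Finset.filter_mem_eq_inter, Finset.filter_mem_eq_inter, Finset.inter_comm]
    refine Finset.sum_congr rfl fun g hg => ?_
    have : g ∈ top 0 (S α) := by rw [top_zero]; exact (Finset.mem_inter.1 hg).1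
    rw [cond_of_mem this, top_zero]
  have hpos : ∀ t : Fin n → ℝ, (∀ g, 0 < t g) →
      0 < ∑ g ∈ S α with g ∈ U, t g + ∑ g ∈ S α with g ∉ U, t g := by
    intro t ht
    rw [Finset.sum_filter_add_sum_filter_not]
    exact Finset.sum_pos (fun _ _ => ht _) hs
  show ∑ g ∈ U, cond 0 t (S α) g ≤ ∑ g ∈ U, cond 0 t' (S α) g
  -- With A and B the weights inside and outside `U`, the claim is A / (A + B) ≤ A' / (A' + B').
  -- Cross-multiplying and cancelling A A' leaves A B' ≤ A' B, which holds term by term by `hr`.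
  rw [hval t ht, hval t' ht', div_le_div_iff₀ (hpos t ht) (hpos t' ht'), mul_add, mul_add,
    mul_comm (∑ g ∈ S α with g ∈ U, t g) (∑ g ∈ S α with g ∈ U, t' g)]
  gcongr 1
  rw [Finset.sum_mul_sum, Finset.sum_mul_sum]
  refine Finset.sum_le_sum fun g hg => Finset.sum_le_sum fun h hh => ?_
  rw [mul_comm]
  exact hr g (Finset.mem_filter.1 hg).2 h (Finset.mem_filter.1 hh).2

/-- The finitely many closed sets `dominated A σ` cover all pairs of systems of full support, hence
all pairs of systems. For a dominated pair, equal totals force equality in each of the inequalities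
that are being summed over the family. -/
theorem eq_of_sum_eq [Fintype A] {S : A → Finset (Fin n)} {x x' : A → Fin n → ℝ}
    (hx : x ∈ systems S) (hx' : x' ∈ systems S) (h : ∑ α, x α = ∑ α, x' α) : x = x' := by
  have hmem : (x, x') ∈ ⋃ σ : Equiv.Perm (Fin n), dominated A σ := by
    have hcl : IsClosed (⋃ σ : Equiv.Perm (Fin n), dominated A σ) :=
      isClosed_iUnion_of_finite fun σ => isClosed_dominated A σ
    have hsub : openSystems S ×ˢ openSystems S ⊆ ⋃ σ : Equiv.Perm (Fin n), dominated A σ := fun p hp =>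
      mem_iUnion.2 (exists_mem_dominated hp.1 hp.2)
    refine closure_minimal hsub hcl ?_
    rw [closure_prod_eq]
    exact ⟨systems_subset_closure S hx, systems_subset_closure S hx'⟩
  obtain ⟨σ, hσ⟩ := mem_iUnion.1 hmem
  have heq : ∀ (m : ℕ) α,
      ∑ g with m ≤ (σ g : ℕ), x α g = ∑ g with m ≤ (σ g : ℕ), x' α g := by
    intro m α
    have hsum : ∑ α, ∑ g with m ≤ (σ g : ℕ), x α g = ∑ α, ∑ g with m ≤ (σ g : ℕ), x' α g := by
      rw [Finset.sum_comm, Finset.sum_comm (f := fun α g => x' α g)]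
      refine Finset.sum_congr rfl fun g _ => ?_
      have := congrFun h g
      simpa using this
    exact (Finset.sum_eq_sum_iff_of_le fun α _ => hσ α m).1 hsum α (Finset.mem_univ _)
  funext α g
  -- The mass at `g` is the difference of the masses of two consecutive upper sets.
  have key : ∀ y : A → Fin n → ℝ, y α g = ∑ h with (σ g : ℕ) ≤ (σ h : ℕ), y α h -
      ∑ h with (σ g : ℕ) + 1 ≤ (σ h : ℕ), y α h := by
    intro y
    have : (Finset.univ.filter fun h => (σ g : ℕ) ≤ (σ h : ℕ)) =
        insert g (Finset.univ.filter fun h => (σ g : ℕ) + 1 ≤ (σ h : ℕ)) := by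
      ext h
      simp only [Finset.mem_filter, Finset.mem_univ, true_and, Finset.mem_insert]
      rw [Nat.le_iff_lt_or_eq, Nat.succ_le_iff, or_comm]
      refine or_congr_left ⟨fun h' => σ.injective (Fin.ext h'.symm), fun h' => by rw [h']⟩
    rw [this, Finset.sum_insert (by simp)]
    ring
  rw [key x, key x', heq, heq]

end Injective

/-! ### Surjectivity of the moment map -/

section Surjective

variable {ι A : Type*}

/-- The face of the standard simplex spanned by `s`. -/
def simplex (s : Finset ι) : Set (ι → ℝ) :=
  {y | (∀ g, 0 ≤ y g) ∧ (∀ g ∉ s, y g = 0) ∧ ∑ g ∈ s, y g = 1}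

theorem cond_mem_simplex {u t : ι → ℝ} (ht : ∀ g, 0 < t g) {s : Finset ι} (hs : s.Nonempty) :
    cond u t s ∈ simplex (top u s) := by
  refine ⟨fun g => cond_nonneg ht, fun g hg => cond_of_notMem hg, ?_⟩
  rw [Finset.sum_subset (top_subset u s) fun g _ h => cond_of_notMem h, sum_cond ht hs]

variable [Fintype ι] [Fintype A]

/-- The log-partition function of a family of sets, minus a linear function, regularised. -/
def potential (S : A → Finset ι) (p : ι → ℝ) (ε : ℝ) (s : ι → ℝ) : ℝ :=
  ∑ α, Real.log (∑ g ∈ S α, Real.exp (s g)) - ∑ g, p g * s g + ε / 2 * ∑ g, s g ^ 2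

/-- Both sides are compared with the maximum of `v` on `s`. This bounds the unregularised potential
below by zero. -/
theorem sum_mul_le_log {s : Finset ι} (hs : s.Nonempty) {y : ι → ℝ} (hy : y ∈ simplex s)
    (v : ι → ℝ) : ∑ g, y g * v g ≤ Real.log (∑ g ∈ s, Real.exp (v g)) := by
  obtain ⟨m, hm, hmax⟩ := s.exists_max_image v hs
  have h1 : ∑ g, y g * v g ≤ v m := by
    rw [← Finset.sum_subset (Finset.subset_univ s) fun g _ hg => by rw [hy.2.1 g hg, zero_mul]]
    calc ∑ g ∈ s, y g * v g ≤ ∑ g ∈ s, y g * v m :=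
          Finset.sum_le_sum fun g hg => mul_le_mul_of_nonneg_left (hmax g hg) (hy.1 g)
      _ = v m := by rw [← Finset.sum_mul, hy.2.2, one_mul]
  refine h1.trans ?_
  rw [Real.le_log_iff_exp_le (Finset.sum_pos (fun _ _ => Real.exp_pos _) hs)]
  exact Finset.single_le_sum (f := fun g => Real.exp (v g)) (fun _ _ => (Real.exp_pos _).le) hm

/-- Minimise `potential`. The derivative in direction `g` at the minimiser `s` gives ∑ `cond` − p =
−ε s in coordinate `g`, and comparison with the value at zero bounds ε ∑ s². The quadratic term is
needed since p may lie on the boundary of the Minkowski sum, where no exact minimiser need exist. -/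
theorem exists_approx_system {S : A → Finset ι} (hS : ∀ α, (S α).Nonempty) {y : A → ι → ℝ}
    (hy : ∀ α, y α ∈ simplex (S α)) {ε : ℝ} (hε : 0 < ε) :
    ∃ x ∈ systems S, ∀ g, (∑ α, x α g - ∑ α, y α g) ^ 2 ≤
      2 * ε * ∑ α, Real.log (S α).card := by
  classical
  set p : ι → ℝ := fun g => ∑ α, y α g with hp
  have hpos : ∀ (s : ι → ℝ) α, 0 < ∑ g ∈ S α, Real.exp (s g) := fun s α =>
    Finset.sum_pos (fun _ _ => Real.exp_pos _) (hS α)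
  have hlow : ∀ s, ε / 2 * ∑ g, s g ^ 2 ≤ potential S p ε s := by
    intro s
    have : ∑ g, p g * s g ≤ ∑ α, Real.log (∑ g ∈ S α, Real.exp (s g)) := by
      simp only [hp, Finset.sum_mul]
      rw [Finset.sum_comm]
      exact Finset.sum_le_sum fun α _ => sum_mul_le_log (hS α) (hy α) s
    simp only [potential]
    linarith
  have hzero : potential S p ε 0 = ∑ α, Real.log (S α).card := by
    simp [potential]
  have hcont : Continuous (potential S p ε) := by
    unfold potential
    refine ((continuous_finsetSum _ fun α _ => ?_).sub (by fun_prop)).add (by fun_prop)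
    exact Continuous.log (by fun_prop) fun s => (hpos s α).ne'
  obtain ⟨s, hs⟩ : ∃ s, ∀ s', potential S p ε s ≤ potential S p ε s' := by
    refine hcont.exists_forall_le' 0 ?_
    have : Filter.Tendsto (fun s : ι → ℝ => ‖s‖) (Filter.cocompact _) Filter.atTop :=
      tendsto_norm_cocompact_atTop
    -- The summand 1 ensures ‖s‖ ≥ 1 and hence ‖s‖ ≤ ‖s‖² ≤ ∑ s²; the other summand makes `ε / 2`
    -- times this at least the value at zero.
    filter_upwards [this.eventually_ge_atTop (1 + 2 / ε * potential S p ε 0)] with s h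
    refine le_trans ?_ (hlow s)
    rcases isEmpty_or_nonempty ι with hι | hι
    · rw [Subsingleton.elim s 0]
      have := hlow 0
      have h0 : ‖s‖ = 0 := by rw [Subsingleton.elim s 0, norm_zero]
      rw [h0] at h
      by_contra! h2
      simp at h2
      have := mul_pos (div_pos two_pos hε) h2
      linarith
    · obtain ⟨g, hg⟩ : ∃ g, ‖s‖ = ‖s g‖ := by
        obtain ⟨g, hg⟩ := Finite.exists_max fun g => ‖s g‖
        exact ⟨g, le_antisymm ((pi_norm_le_iff_of_nonneg (norm_nonneg _)).2 hg) (norm_le_pi_norm s g)⟩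
      have h0 : 0 ≤ potential S p ε 0 := by
        have := hlow 0
        simpa using this
      have h1 : 1 ≤ ‖s‖ := by
        have : 0 ≤ 2 / ε * potential S p ε 0 := by positivity
        linarith
      have h2 : ‖s‖ ≤ ∑ g, s g ^ 2 := by
        calc ‖s‖ ≤ ‖s‖ ^ 2 := by nlinarith
          _ = s g ^ 2 := by rw [hg, Real.norm_eq_abs, sq_abs]
          _ ≤ _ := Finset.single_le_sum (f := fun g => s g ^ 2) (fun _ _ => sq_nonneg _)
            (Finset.mem_univ g)
      calc potential S p ε 0 = ε / 2 * (2 / ε * potential S p ε 0) := by field_simp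
        _ ≤ ε / 2 * ∑ g, s g ^ 2 := by gcongr; linarith
  have hbound : ε / 2 * ∑ g, s g ^ 2 ≤ ∑ α, Real.log (S α).card :=
    hzero ▸ (hlow s).trans (hs 0)
  refine ⟨fun α => cond 0 (fun g => Real.exp (s g)) (S α), ⟨0, _, fun _ => Real.exp_pos _, rfl⟩,
    fun g => ?_⟩
  have hder : HasDerivAt (fun τ : ℝ => potential S p ε (s + τ • Pi.single g 1))
      (∑ α, cond 0 (fun g => Real.exp (s g)) (S α) g - p g + ε * s g) 0 := by
    have hline : ∀ h, HasDerivAt (fun τ : ℝ => (s + τ • (Pi.single g 1 : ι → ℝ) : ι → ℝ) h)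
        ((Pi.single g 1 : ι → ℝ) h) 0 := by
      intro h
      simpa using ((hasDerivAt_id (0 : ℝ)).mul_const ((Pi.single g 1 : ι → ℝ) h)).const_add (s h)
    unfold potential
    refine HasDerivAt.add (HasDerivAt.sub (HasDerivAt.fun_sum fun α _ => ?_) ?_) ?_
    · have h1 := (HasDerivAt.fun_sum (u := S α) fun h _ => (hline h).exp).log (hpos _ α).ne'
      refine h1.congr_deriv ?_
      simp only [zero_smul, add_zero]
      by_cases hg : g ∈ S α
      · rw [cond_of_mem (by rwa [top_zero]), top_zero]
        simp [Pi.single_apply, hg]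
      · rw [cond_of_notMem_set hg]
        simp [Pi.single_apply, hg]
    · have h1 := HasDerivAt.fun_sum (u := Finset.univ) fun h _ => (hline h).const_mul (p h)
      refine h1.congr_deriv ?_
      simp [Pi.single_apply]
    · have h1 := (HasDerivAt.fun_sum (u := Finset.univ) fun h _ => (hline h).pow 2).const_mul (ε / 2)
      refine h1.congr_deriv ?_
      simp [Pi.single_apply]
      ring
  have hmin : IsLocalMin (fun τ : ℝ => potential S p ε (s + τ • Pi.single g 1)) 0 :=
    Filter.Eventually.of_forall fun τ => by
      simpa using hs (s + τ • Pi.single g 1)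
  have heq := hmin.hasDerivAt_eq_zero hder
  have h2 : ∑ α, cond 0 (fun g => Real.exp (s g)) (S α) g - p g = - (ε * s g) := by linarith
  have h3 : s g ^ 2 ≤ ∑ g, s g ^ 2 :=
    Finset.single_le_sum (f := fun g => s g ^ 2) (fun _ _ => sq_nonneg _) (Finset.mem_univ g)
  show (∑ α, cond 0 (fun g => Real.exp (s g)) (S α) g - p g) ^ 2 ≤ _
  rw [h2]
  calc (-(ε * s g)) ^ 2 = 2 * ε * (ε / 2 * s g ^ 2) := by ring
    _ ≤ 2 * ε * (ε / 2 * ∑ g, s g ^ 2) := by gcongr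
    _ ≤ _ := by gcongr

/-- Every sum of points of the simplices of a family is the sum of a conditional system. -/
theorem exists_system_sum_eq {S : A → Finset ι} (hS : ∀ α, (S α).Nonempty) {y : A → ι → ℝ}
    (hy : ∀ α, y α ∈ simplex (S α)) : ∃ x ∈ systems S, ∑ α, x α = ∑ α, y α := by
  have hcomp : IsCompact ((fun x : A → ι → ℝ => ∑ α, x α) '' systems S) :=
    (isCompact_systems S).image (by fun_prop)
  suffices ∑ α, y α ∈ closure ((fun x : A → ι → ℝ => ∑ α, x α) '' systems S) by
    rw [hcomp.isClosed.closure_eq] at this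
    exact this
  choose x hx hxy using fun k : ℕ => exists_approx_system hS hy
    (ε := 1 / ((k : ℝ) + 1)) (by positivity)
  refine mem_closure_of_tendsto (f := fun k : ℕ => ∑ α, x k α) (b := Filter.atTop) ?_
    (Filter.Eventually.of_forall fun k => ⟨x k, hx k, rfl⟩)
  rw [tendsto_pi_nhds]
  intro g
  rw [tendsto_iff_norm_sub_tendsto_zero]
  have hlim : Filter.Tendsto (fun k : ℕ => Real.sqrt (2 * (1 / ((k : ℝ) + 1)) *
      ∑ α, Real.log (S α).card)) Filter.atTop (𝓝 0) := by
    have := ((tendsto_one_div_add_atTop_nhds_zero_nat (𝕜 := ℝ)).const_mul 2).mul_const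
      (∑ α, Real.log (S α).card)
    rw [mul_zero, zero_mul] at this
    have h := (Real.continuous_sqrt.tendsto 0).comp this
    rwa [Real.sqrt_zero] at h
  refine squeeze_zero (fun _ => norm_nonneg _) (fun k => ?_) hlim
  rw [Real.norm_eq_abs]
  refine Real.abs_le_sqrt ?_
  simpa using hxy k g

end Surjective

/-! ### Relative interiors of convex sets -/

section Convex

variable {E : Type*} [NormedAddCommGroup E] [NormedSpace ℝ E] [FiniteDimensional ℝ E]

/-- Affine coordinates on the affine span of a set. -/
theorem exists_affine_coordinates {F : Set E} {x₀ : E} (hx₀ : x₀ ∈ F) :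
    ∃ ψ : (Fin (Module.finrank ℝ (vectorSpan ℝ F)) → ℝ) →L[ℝ] E, Function.Injective ψ ∧
      F ⊆ range (fun a => ψ a + x₀) ∧
      intrinsicInterior ℝ F = (fun a => ψ a + x₀) '' interior ((fun a => ψ a + x₀) ⁻¹' F) := by
  let ψ : (Fin (Module.finrank ℝ (vectorSpan ℝ F)) → ℝ) ≃L[ℝ] vectorSpan ℝ F :=
    ContinuousLinearEquiv.ofFinrankEq (by simp)
  let φ : (Fin (Module.finrank ℝ (vectorSpan ℝ F)) → ℝ) ≃ₜ affineSpan ℝ F :=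
    { toFun := fun a => ⟨(ψ a : E) + x₀, by
        have := AffineSubspace.vadd_mem_of_mem_direction (s := affineSpan ℝ F) (v := (ψ a : E))
          (by rw [direction_affineSpan]; exact (ψ a).2) (mem_affineSpan ℝ hx₀)
        exact this⟩
      invFun := fun p => ψ.symm ⟨(p : E) - x₀, by
        have := AffineSubspace.vsub_mem_direction p.2 (mem_affineSpan ℝ hx₀)
        rwa [direction_affineSpan] at this⟩
      left_inv := fun a => by simp
      right_inv := fun p => by simp
      continuous_toFun := by fun_prop
      continuous_invFun := by fun_prop }
  refine ⟨(vectorSpan ℝ F).subtypeL.comp (ψ : _ →L[ℝ] vectorSpan ℝ F), ?_, ?_, ?_⟩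
  · intro a b hab
    exact ψ.injective (Subtype.ext hab)
  · intro p hp
    refine ⟨φ.symm ⟨p, mem_affineSpan ℝ hp⟩, ?_⟩
    exact congrArg Subtype.val (φ.apply_symm_apply ⟨p, mem_affineSpan ℝ hp⟩)
  · have h1 : ∀ B : Set (affineSpan ℝ F), interior B = φ '' interior (φ ⁻¹' B) := by
      intro B
      rw [← φ.preimage_interior, image_preimage_eq _ φ.surjective]
    rw [intrinsicInterior, h1, image_image]
    rfl

/-- A point of a convex set lies in the relative interior if and only if every linear functional
that attains its maximum over the set at this point is constant on the set. -/
theorem mem_intrinsicInterior_iff {F : Set E} (hF : Convex ℝ F) {p : E} (hp : p ∈ F) :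
    p ∈ intrinsicInterior ℝ F ↔
      ∀ l : StrongDual ℝ E, (∀ q ∈ F, l q ≤ l p) → ∀ q ∈ F, l q = l p := by
  obtain ⟨ψ, hinj, hran, hint⟩ := exists_affine_coordinates hp
  set f : (Fin (Module.finrank ℝ (vectorSpan ℝ F)) → ℝ) → E := fun a => ψ a + p with hf
  have hfinj : Function.Injective f := fun a b h => hinj (add_right_cancel h)
  rw [hint]
  constructor
  · rintro ⟨a, ha, hap⟩ l hl q hq
    obtain ⟨b, rfl⟩ := hran hq
    -- The segment from the point with coordinates `b` to the interior point `a` can be prolonged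
    -- slightly beyond `a`; a functional that is maximal at `a` cannot grow along the prolongation.
    have hcont : Filter.Tendsto (fun ε : ℝ => a + ε • (a - b)) (𝓝[>] 0) (𝓝 a) := by
      have : ContinuousAt (fun ε : ℝ => a + ε • (a - b)) 0 := by fun_prop
      have h2 := this.tendsto
      simp only [zero_smul, add_zero] at h2
      exact h2.mono_left nhdsWithin_le_nhds
    obtain ⟨ε, hε, hpos⟩ := ((hcont.eventually (mem_interior_iff_mem_nhds.1 ha)).and
      self_mem_nhdsWithin).exists
    have hpos : 0 < ε := hpos
    have h1 := hl _ hε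
    have h2 : l (f (a + ε • (a - b))) = l (f a) + ε * (l (f a) - l (f b)) := by
      simp only [hf, map_add, map_smul, map_sub, smul_eq_mul]
      ring
    have hap' : f a = p := hap
    refine le_antisymm (hl _ hq) ?_
    change l (f (a + ε • (a - b))) ≤ l p at h1
    rw [h2, hap'] at h1
    have : ε * (l p - l (f b)) ≤ 0 := by linarith
    have := nonpos_of_mul_nonpos_right this hpos
    change l p ≤ l (f b)
    linarith
  · intro h
    have hconv : Convex ℝ (f ⁻¹' F) := by
      have : f ⁻¹' F = ψ ⁻¹' ((fun z => z + p) ⁻¹' F) := rfl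
      rw [this]
      exact (hF.translate_preimage_left p).linear_preimage ψ.toLinearMap
    refine ⟨0, ?_, by simp [hf]⟩
    by_contra h0
    -- The coordinates of `p` are 0. If 0 is not interior, a functional separates it from the
    -- interior; composed with the left inverse `r` of `ψ`, it is maximal at `p` without being
    -- constant on `F`.
    obtain ⟨g, hg⟩ := geometric_hahn_banach_open_point hconv.interior isOpen_interior h0
    obtain ⟨r, hr⟩ := LinearMap.exists_leftInverse_of_injective ψ.toLinearMap
      (LinearMap.ker_eq_bot.2 hinj)
    have hr' : ∀ a, r (ψ a) = a := fun a => LinearMap.congr_fun hr a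
    have hne : (interior (f ⁻¹' F)).Nonempty := by
      have := (Set.Nonempty.intrinsicInterior hF ⟨p, hp⟩)
      rw [hint] at this
      exact this.of_image
    have hle : ∀ a ∈ f ⁻¹' F, g a ≤ g 0 := by
      intro a ha
      have hcl : a ∈ closure (interior (f ⁻¹' F)) := by
        rw [hconv.closure_interior_eq_closure_of_nonempty_interior hne]
        exact subset_closure ha
      exact closure_minimal (fun b hb => (hg b hb).le)
        (isClosed_le g.continuous continuous_const) hcl
    obtain ⟨b, hb⟩ := hne
    have hfr : ∀ a, g (r (f a)) = g a + g (r p) := fun a => by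
      rw [hf, map_add, hr', map_add]
    have key := h (g.comp (LinearMap.toContinuousLinearMap r)) (fun q hq => by
      obtain ⟨a, rfl⟩ := hran hq
      have := hle a hq
      rw [map_zero] at this
      show g (r (f a)) ≤ g (r p)
      linarith [hfr a]) (f b) (interior_subset (s := f ⁻¹' F) hb)
    have h3 := hg b hb
    rw [map_zero] at h3
    have key : g (r (f b)) = g (r p) := key
    linarith [hfr b]

/-- The radial projection onto the closed unit ball of the maximum norm. -/
def clamp {k : ℕ} (a : Fin k → ℝ) : Fin k → ℝ := fun i => max (-1) (min 1 (a i))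

theorem continuous_clamp {k : ℕ} : Continuous (clamp (k := k)) := by
  unfold clamp
  fun_prop

theorem clamp_mem {k : ℕ} (a : Fin k → ℝ) : clamp a ∈ Metric.closedBall (0 : Fin k → ℝ) 1 := by
  rw [mem_closedBall_zero_iff, pi_norm_le_iff_of_nonneg zero_le_one]
  intro i
  rw [Real.norm_eq_abs, abs_le]
  simp [clamp]

theorem clamp_eq {k : ℕ} {a : Fin k → ℝ} (ha : a ∈ Metric.closedBall (0 : Fin k → ℝ) 1) :
    clamp a = a := by
  rw [mem_closedBall_zero_iff, pi_norm_le_iff_of_nonneg zero_le_one] at ha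
  funext i
  have := abs_le.1 (ha i)
  simp [clamp, this]

/-- A compact convex set is the image of a closed ball of the same dimension, such that the open
ball corresponds to the relative interior. -/
theorem exists_ball_chart {F : Set E} (hF : Convex ℝ F) (hc : IsCompact F) (hne : F.Nonempty) :
    ∃ e : PartialEquiv (Fin (Module.finrank ℝ (vectorSpan ℝ F)) → ℝ) E,
      Continuous e ∧ Continuous e.symm ∧ e.source = Metric.ball 0 1 ∧
      e.target = intrinsicInterior ℝ F ∧ (∀ a, e a ∈ F) ∧ e '' Metric.closedBall 0 1 = F ∧
      ∀ a ∈ Metric.sphere 0 1, e a ∉ intrinsicInterior ℝ F := by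
  obtain ⟨x₀, hx₀⟩ := hne
  obtain ⟨ψ, hinj, hran, hint⟩ := exists_affine_coordinates hx₀
  set f : (Fin (Module.finrank ℝ (vectorSpan ℝ F)) → ℝ) → E := fun a => ψ a + x₀ with hf
  obtain ⟨r, hr⟩ := LinearMap.exists_leftInverse_of_injective ψ.toLinearMap
    (LinearMap.ker_eq_bot.2 hinj)
  have hr' : ∀ a, r (ψ a) = a := fun a => LinearMap.congr_fun hr a
  have hfr : ∀ b, r (f b - x₀) = b := fun b => by rw [hf, add_sub_cancel_right, hr']
  have hrc : Continuous r := LinearMap.continuous_of_finiteDimensional r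
  have hfc : Continuous f := by fun_prop
  have hfinj : Function.Injective f := fun a b h => hinj (add_right_cancel h)
  have hconv : Convex ℝ (f ⁻¹' F) := by
    have : f ⁻¹' F = ψ ⁻¹' ((fun z => z + x₀) ⁻¹' F) := rfl
    rw [this]
    exact (hF.translate_preimage_left x₀).linear_preimage ψ.toLinearMap
  have himage : f ⁻¹' F = (fun q => r (q - x₀)) '' F := by
    ext a
    constructor
    · exact fun ha => ⟨f a, ha, by simp [hf, hr']⟩
    · rintro ⟨q, hq, rfl⟩
      obtain ⟨b, rfl⟩ := hran hq
      show f (r (f b - x₀)) ∈ F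
      rw [hfr]
      exact hq
  have hcomp : IsCompact (f ⁻¹' F) := by
    rw [himage]
    exact hc.image (by fun_prop)
  have hne : (interior (f ⁻¹' F)).Nonempty := by
    have := (Set.Nonempty.intrinsicInterior hF ⟨x₀, hx₀⟩)
    rw [hint] at this
    exact this.of_image
  obtain ⟨h, h1, h2, h3⟩ := exists_homeomorph_image_interior_closure_frontier_eq_unitBall hconv hne
    hcomp.isBounded
  rw [hcomp.isClosed.closure_eq] at h2
  have h2' : ∀ a ∈ Metric.closedBall 0 1, h.symm a ∈ f ⁻¹' F := by
    intro a ha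
    rw [← h2] at ha
    obtain ⟨b, hb, rfl⟩ := ha
    simpa using hb
  have h1' : ∀ a, a ∈ Metric.ball 0 1 ↔ h.symm a ∈ interior (f ⁻¹' F) := by
    intro a
    rw [← h1]
    constructor
    · rintro ⟨b, hb, rfl⟩
      simpa using hb
    · exact fun hb => ⟨_, hb, by simp⟩
  have hint' : ∀ b, f b ∈ intrinsicInterior ℝ F ↔ b ∈ interior (f ⁻¹' F) := by
    intro b
    rw [hint]
    exact hfinj.mem_set_image
  -- Precomposition with `clamp` changes nothing on the closed ball, but makes the chart a globally
  -- continuous map with all its values in `F`.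
  refine ⟨{ toFun := fun a => f (h.symm (clamp a))
            invFun := fun p => h (r (p - x₀))
            source := Metric.ball 0 1
            target := intrinsicInterior ℝ F
            map_source' := fun a ha => ?_
            map_target' := fun p hp => ?_
            left_inv' := fun a ha => ?_
            right_inv' := fun p hp => ?_ }, ?_, ?_, rfl, rfl, ?_, ?_, ?_⟩
  · rw [clamp_eq (Metric.ball_subset_closedBall ha), hint', ← h1']
    exact ha
  · rw [hint] at hp
    obtain ⟨b, hb, rfl⟩ := hp
    rw [h1', hfr, h.symm_apply_apply]
    exact hb
  · simp [hf, hr', clamp_eq (Metric.ball_subset_closedBall ha)]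
  · rw [hint] at hp
    obtain ⟨b, hb, rfl⟩ := hp
    have hb' : h b ∈ Metric.ball 0 1 := by rw [h1']; simpa using hb
    rw [hfr, clamp_eq (Metric.ball_subset_closedBall hb'), h.symm_apply_apply]
  · exact hfc.comp (h.symm.continuous.comp continuous_clamp)
  · exact h.continuous.comp (hrc.comp (continuous_id.sub continuous_const))
  · exact fun a => h2' _ (clamp_mem a)
  · apply Subset.antisymm
    · rintro _ ⟨a, -, rfl⟩
      exact h2' _ (clamp_mem a)
    · intro p hp
      obtain ⟨b, rfl⟩ := hran hp
      have hb : h b ∈ Metric.closedBall 0 1 := by rw [← h2]; exact ⟨b, hp, rfl⟩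
      exact ⟨h b, hb, by simp [clamp_eq hb, hf]⟩
  · intro a ha
    show f (h.symm (clamp a)) ∉ _
    rw [clamp_eq (Metric.sphere_subset_closedBall ha), hint', ← h1']
    simp at ha ⊢
    exact ha.ge

end Convex

/-! ### Minkowski sums of simplices and their faces -/

section Faces

variable {ι A : Type*} [Fintype A]

/-- The point of Euclidean space given by the sum of a family of vectors. -/
def moment (c : ι → ℝ) (x : A → ι → ℝ) : EuclideanSpace ℝ ι := WithLp.toLp 2 (c + ∑ α, x α)

/-- The translate by `c` of the Minkowski sum of the simplices spanned by a family of sets. -/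
def simplexSum (c : ι → ℝ) (S : A → Finset ι) : Set (EuclideanSpace ℝ ι) :=
  {p | ∃ y, (∀ α, y α ∈ simplex (S α)) ∧ moment c y = p}

theorem moment_apply (c : ι → ℝ) (x : A → ι → ℝ) (g : ι) : moment c x g = c g + ∑ α, x α g := by
  simp [moment]

theorem continuous_moment (c : ι → ℝ) : Continuous (moment (A := A) c) := by
  unfold moment
  fun_prop

theorem convex_simplex (s : Finset ι) : Convex ℝ (simplex s) := by
  intro y hy z hz a b ha hb hab
  refine ⟨fun g => ?_, fun g hg => ?_, ?_⟩
  · simpa using add_nonneg (mul_nonneg ha (hy.1 g)) (mul_nonneg hb (hz.1 g))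
  · simp [hy.2.1 g hg, hz.2.1 g hg]
  · simp [Finset.sum_add_distrib, ← Finset.mul_sum, hy.2.2, hz.2.2, hab]

theorem convex_simplexSum (c : ι → ℝ) (S : A → Finset ι) : Convex ℝ (simplexSum c S) := by
  rintro _ ⟨y, hy, rfl⟩ _ ⟨z, hz, rfl⟩ a b ha hb hab
  refine ⟨fun α => a • y α + b • z α, fun α => convex_simplex _ (hy α) (hz α) ha hb hab, ?_⟩
  ext g
  simp only [moment_apply, PiLp.add_apply, PiLp.smul_apply, smul_eq_mul, Pi.add_apply,
    Pi.smul_apply, Finset.sum_add_distrib, ← Finset.mul_sum]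
  linear_combination (-c g) * hab

theorem simplex_mono {s s' : Finset ι} (h : s ⊆ s') : simplex s ⊆ simplex s' := by
  intro y hy
  refine ⟨hy.1, fun g hg => hy.2.1 g fun h' => hg (h h'), ?_⟩
  rw [← hy.2.2]
  exact (Finset.sum_subset h fun g _ hg => hy.2.1 g hg).symm

theorem simplexSum_mono {c : ι → ℝ} {S S' : A → Finset ι} (h : ∀ α, S α ⊆ S' α) :
    simplexSum c S ⊆ simplexSum c S' := by
  rintro _ ⟨y, hy, rfl⟩
  exact ⟨y, fun α => simplex_mono (h α) (hy α), rfl⟩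

open Classical in
theorem single_mem_simplex {s : Finset ι} {g : ι} (hg : g ∈ s) :
    (Pi.single g 1 : ι → ℝ) ∈ simplex s := by
  refine ⟨fun h => ?_, fun h hh => ?_, ?_⟩
  · by_cases h' : h = g
    · subst h'; simp
    · simp [h']
  · exact Pi.single_eq_of_ne (fun h' => hh (by rwa [h'])) _
  · simp [hg]

variable [Fintype ι]

/-- The inclusion from right to left is `exists_system_sum_eq`. It allows every point of the
Minkowski sum to be written as the moment of a system, whose supports then locate the face
containing the point. -/
theorem moment_image_systems (c : ι → ℝ) {S : A → Finset ι} (hS : ∀ α, (S α).Nonempty) :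
    moment c '' systems S = simplexSum c S := by
  apply Subset.antisymm
  · rintro _ ⟨_, ⟨u, t, ht, rfl⟩, rfl⟩
    exact simplexSum_mono (fun α => top_subset u _)
      ⟨_, fun α => cond_mem_simplex (u := u) ht (hS α), rfl⟩
  · rintro _ ⟨y, hy, rfl⟩
    obtain ⟨x, hx, hxy⟩ := exists_system_sum_eq hS hy
    exact ⟨x, hx, by rw [moment, hxy, moment]⟩

theorem isCompact_simplexSum (c : ι → ℝ) {S : A → Finset ι} (hS : ∀ α, (S α).Nonempty) :
    IsCompact (simplexSum c S) := by
  rw [← moment_image_systems c hS]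
  exact (isCompact_systems S).image (continuous_moment c)

theorem simplexSum_nonempty (c : ι → ℝ) {S : A → Finset ι} (hS : ∀ α, (S α).Nonempty) :
    (simplexSum c S).Nonempty := by
  rw [← moment_image_systems c hS]
  exact Set.Nonempty.image _ ⟨_, 0, fun _ => 1, fun _ => one_pos, rfl⟩

theorem sum_mul_le_of_mem_simplex {s : Finset ι} {y v : ι → ℝ} (hy : y ∈ simplex s) {m : ι}
    (hm : m ∈ top v s) : ∑ g, y g * v g ≤ v m := by
  rw [← Finset.sum_subset (Finset.subset_univ s) fun g _ hg => by rw [hy.2.1 g hg, zero_mul]]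
  calc ∑ g ∈ s, y g * v g ≤ ∑ g ∈ s, y g * v m :=
        Finset.sum_le_sum fun g hg => mul_le_mul_of_nonneg_left ((mem_top.1 hm).2 g hg) (hy.1 g)
    _ = v m := by rw [← Finset.sum_mul, hy.2.2, one_mul]

theorem sum_mul_eq_iff_of_mem_simplex {s : Finset ι} {y v : ι → ℝ} (hy : y ∈ simplex s) {m : ι}
    (hm : m ∈ top v s) : ∑ g, y g * v g = v m ↔ y ∈ simplex (top v s) := by
  have h1 : ∑ g, y g * v g = v m ↔ ∀ g ∈ s, y g * v g = y g * v m := by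
    rw [← Finset.sum_subset (Finset.subset_univ s) fun g _ hg => by rw [hy.2.1 g hg, zero_mul],
      ← Finset.sum_eq_sum_iff_of_le fun g hg =>
        mul_le_mul_of_nonneg_left ((mem_top.1 hm).2 g hg) (hy.1 g),
      ← Finset.sum_mul, hy.2.2, one_mul]
  rw [h1]
  constructor
  · intro h
    have h0 : ∀ g ∉ top v s, y g = 0 := by
      intro g hg
      by_cases hgs : g ∈ s
      · by_contra h0
        have := mul_left_cancel₀ h0 (h g hgs)
        exact hg (mem_top.2 ⟨hgs, fun k hk => this ▸ (mem_top.1 hm).2 k hk⟩)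
      · exact hy.2.1 g hgs
    refine ⟨hy.1, h0, ?_⟩
    rw [Finset.sum_subset (top_subset v s) fun g _ hg => h0 g hg, hy.2.2]
  · intro h g hg
    by_cases hgt : g ∈ top v s
    · rw [le_antisymm ((mem_top.1 hm).2 g hg) ((mem_top.1 hgt).2 m (top_subset _ _ hm))]
    · rw [h.2.1 g hgt, zero_mul, zero_mul]

/-- The linear functional with given coefficients. -/
def functional (u : ι → ℝ) : StrongDual ℝ (EuclideanSpace ℝ ι) :=
  ∑ g, u g • EuclideanSpace.proj g

theorem functional_apply (u : ι → ℝ) (p : EuclideanSpace ℝ ι) :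
    functional u p = ∑ g, p g * u g := by
  simp [functional, mul_comm]

theorem exists_eq_functional (l : StrongDual ℝ (EuclideanSpace ℝ ι)) :
    ∃ u, l = functional u := by
  classical
  refine ⟨fun g => l (EuclideanSpace.single g 1), ?_⟩
  ext p
  rw [functional_apply]
  conv_lhs => rw [← (EuclideanSpace.basisFun ι ℝ).sum_repr p, map_sum]
  simp

theorem functional_moment (u c : ι → ℝ) (y : A → ι → ℝ) :
    functional u (moment c y) = ∑ g, c g * u g + ∑ α, ∑ g, y α g * u g := by
  simp only [functional_apply, moment_apply, add_mul, Finset.sum_add_distrib, Finset.sum_mul]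
  rw [Finset.sum_comm]

variable {c : ι → ℝ} {S : A → Finset ι}

/-- The faces of a Minkowski sum are the Minkowski sums of the faces. -/
theorem moment_mem_face_iff (hS : ∀ α, (S α).Nonempty) (u : ι → ℝ) {y : A → ι → ℝ}
    (hy : ∀ α, y α ∈ simplex (S α)) :
    (∀ q ∈ simplexSum c S, functional u q ≤ functional u (moment c y)) ↔
      ∀ α, y α ∈ simplex (top u (S α)) := by
  classical
  choose m hm using fun α => top_nonempty u (hS α)
  have hmax : ∀ z : A → ι → ℝ, (∀ α, z α ∈ simplex (S α)) →
      ∑ α, ∑ g, z α g * u g ≤ ∑ α, u (m α) := fun z hz =>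
    Finset.sum_le_sum fun α _ => sum_mul_le_of_mem_simplex (hz α) (hm α)
  have heq : (∑ α, ∑ g, y α g * u g = ∑ α, u (m α)) ↔ ∀ α, y α ∈ simplex (top u (S α)) := by
    rw [Finset.sum_eq_sum_iff_of_le fun α _ => sum_mul_le_of_mem_simplex (hy α) (hm α)]
    simp only [Finset.mem_univ, true_imp_iff]
    exact forall_congr' fun α => sum_mul_eq_iff_of_mem_simplex (hy α) (hm α)
  rw [← heq]
  constructor
  · intro h
    refine le_antisymm (hmax y hy) ?_
    -- The vertices `m α` maximise all summands simultaneously, so the upper bound of `hmax` is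
    -- attained.
    have := h _ ⟨fun α => Pi.single (m α) 1,
      fun α => single_mem_simplex (top_subset _ _ (hm α)), rfl⟩
    rw [functional_moment, functional_moment] at this
    have h2 := le_of_add_le_add_left this
    simpa [Pi.single_apply] using h2
  · rintro h _ ⟨z, hz, rfl⟩
    rw [functional_moment, functional_moment, h]
    exact add_le_add_right (hmax z hz) _

theorem setOf_max_eq (hS : ∀ α, (S α).Nonempty) (u : ι → ℝ) :
    {p ∈ simplexSum c S | ∀ q ∈ simplexSum c S, functional u q ≤ functional u p} =
      simplexSum c fun α => top u (S α) := by
  apply Subset.antisymm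
  · rintro _ ⟨⟨y, hy, rfl⟩, h⟩
    exact ⟨y, (moment_mem_face_iff hS u hy).1 h, rfl⟩
  · rintro p hp
    have hp' := simplexSum_mono (fun α => top_subset u (S α)) hp
    obtain ⟨y, hy, rfl⟩ := hp
    have hy' : ∀ α, y α ∈ simplex (S α) := fun α => ⟨(hy α).1,
      fun g hg => (hy α).2.1 g fun h => hg (top_subset _ _ h), by
        rw [← (hy α).2.2]
        exact (Finset.sum_subset (top_subset _ _) fun g _ hg => (hy α).2.1 g hg).symm⟩
    exact ⟨hp', (moment_mem_face_iff hS u hy').2 hy⟩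

theorem moment_mem_simplexSum_top_iff (hS : ∀ α, (S α).Nonempty) (u : ι → ℝ) {y : A → ι → ℝ}
    (hy : ∀ α, y α ∈ simplex (S α)) :
    moment c y ∈ simplexSum c (fun α => top u (S α)) ↔ ∀ α, y α ∈ simplex (top u (S α)) := by
  constructor
  · intro h
    rw [← setOf_max_eq hS] at h
    exact (moment_mem_face_iff hS u hy).1 h.2
  · exact fun h => ⟨y, h, rfl⟩

theorem exposed_iff (hS : ∀ α, (S α).Nonempty) {F : Set (EuclideanSpace ℝ ι)} :
    (F.Nonempty ∧ IsExposed ℝ (simplexSum c S) F) ↔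
      ∃ u, F = simplexSum c fun α => top u (S α) := by
  constructor
  · rintro ⟨hne, hF⟩
    obtain ⟨l, hl⟩ := hF hne
    obtain ⟨u, rfl⟩ := exists_eq_functional l
    exact ⟨u, hl.trans (setOf_max_eq hS u)⟩
  · rintro ⟨u, rfl⟩
    exact ⟨simplexSum_nonempty c fun α => top_nonempty u (hS α),
      fun _ => ⟨functional u, (setOf_max_eq hS u).symm⟩⟩

/-- Given `g ∈ T α`, take a vertex from every `T β`, with `g` in slot `α`. Their sum lies in the
face, and a sum can be maximal only if every summand is. -/
theorem subset_of_simplexSum_subset (hS : ∀ α, (S α).Nonempty) {T : A → Finset ι}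
    (hT : ∀ α, (T α).Nonempty) (hTS : ∀ α, T α ⊆ S α) {u : ι → ℝ}
    (h : simplexSum c T ⊆ simplexSum c fun α => top u (S α)) (α : A) : T α ⊆ top u (S α) := by
  classical
  intro g hg
  choose m hm using hT
  have hy : ∀ β, (Pi.single (Function.update m α g β) 1 : ι → ℝ) ∈ simplex (T β) := by
    intro β
    by_cases hβ : β = α
    · subst hβ
      rw [Function.update_self]
      exact single_mem_simplex hg
    · rw [Function.update_of_ne hβ]
      exact single_mem_simplex (hm β)
  have hmem := h ⟨_, hy, rfl⟩
  rw [moment_mem_simplexSum_top_iff hS u fun β => single_mem_simplex (hTS β ?_)] at hmem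
  · have := (hmem α).2.1 g
    simp only [Function.update_self, Pi.single_eq_same, one_ne_zero, imp_false, not_not] at this
    exact this
  · by_cases hβ : β = α
    · subst hβ
      rwa [Function.update_self]
    · rw [Function.update_of_ne hβ]
      exact hm β

theorem moment_mem_intrinsicInterior (hS : ∀ α, (S α).Nonempty) {x : A → ι → ℝ}
    (hx : ∀ α, x α ∈ simplex (S α)) (hpos : ∀ α, ∀ g ∈ S α, 0 < x α g) :
    moment c x ∈ intrinsicInterior ℝ (simplexSum c S) := by
  rw [mem_intrinsicInterior_iff (convex_simplexSum c S) ⟨x, hx, rfl⟩]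
  intro l hl q hq
  obtain ⟨v, rfl⟩ := exists_eq_functional l
  have h := (moment_mem_face_iff hS v hx).1 hl
  have htop : ∀ α, top v (S α) = S α := fun α =>
    (top_subset _ _).antisymm fun g hg => by_contra fun h' =>
      (hpos α g hg).ne' ((h α).2.1 g h')
  have hq' : q ∈ simplexSum c fun α => top v (S α) := by simpa only [htop] using hq
  rw [← setOf_max_eq hS] at hq'
  exact le_antisymm (hl q hq) (hq'.2 _ ⟨x, hx, rfl⟩)

/-- The moment map sends the systems with given supports to the relative interior of a face. -/
theorem moment_cond_mem_intrinsicInterior_iff (hS : ∀ α, (S α).Nonempty) {u w t : ι → ℝ}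
    (ht : ∀ g, 0 < t g) :
    moment c (fun α => cond w t (S α)) ∈ intrinsicInterior ℝ (simplexSum c fun α => top u (S α)) ↔
      ∀ α, top w (S α) = top u (S α) := by
  have hTne := fun α => top_nonempty u (hS α)
  have hmemw : ∀ α, cond w t (S α) ∈ simplex (top w (S α)) := fun α => cond_mem_simplex ht (hS α)
  constructor
  · intro h
    have hmem := intrinsicInterior_subset h
    have hx : ∀ α, cond w t (S α) ∈ simplex (S α) := fun α =>
      ⟨fun g => cond_nonneg ht, fun g hg => cond_of_notMem_set hg, sum_cond ht (hS α)⟩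
    have hxu := (moment_mem_simplexSum_top_iff hS u hx).1 hmem
    have hsub : ∀ α, top w (S α) ⊆ top u (S α) := fun α g hg => by_contra fun h' =>
      (cond_pos ht hg).ne' ((hxu α).2.1 g h')
    have htt : ∀ α, top w (top u (S α)) = top w (S α) := by
      intro α
      obtain ⟨m, hm⟩ := top_nonempty w (hS α)
      ext g
      constructor
      · intro hg
        refine mem_top.2 ⟨top_subset _ _ (top_subset _ _ hg), fun k hk => ?_⟩
        exact ((mem_top.1 hm).2 k hk).trans ((mem_top.1 hg).2 m (hsub α hm))
      · intro hg
        exact mem_top.2 ⟨hsub α hg, fun k hk => (mem_top.1 hg).2 k (top_subset _ _ hk)⟩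
    -- The functional `w` attains its maximum over the face of `u` at the given point. In the
    -- relative interior this makes it constant on that face, which is therefore contained in the
    -- face of `w`.
    rw [mem_intrinsicInterior_iff (convex_simplexSum c _) hmem] at h
    have hmax := (moment_mem_face_iff (c := c) hTne w hxu).2 fun α => (htt α).symm ▸ hmemw α
    have hconst := h (functional w) hmax
    have hF : (simplexSum c fun α => top u (S α)) ⊆ simplexSum c fun α => top w (S α) := by
      intro q hq
      have : q ∈ simplexSum c fun α => top w (top u (S α)) := by
        rw [← setOf_max_eq hTne]
        exact ⟨hq, fun q' hq' => (hconst q hq).symm ▸ hmax q' hq'⟩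
      simpa only [htt] using this
    exact fun α => (hsub α).antisymm
      (subset_of_simplexSum_subset hS hTne (fun α => top_subset _ _) hF α)
  · intro h
    have h' : (fun α => top u (S α)) = fun α => top w (S α) := funext fun α => (h α).symm
    rw [h']
    exact moment_mem_intrinsicInterior (fun α => top_nonempty w (hS α)) hmemw
      fun α g hg => cond_pos ht hg

/-- A common point is the moment of a conditional system, and its supports agree with those of both
faces. -/
theorem disjoint_intrinsicInterior (hS : ∀ α, (S α).Nonempty) {u w : ι → ℝ}
    {p : EuclideanSpace ℝ ι}
    (hu : p ∈ intrinsicInterior ℝ (simplexSum c fun α => top u (S α)))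
    (hw : p ∈ intrinsicInterior ℝ (simplexSum c fun α => top w (S α))) (α : A) :
    top u (S α) = top w (S α) := by
  have hp := simplexSum_mono (fun α => top_subset u (S α)) (intrinsicInterior_subset hu)
  rw [← moment_image_systems c hS] at hp
  obtain ⟨_, ⟨v, t, ht, rfl⟩, rfl⟩ := hp
  exact ((moment_cond_mem_intrinsicInterior_iff hS ht).1 hu α).symm.trans
    ((moment_cond_mem_intrinsicInterior_iff hS ht).1 hw α)

/-- A boundary point of a face lies in the relative interior of a face of lower dimension. -/
theorem exists_lower_face (hS : ∀ α, (S α).Nonempty) {u : ι → ℝ} {p : EuclideanSpace ℝ ι}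
    (hp : p ∈ simplexSum c fun α => top u (S α))
    (hp' : p ∉ intrinsicInterior ℝ (simplexSum c fun α => top u (S α))) :
    ∃ w, p ∈ intrinsicInterior ℝ (simplexSum c fun α => top w (S α)) ∧
      Module.finrank ℝ (vectorSpan ℝ (simplexSum c fun α => top w (S α))) <
        Module.finrank ℝ (vectorSpan ℝ (simplexSum c fun α => top u (S α))) := by
  have hTne := fun α => top_nonempty u (hS α)
  have hpS := simplexSum_mono (fun α => top_subset u (S α)) hp
  have hpS' := hpS
  rw [← moment_image_systems c hS] at hpS
  obtain ⟨_, ⟨w, t, ht, rfl⟩, rfl⟩ := hpS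
  have hx : ∀ α, cond w t (S α) ∈ simplex (S α) := fun α =>
    ⟨fun g => cond_nonneg ht, fun g hg => cond_of_notMem_set hg, sum_cond ht (hS α)⟩
  have hxu := (moment_mem_simplexSum_top_iff hS u hx).1 hp
  have hsub : ∀ α, top w (S α) ⊆ top u (S α) := fun α g hg => by_contra fun h' =>
    (cond_pos ht hg).ne' ((hxu α).2.1 g h')
  have hrel := (moment_cond_mem_intrinsicInterior_iff (c := c) (u := w) hS ht).2 fun _ => rfl
  refine ⟨w, hrel, ?_⟩
  have hFF := simplexSum_mono (c := c) hsub
  have hconst : ∀ q ∈ simplexSum c fun α => top w (S α), ∀ q' ∈ simplexSum c fun α => top w (S α),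
      functional w q = functional w q' := by
    intro q hq q' hq'
    rw [← setOf_max_eq hS] at hq hq'
    exact le_antisymm (hq'.2 q hq.1) (hq.2 q' hq'.1)
  -- If the directions of the two faces coincided, the functional `w` would be constant on the
  -- larger face too. The faces would then have equal supports, against `hp'`.
  refine Submodule.finrank_lt_finrank_of_lt (lt_of_le_of_ne (vectorSpan_mono ℝ hFF) fun heq => ?_)
  have hker : vectorSpan ℝ (simplexSum c fun α => top w (S α)) ≤
      LinearMap.ker (functional w).toLinearMap := by
    rw [vectorSpan_def, Submodule.span_le]
    rintro _ ⟨q, hq, q', hq', rfl⟩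
    simp [hconst q hq q' hq']
  have hF : (simplexSum c fun α => top u (S α)) ⊆ simplexSum c fun α => top w (S α) := by
    intro q hq
    have h1 : q -ᵥ moment c (fun α => cond w t (S α)) ∈
        vectorSpan ℝ (simplexSum c fun α => top u (S α)) := vsub_mem_vectorSpan ℝ hq hp
    rw [← heq] at h1
    have h2 := hker h1
    simp only [vsub_eq_sub, LinearMap.mem_ker, ContinuousLinearMap.coe_coe, map_sub] at h2
    have h3 := intrinsicInterior_subset hrel
    rw [← setOf_max_eq hS] at h3 ⊢
    exact ⟨simplexSum_mono (fun α => top_subset u (S α)) hq,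
      fun q' hq' => (h3.2 q' hq').trans (sub_eq_zero.1 h2).ge⟩
  have heq' : ∀ α, top w (S α) = top u (S α) := fun α => (hsub α).antisymm
    (subset_of_simplexSum_subset hS hTne (fun α => top_subset _ _) hF α)
  exact hp' ((moment_cond_mem_intrinsicInterior_iff hS ht).2 heq')

theorem finite_faces (hS : ∀ α, (S α).Nonempty) :
    {F | F.Nonempty ∧ IsExposed ℝ (simplexSum c S) F}.Finite := by
  refine (Set.finite_range fun T : A → Finset ι => simplexSum c T).subset ?_
  rintro F hF
  obtain ⟨u, rfl⟩ := (exposed_iff hS).1 hF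
  exact ⟨_, rfl⟩

end Faces

/-! ### Cell structures -/

section Cells

/-- A convex body with well-behaved faces: its non-empty exposed faces are finitely many, their
relative interiors are disjoint, and their relative boundaries are covered by the relative
interiors of faces of lower dimension. -/
structure FaceComplex {E : Type*} [NormedAddCommGroup E] [NormedSpace ℝ E] (P : Set E) : Prop where
  convex : Convex ℝ P
  isCompact : IsCompact P
  nonempty : P.Nonempty
  finite : {F | F.Nonempty ∧ IsExposed ℝ P F}.Finite
  disjoint : ∀ F G, F.Nonempty → IsExposed ℝ P F → G.Nonempty → IsExposed ℝ P G → ∀ p,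
    p ∈ intrinsicInterior ℝ F → p ∈ intrinsicInterior ℝ G → F = G
  boundary : ∀ F k, IsFaceOfDim P F k → ∀ p ∈ F, p ∉ intrinsicInterior ℝ F →
    ∃ G m, IsFaceOfDim P G m ∧ m < k ∧ p ∈ intrinsicInterior ℝ G

variable {E : Type} [NormedAddCommGroup E] [NormedSpace ℝ E] [FiniteDimensional ℝ E] {P : Set E}

/-- The target `Z` is general so that the same cells can be placed both in the polytope and in the
moduli space. -/
theorem FaceComplex.exists_cell (hP : FaceComplex P) {Z : Type} [TopologicalSpace Z] {f : P → Z}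
    (hf : IsEmbedding f) {F : Set E} {k : ℕ} (hF : IsFaceOfDim P F k) :
    ∃ e : PartialEquiv (Fin k → ℝ) Z, Continuous e ∧ ContinuousOn e.symm e.target ∧
      e.source = Metric.ball 0 1 ∧
      e '' Metric.ball 0 1 = f '' (Subtype.val ⁻¹' intrinsicInterior ℝ F) ∧
      e '' Metric.closedBall 0 1 = f '' (Subtype.val ⁻¹' F) ∧
      ∀ a ∈ Metric.sphere 0 1, e a ∈ f '' (Subtype.val ⁻¹' (F \ intrinsicInterior ℝ F)) := by
  obtain ⟨hne, hexp, rfl⟩ := hF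
  have hFP : F ⊆ P := hexp.subset
  have : Nonempty P := ⟨⟨hne.some, hFP hne.some_mem⟩⟩
  obtain ⟨e, h1, h2, h3, h4, h5, h6, h7⟩ := exists_ball_chart (hexp.convex hP.convex)
    (hexp.isCompact hP.isCompact) hne
  have hinv : ∀ p, Function.invFun f (f p) = p := Function.leftInverse_invFun hf.injective
  have hball : e '' Metric.ball 0 1 = intrinsicInterior ℝ F := by
    rw [← h3, e.image_source_eq_target, h4]
  let e' : PartialEquiv (Fin (Module.finrank ℝ (vectorSpan ℝ F)) → ℝ) Z :=
    { toFun := fun a => f ⟨e a, hFP (h5 a)⟩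
      invFun := fun z => e.symm (Function.invFun f z : P)
      source := Metric.ball 0 1
      target := f '' (Subtype.val ⁻¹' intrinsicInterior ℝ F)
      map_source' := fun a ha => ⟨_, by rw [← hball]; exact ⟨a, ha, rfl⟩, rfl⟩
      map_target' := by
        rintro _ ⟨p, hp, rfl⟩
        rw [hinv, ← h3]
        exact e.map_target (h4 ▸ hp)
      left_inv' := fun a ha => by
        rw [hinv]
        exact e.left_inv (h3 ▸ ha)
      right_inv' := by
        rintro _ ⟨p, hp, rfl⟩
        congr 1
        rw [Subtype.ext_iff, hinv]
        exact e.right_inv (h4 ▸ hp) }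
  have himage : ∀ B : Set (Fin (Module.finrank ℝ (vectorSpan ℝ F)) → ℝ),
      e' '' B = f '' (Subtype.val ⁻¹' (e '' B)) := by
    intro B
    ext z
    constructor
    · rintro ⟨a, ha, rfl⟩
      exact ⟨_, ⟨a, ha, rfl⟩, rfl⟩
    · rintro ⟨p, ⟨a, ha, hap⟩, rfl⟩
      exact ⟨a, ha, congrArg f (Subtype.ext hap)⟩
  refine ⟨e', ?_, ?_, rfl, ?_, ?_, ?_⟩
  · exact hf.continuous.comp (by fun_prop)
  · have hcont : ContinuousOn (fun z => e.symm (Function.invFun f z : P)) (range f) := by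
      rw [continuousOn_iff_continuous_domRestrict]
      have : (range f).domRestrict (fun z => e.symm (Function.invFun f z : P)) =
          fun z => e.symm (hf.toHomeomorph.symm z : P) := by
        funext z
        obtain ⟨p, rfl⟩ := hf.toHomeomorph.surjective z
        rw [Homeomorph.symm_apply_apply]
        exact congrArg (fun q : P => e.symm q) (hinv p)
      rw [this]
      exact h2.comp (continuous_subtype_val.comp hf.toHomeomorph.symm.continuous)
    exact hcont.mono (image_subset_range _ _)
  · rw [himage, hball]
  · rw [himage, h6]
  · exact fun a ha => ⟨_, ⟨h5 a, h7 a ha⟩, rfl⟩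

/-- An embedded convex body is a CW complex whose open cells are the relative interiors of the
faces. -/
theorem FaceComplex.exists_cwComplex (hP : FaceComplex P) {Z : Type} [TopologicalSpace Z]
    {f : P → Z} (hf : IsEmbedding f) {C : Set Z} (hC : range f = C) :
    ∃ K : CWComplex C, ∀ k, openCells K k =
      {e | ∃ F, IsFaceOfDim P F k ∧ e = f '' (Subtype.val ⁻¹' intrinsicInterior ℝ F)} := by
  choose map h1 h2 h3 h4 h5 h6 using
    fun (k : ℕ) (i : {F : Set E // IsFaceOfDim P F k}) => hP.exists_cell hf i.2
  have hsub : ∀ {k m : ℕ} (F : {F : Set E // IsFaceOfDim P F k})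
      (G : {F : Set E // IsFaceOfDim P F m}) (z : Z), z ∈ map k F '' Metric.ball 0 1 →
      z ∈ map m G '' Metric.ball 0 1 → F.1 = G.1 := by
    intro k m F G z hz hz'
    rw [h4] at hz hz'
    obtain ⟨p, hp, rfl⟩ := hz
    obtain ⟨q, hq, hpq⟩ := hz'
    rw [hf.injective hpq] at hq
    exact hP.disjoint F.1 G.1 F.2.1 F.2.2.1 G.2.1 G.2.2.1 p hp hq
  let K : CWComplex C := CWComplex.mkFinite C (fun k => {F : Set E // IsFaceOfDim P F k}) map
    (by
      filter_upwards [Filter.eventually_gt_atTop (Module.finrank ℝ E)] with k hk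
      refine ⟨fun F => ?_⟩
      have := F.2.2.2 ▸ Submodule.finrank_le (vectorSpan ℝ F.1)
      omega)
    (fun k => by
      have := hP.finite.to_subtype
      refine Finite.of_injective (β := {F | F.Nonempty ∧ IsExposed ℝ P F})
        (fun F : {F : Set E // IsFaceOfDim P F k} => ⟨F.1, F.2.1, F.2.2.1⟩) fun F G h => ?_
      exact Subtype.ext (Subtype.mk.inj h))
    h3 (fun k F => (h1 k F).continuousOn) h2
    (by
      rintro ⟨k, F⟩ - ⟨m, G⟩ - hne
      rw [Function.onFun, Set.disjoint_left]
      intro z hz hz'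
      have heq := hsub F G z hz hz'
      apply hne
      obtain ⟨F, hF⟩ := F
      obtain ⟨G, hG⟩ := G
      have heq : F = G := heq
      subst heq
      have : k = m := hF.2.2.symm.trans hG.2.2
      subst this
      rfl)
    (by
      intro k F a ha
      obtain ⟨p, ⟨hp, hp'⟩, hpa⟩ := h6 k F a ha
      obtain ⟨G, m, hG, hm, hpG⟩ := hP.boundary F.1 k F.2 p hp hp'
      rw [← hpa]
      refine mem_iUnion₂.2 ⟨m, hm, mem_iUnion.2 ⟨⟨G, hG⟩, ?_⟩⟩
      rw [h5]
      exact ⟨p, (intrinsicInterior_subset hpG : (p : E) ∈ G), rfl⟩)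
    (by
      rw [← hC]
      apply Subset.antisymm
      · refine iUnion_subset fun k => iUnion_subset fun F => ?_
        rw [h5]
        exact image_subset_range _ _
      · rintro _ ⟨p, rfl⟩
        -- `P` is a face of itself, and its closed cell is everything.
        refine mem_iUnion.2 ⟨_, mem_iUnion.2 ⟨⟨P, hP.nonempty, IsExposed.refl P, rfl⟩, ?_⟩⟩
        rw [h5]
        exact ⟨p, p.2, rfl⟩)
  refine ⟨K, fun k => ?_⟩
  ext e
  constructor
  · rintro ⟨F, rfl⟩
    exact ⟨F.1, F.2, h4 k F⟩
  · rintro ⟨F, hF, rfl⟩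
    exact ⟨⟨F, hF⟩, (h4 k ⟨F, hF⟩).symm⟩

theorem faceComplex_simplexSum {ι A : Type} [Fintype ι] [Fintype A] (c : ι → ℝ) {S : A → Finset ι}
    (hS : ∀ α, (S α).Nonempty) : FaceComplex (simplexSum c S) where
  convex := convex_simplexSum c S
  isCompact := isCompact_simplexSum c hS
  nonempty := simplexSum_nonempty c hS
  finite := finite_faces hS
  disjoint := by
    intro F G hF hF' hG hG' p hp hp'
    obtain ⟨u, rfl⟩ := (exposed_iff hS).1 ⟨hF, hF'⟩
    obtain ⟨w, rfl⟩ := (exposed_iff hS).1 ⟨hG, hG'⟩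
    exact congrArg _ (funext (disjoint_intrinsicInterior hS hp hp'))
  boundary := by
    rintro F k ⟨hF, hF', rfl⟩ p hp hp'
    obtain ⟨u, rfl⟩ := (exposed_iff hS).1 ⟨hF, hF'⟩
    obtain ⟨w, hw, hlt⟩ := exists_lower_face hS hp hp'
    obtain ⟨h1, h2⟩ := (exposed_iff (c := c) hS).2 ⟨w, rfl⟩
    exact ⟨_, _, ⟨h1, h2, rfl⟩, hlt, hw⟩

end Cells

/-! ### Decompositions of intervals -/

section Lists

/-- Lists of consecutive natural numbers. -/
abbrev Consec (l : List ℕ) : Prop := l.IsChain fun a b => b = a + 1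

/-- The elements `i` and `j` belong to different members of `L`. -/
def Sep (L : List (List ℕ)) (i j : ℕ) : Prop :=
  i ∈ L.flatten ∧ j ∈ L.flatten ∧ ∀ l ∈ L, ¬ (i ∈ l ∧ j ∈ l)

theorem Sep.symm {L : List (List ℕ)} {i j : ℕ} (h : Sep L i j) : Sep L j i :=
  ⟨h.2.1, h.1, fun l hl h' => h.2.2 l hl h'.symm⟩

theorem Consec.exists_range' {l : List ℕ} (h : Consec l) : ∃ a, l = List.range' a l.length := by
  induction l with
  | nil => exact ⟨0, rfl⟩
  | cons x l ih =>
    obtain ⟨a, ha⟩ := ih h.of_cons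
    refine ⟨x, ?_⟩
    cases l with
    | nil => rfl
    | cons y l =>
      have hy : y = x + 1 := (List.isChain_cons_cons.1 h).1
      rw [List.length_cons, List.range'_succ] at ha ⊢
      rw [List.length_cons, List.range'_succ]
      injection ha with h1 h2
      subst hy
      rw [h2, ← h1]
      simp

theorem consec_range' (a n : ℕ) : Consec (List.range' a n) := by
  induction n generalizing a with
  | zero => exact List.isChain_nil
  | succ n ih =>
    rw [List.range'_succ]
    cases n with
    | zero => exact List.isChain_singleton _
    | succ n =>
      have := ih (a + 1)
      rw [List.range'_succ] at this ⊢
      exact List.isChain_cons_cons.2 ⟨rfl, this⟩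

theorem Consec.mem_of_le {l : List ℕ} (h : Consec l) {i j k : ℕ} (hi : i ∈ l) (hk : k ∈ l)
    (hij : i ≤ j) (hjk : j ≤ k) : j ∈ l := by
  obtain ⟨a, ha⟩ := h.exists_range'
  generalize l.length = m at ha
  subst ha
  rw [List.mem_range'_1] at *
  omega

theorem Consec.pairwise {l : List ℕ} (h : Consec l) : l.Pairwise (· < ·) := by
  obtain ⟨a, ha⟩ := h.exists_range'
  rw [ha]
  exact List.pairwise_lt_range'

theorem Consec.getLast_eq {l : List ℕ} (h : Consec l) {i : ℕ} (hi : i ∈ l) (hi' : i + 1 ∉ l) :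
    l.getLast (List.ne_nil_of_mem hi) = i := by
  have hmem := List.getLast_mem (List.ne_nil_of_mem hi)
  have h1 : i ≤ l.getLast (List.ne_nil_of_mem hi) := by
    obtain ⟨a, ha⟩ := h.exists_range'
    generalize l.length = m at ha
    subst ha
    rw [List.mem_range'_1] at hi
    simp only [List.getLast_range']
    omega
  by_contra h2
  exact hi' (h.mem_of_le hi hmem (by omega) (by omega))

theorem Consec.head_eq {l : List ℕ} (h : Consec l) {i : ℕ} (hi : i + 1 ∈ l) (hi' : i ∉ l) :
    l.head (List.ne_nil_of_mem hi) = i + 1 := by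
  have hmem := List.head_mem (List.ne_nil_of_mem hi)
  have h1 : l.head (List.ne_nil_of_mem hi) ≤ i + 1 := by
    obtain ⟨a, ha⟩ := h.exists_range'
    generalize l.length = m at ha
    subst ha
    rw [List.mem_range'_1] at hi
    simp only [List.head_range']
    omega
  by_contra h2
  exact hi' (h.mem_of_le hmem hi (by omega) (by omega))

variable {L : List (List ℕ)}

theorem consec_of_mem (h : Consec L.flatten) {l : List ℕ} (hl : l ∈ L) : Consec l :=
  h.infix (List.infix_of_mem_flatten hl)

theorem lt_of_mem_getElem (h : Consec L.flatten) {a b : ℕ} (ha : a < L.length) (hb : b < L.length)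
    (hab : a < b) {i j : ℕ} (hi : i ∈ L[a]) (hj : j ∈ L[b]) : i < j :=
  (List.pairwise_iff_getElem.1 (List.pairwise_flatten.1 h.pairwise).2) a b ha hb hab i hi j hj

theorem le_of_mem_getElem (h : Consec L.flatten) {a b : ℕ} (ha : a < L.length) (hb : b < L.length)
    {i j : ℕ} (hi : i ∈ L[a]) (hj : j ∈ L[b]) (hij : i ≤ j) : a ≤ b := by
  by_contra hab
  have := lt_of_mem_getElem h hb ha (by omega) hj hi
  omega

theorem eq_of_mem_getElem (h : Consec L.flatten) {a b : ℕ} (ha : a < L.length) (hb : b < L.length)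
    {i : ℕ} (hi : i ∈ L[a]) (hj : i ∈ L[b]) : a = b :=
  le_antisymm (le_of_mem_getElem h ha hb hi hj le_rfl) (le_of_mem_getElem h hb ha hj hi le_rfl)

theorem mem_flatten_iff_getElem {i : ℕ} :
    i ∈ L.flatten ↔ ∃ (a : ℕ) (ha : a < L.length), i ∈ L[a] := by
  rw [List.mem_flatten]
  constructor
  · rintro ⟨l, hl, hi⟩
    obtain ⟨a, ha, rfl⟩ := List.getElem_of_mem hl
    exact ⟨a, ha, hi⟩
  · rintro ⟨a, ha, hi⟩
    exact ⟨_, List.getElem_mem ha, hi⟩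

theorem sep_iff (h : Consec L.flatten) {i j : ℕ} :
    Sep L i j ↔ ∃ (a b : ℕ) (ha : a < L.length) (hb : b < L.length), a ≠ b ∧ i ∈ L[a] ∧ j ∈ L[b] := by
  constructor
  · rintro ⟨hi, hj, hs⟩
    obtain ⟨a, ha, hi⟩ := mem_flatten_iff_getElem.1 hi
    obtain ⟨b, hb, hj⟩ := mem_flatten_iff_getElem.1 hj
    refine ⟨a, b, ha, hb, ?_, hi, hj⟩
    rintro rfl
    exact hs _ (List.getElem_mem ha) ⟨hi, hj⟩
  · rintro ⟨a, b, ha, hb, hab, hi, hj⟩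
    refine ⟨mem_flatten_iff_getElem.2 ⟨a, ha, hi⟩, mem_flatten_iff_getElem.2 ⟨b, hb, hj⟩, ?_⟩
    rintro l hl ⟨hi', hj'⟩
    obtain ⟨c, hc, rfl⟩ := List.getElem_of_mem hl
    exact hab ((eq_of_mem_getElem h ha hc hi hi').trans (eq_of_mem_getElem h hc hb hj' hj))

theorem Sep.ne {i j : ℕ} (h : Sep L i j) : i ≠ j := by
  rintro rfl
  obtain ⟨l, hl, hi⟩ := List.mem_flatten.1 h.1
  exact h.2.2 l hl ⟨hi, hi⟩

/-- If `i < j` belong to different members of `L`, then there is a break between them. -/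
theorem exists_sep_succ (h : Consec L.flatten) {i j : ℕ} (hij : i ≤ j) (hs : Sep L i j) :
    ∃ g, i ≤ g ∧ g < j ∧ Sep L g (g + 1) := by
  induction j, hij using Nat.le_induction with
  | base => exact absurd rfl hs.ne
  | succ j hj ih =>
    have hjm := h.mem_of_le hs.1 hs.2.1 hj (Nat.le_succ j)
    by_cases hsj : Sep L j (j + 1)
    · exact ⟨j, hj, Nat.lt_succ_self j, hsj⟩
    · have : Sep L i j := by
        refine ⟨hs.1, hjm, fun l hl hil => ?_⟩
        simp only [Sep, hjm, hs.2.1, true_and, not_forall, not_not] at hsj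
        obtain ⟨l', hl', hjl'⟩ := hsj
        obtain ⟨c, hc, rfl⟩ := List.getElem_of_mem hl
        obtain ⟨d, hd, rfl⟩ := List.getElem_of_mem hl'
        obtain rfl := eq_of_mem_getElem h hc hd hil.2 hjl'.1
        exact hs.2.2 _ hl ⟨hil.1, hjl'.2⟩
      obtain ⟨g, h1, h2, h3⟩ := ih this
      exact ⟨g, h1, h2.trans (Nat.lt_succ_self j), h3⟩

theorem exists_break (h : Consec L.flatten) (hn : [] ∉ L) (hL : 2 ≤ L.length) :
    ∃ g, Sep L g (g + 1) := by
  have h0 : L[0] ≠ [] := fun h' => hn (h' ▸ List.getElem_mem _)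
  have h1 : L[1] ≠ [] := fun h' => hn (h' ▸ List.getElem_mem _)
  obtain ⟨i, hi⟩ := List.exists_mem_of_ne_nil _ h0
  obtain ⟨j, hj⟩ := List.exists_mem_of_ne_nil _ h1
  have hij := lt_of_mem_getElem h _ _ zero_lt_one hi hj
  obtain ⟨g, -, -, hg⟩ := exists_sep_succ h hij.le
    ((sep_iff h).2 ⟨0, 1, by omega, by omega, zero_ne_one, hi, hj⟩)
  exact ⟨g, hg⟩

/-- A nonempty member strictly between those containing `g` and `g + 1` would contain a number
strictly between them. -/
theorem adjacent_of_sep_succ (h : Consec L.flatten) (hn : [] ∉ L) {g : ℕ} (hs : Sep L g (g + 1)) :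
    ∃ (a : ℕ) (ha : a + 1 < L.length) (h1 : L[a] ≠ []) (h2 : L[a + 1] ≠ []),
      L[a].getLast h1 = g ∧ L[a + 1].head h2 = g + 1 := by
  obtain ⟨a, b, ha, hb, hab, hi, hj⟩ := (sep_iff h).1 hs
  have hlt : a < b := lt_of_le_of_ne (le_of_mem_getElem h ha hb hi hj (Nat.le_succ g)) hab
  have hb' : b = a + 1 := by
    by_contra hne
    have hc : a + 1 < L.length := by omega
    obtain ⟨k, hk⟩ := List.exists_mem_of_ne_nil L[a + 1] fun h' => hn (h' ▸ List.getElem_mem _)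
    have h1 := lt_of_mem_getElem h ha hc (by omega) hi hk
    have h2 := lt_of_mem_getElem h hc hb (by omega) hk hj
    omega
  subst hb'
  refine ⟨a, hb, List.ne_nil_of_mem hi, List.ne_nil_of_mem hj, ?_, ?_⟩
  · exact (consec_of_mem h (List.getElem_mem ha)).getLast_eq hi
      fun h' => hab (eq_of_mem_getElem h ha hb h' hj)
  · exact (consec_of_mem h (List.getElem_mem hb)).head_eq hj
      fun h' => hab (eq_of_mem_getElem h ha hb hi h')

open Classical in
/-- A decomposition of an interval is determined by its breaks. -/
theorem splitBy_sep (h : Consec L.flatten) (hn : [] ∉ L) :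
    L.flatten.splitBy (fun a _ => !decide (Sep L a (a + 1))) = L := by
  refine List.splitBy_flatten hn (fun l hl => ?_) ?_
  · rw [List.isChain_iff_getElem]
    intro i hi
    have h1 : l[i + 1] = l[i] + 1 := List.isChain_iff_getElem.1 (consec_of_mem h hl) i hi
    simp only [Bool.not_eq_true', decide_eq_false_iff_not]
    intro hs
    exact hs.2.2 l hl ⟨List.getElem_mem _, h1 ▸ List.getElem_mem _⟩
  · rw [List.isChain_iff_getElem]
    intro i hi
    have h1 : L[i] ≠ [] := fun h' => hn (h' ▸ List.getElem_mem _)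
    have h2 : L[i + 1] ≠ [] := fun h' => hn (h' ▸ List.getElem_mem _)
    refine ⟨h1, h2, ?_⟩
    have h3 := List.isChain_iff_getElem.1 ((List.isChain_flatten hn).1 h).2 i hi
      _ (List.getLast_mem_getLast? h1) _ (List.head_mem_head? h2)
    simp only [Bool.not_eq_false', decide_eq_true_eq]
    refine (sep_iff h).2 ⟨i, i + 1, by omega, hi, by omega, List.getLast_mem h1, ?_⟩
    rw [← h3]
    exact List.head_mem h2

/-- Both decompositions are recovered from the same list by splitting at the same places
(`splitBy_sep`). -/
theorem eq_of_sep_iff {L L' : List (List ℕ)} (h : Consec L.flatten) (hn : [] ∉ L) (hn' : [] ∉ L')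
    (hLL : L.flatten = L'.flatten) (hs : ∀ g, Sep L g (g + 1) ↔ Sep L' g (g + 1)) : L = L' := by
  classical
  have h1 := splitBy_sep h hn
  have h2 := splitBy_sep (hLL ▸ h) hn'
  have hfun : (fun a (_ : ℕ) => !decide (Sep L a (a + 1))) =
      fun a _ => !decide (Sep L' a (a + 1)) := by
    funext a _
    rw [decide_eq_decide.2 (hs a)]
  rw [hfun, hLL] at h1
  exact h1.symm.trans h2

/-- An interval can be decomposed with any given set of breaks. -/
theorem exists_decomposition {l : List ℕ} (hl : Consec l) (p : ℕ → Prop) :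
    ∃ L : List (List ℕ), L.flatten = l ∧ [] ∉ L ∧
      ∀ g, Sep L g (g + 1) ↔ g ∈ l ∧ g + 1 ∈ l ∧ p g := by
  classical
  refine ⟨l.splitBy fun a _ => !decide (p a), List.flatten_splitBy _ _,
    List.nil_notMem_splitBy _ _, fun g => ?_⟩
  set L := l.splitBy fun a _ => !decide (p a) with hL
  have hfl : L.flatten = l := List.flatten_splitBy _ _
  have hn : [] ∉ L := List.nil_notMem_splitBy _ _
  have hc : Consec L.flatten := by rwa [hfl]
  constructor
  · intro hs
    refine ⟨hfl ▸ hs.1, hfl ▸ hs.2.1, ?_⟩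
    obtain ⟨a, ha, h1, h2, h3, h4⟩ := adjacent_of_sep_succ hc hn hs
    obtain ⟨_, _, h5⟩ := List.isChain_iff_getElem.1
      (List.isChain_getLast_head_splitBy (fun a _ => !decide (p a)) l) a ha
    change (!decide (p (L[a].getLast _))) = false at h5
    rw [h3] at h5
    simpa using h5
  · rintro ⟨h1, h2, h3⟩
    refine ⟨hfl.symm ▸ h1, hfl.symm ▸ h2, fun m hm hg => ?_⟩
    have hch := List.isChain_of_mem_splitBy hm
    obtain ⟨i, hi, rfl⟩ := List.getElem_of_mem hg.1
    have hcm := consec_of_mem hc hm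
    have hi' : i + 1 < m.length := by
      by_contra hlt
      obtain ⟨j, hj, hj'⟩ := List.getElem_of_mem hg.2
      have := List.pairwise_iff_getElem.1 hcm.pairwise
      rcases lt_trichotomy i j with h | h | h
      · omega
      · subst h; omega
      · have := this j i hj hi h; omega
    have := List.isChain_iff_getElem.1 hch i hi'
    simp [h3] at this

end Lists

/-! ### Vertices of trees -/

theorem UTree.leaves_ne_nil : ∀ T : UTree, T.leaves ≠ []
  | .leaf i => by simp [UTree.leaves]
  | .node k c => by
    rw [UTree.leaves, Ne, List.flatten_eq_nil_iff]
    intro h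
    exact UTree.leaves_ne_nil (c 0) (h _ (List.mem_ofFn.2 ⟨0, rfl⟩))

theorem CTree.leaves_ne_nil : ∀ T : CTree, T.leaves ≠ []
  | .colored k c => by
    rw [CTree.leaves, Ne, List.flatten_eq_nil_iff]
    intro h
    exact UTree.leaves_ne_nil (c 0) (h _ (List.mem_ofFn.2 ⟨0, rfl⟩))
  | .node k c => by
    rw [CTree.leaves, Ne, List.flatten_eq_nil_iff]
    intro h
    exact CTree.leaves_ne_nil (c 0) (h _ (List.mem_ofFn.2 ⟨0, rfl⟩))

theorem nil_notMem_ofFn {k : ℕ} {f : Fin k → List ℕ} (h : ∀ a, f a ≠ []) : [] ∉ List.ofFn f := by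
  rw [List.mem_ofFn]
  rintro ⟨a, ha⟩
  exact h a ha

theorem UTree.Vert.nil_notMem_branches : ∀ {T : UTree} (v : T.Vert), [] ∉ v.branches
  | _, @UTree.Vert.top _ _ => nil_notMem_ofFn fun _ => UTree.leaves_ne_nil _
  | _, .sub _ v => v.nil_notMem_branches

theorem CTree.Vert.nil_notMem_branches : ∀ {T : CTree} (v : T.Vert), [] ∉ v.branches
  | _, @CTree.Vert.seam _ _ => nil_notMem_ofFn fun _ => UTree.leaves_ne_nil _
  | _, .inner _ v => v.nil_notMem_branches
  | _, @CTree.Vert.top _ _ => nil_notMem_ofFn fun _ => CTree.leaves_ne_nil _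
  | _, .sub _ v => v.nil_notMem_branches

theorem UTree.Vert.two_le_length : ∀ {T : UTree} (v : T.Vert), 2 ≤ v.branches.length
  | _, @UTree.Vert.top _ _ => by simp [UTree.Vert.branches]
  | _, .sub _ v => v.two_le_length

theorem CTree.Vert.two_le_arity :
    ∀ {T : CTree} (v : T.Vert), v.level ≠ .colored → 2 ≤ v.arity
  | _, @CTree.Vert.seam _ _ => fun h => absurd rfl h
  | _, .inner _ v => fun _ => v.two_le_length
  | _, @CTree.Vert.top _ _ => fun _ => by simp [CTree.Vert.branches, CTree.Vert.arity]
  | _, .sub _ v => v.two_le_arity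

theorem CTree.Vert.arity_pos : ∀ {T : CTree} (v : T.Vert), 0 < v.arity
  | _, @CTree.Vert.seam _ _ => by simp [CTree.Vert.branches, CTree.Vert.arity]
  | _, .inner _ v => zero_lt_two.trans_le v.two_le_length
  | _, @CTree.Vert.top _ _ => by simp [CTree.Vert.branches, CTree.Vert.arity]
  | _, .sub _ v => v.arity_pos

theorem infix_flatten_ofFn {k : ℕ} (f : Fin k → List ℕ) (a : Fin k) :
    f a <:+: (List.ofFn f).flatten :=
  List.infix_of_mem_flatten (List.mem_ofFn.2 ⟨a, rfl⟩)

theorem UTree.Vert.infix_leaves : ∀ {T : UTree} (v : T.Vert), v.branches.flatten <:+: T.leaves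
  | _, @UTree.Vert.top _ _ => List.infix_rfl
  | .node _ c, .sub a v => v.infix_leaves.trans (infix_flatten_ofFn (fun a => (c a).leaves) a)

theorem CTree.Vert.infix_leaves : ∀ {T : CTree} (v : T.Vert), v.branches.flatten <:+: T.leaves
  | _, @CTree.Vert.seam _ _ => List.infix_rfl
  | .colored _ c, .inner a v => v.infix_leaves.trans (infix_flatten_ofFn (fun a => (c a).leaves) a)
  | _, @CTree.Vert.top _ _ => List.infix_rfl
  | .node _ c, .sub a v => v.infix_leaves.trans (infix_flatten_ofFn (fun a => (c a).leaves) a)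

theorem sep_ofFn {k : ℕ} {f : Fin k → List ℕ} (h : Consec (List.ofFn f).flatten) {a b : Fin k}
    (hab : a ≠ b) {i j : ℕ} (hi : i ∈ f a) (hj : j ∈ f b) : Sep (List.ofFn f) i j :=
  (sep_iff h).2 ⟨a, b, by simp, by simp, fun h' => hab (Fin.ext h'), by simpa, by simpa⟩

/-- Any two leaves are separated by a vertex. -/
theorem UTree.exists_sep : ∀ {T : UTree}, Consec T.leaves → ∀ {i j : ℕ}, i ∈ T.leaves →
    j ∈ T.leaves → i ≠ j → ∃ v : T.Vert, Sep v.branches i j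
  | .leaf _, _, i, j, hi, hj, hij => by
    rw [UTree.leaves, List.mem_singleton] at hi hj
    exact absurd (hi.trans hj.symm) hij
  | .node k c, h, i, j, hi, hj, hij => by
    obtain ⟨_, h1, hi⟩ := List.mem_flatten.1 hi
    obtain ⟨a, rfl⟩ := List.mem_ofFn.1 h1
    obtain ⟨_, h2, hj⟩ := List.mem_flatten.1 hj
    obtain ⟨b, rfl⟩ := List.mem_ofFn.1 h2
    by_cases hab : a = b
    · subst hab
      obtain ⟨v, hv⟩ := UTree.exists_sep (consec_of_mem h h1) hi hj hij
      exact ⟨.sub a v, hv⟩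
    · exact ⟨.top, sep_ofFn h hab hi hj⟩

theorem CTree.exists_sep : ∀ {T : CTree}, Consec T.leaves → ∀ {i j : ℕ}, i ∈ T.leaves →
    j ∈ T.leaves → i ≠ j → ∃ v : T.Vert, Sep v.branches i j
  | .colored k c, h, i, j, hi, hj, hij => by
    obtain ⟨_, h1, hi⟩ := List.mem_flatten.1 hi
    obtain ⟨a, rfl⟩ := List.mem_ofFn.1 h1
    obtain ⟨_, h2, hj⟩ := List.mem_flatten.1 hj
    obtain ⟨b, rfl⟩ := List.mem_ofFn.1 h2
    by_cases hab : a = b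
    · subst hab
      obtain ⟨v, hv⟩ := UTree.exists_sep (consec_of_mem h h1) hi hj hij
      exact ⟨.inner a v, hv⟩
    · exact ⟨.seam, sep_ofFn h hab hi hj⟩
  | .node k c, h, i, j, hi, hj, hij => by
    obtain ⟨_, h1, hi⟩ := List.mem_flatten.1 hi
    obtain ⟨a, rfl⟩ := List.mem_ofFn.1 h1
    obtain ⟨_, h2, hj⟩ := List.mem_flatten.1 hj
    obtain ⟨b, rfl⟩ := List.mem_ofFn.1 h2
    by_cases hab : a = b
    · subst hab
      obtain ⟨v, hv⟩ := CTree.exists_sep (consec_of_mem h h1) hi hj hij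
      exact ⟨.sub a v, hv⟩
    · exact ⟨.top, sep_ofFn h hab hi hj⟩

/-- The members of `L'` are all contained in one member of `L`. -/
def Nested (L' L : List (List ℕ)) : Prop := ∃ l ∈ L, L'.flatten ⊆ l

theorem disjoint_ofFn {k : ℕ} {f : Fin k → List ℕ} (h : Consec (List.ofFn f).flatten) {a b : Fin k}
    (hab : a ≠ b) : List.Disjoint (f a) (f b) := fun _ hi hj =>
  (sep_ofFn h hab hi hj).ne rfl

theorem UTree.Vert.trichotomy : ∀ {T : UTree}, Consec T.leaves → ∀ v w : T.Vert,
    v = w ∨ Nested w.branches v.branches ∨ Nested v.branches w.branches ∨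
      List.Disjoint v.branches.flatten w.branches.flatten
  | .node _ c, _, .top, .top => Or.inl rfl
  | .node _ c, _, .top, .sub a w =>
    Or.inr (Or.inl ⟨_, List.mem_ofFn.2 ⟨a, rfl⟩, w.infix_leaves.subset⟩)
  | .node _ c, _, .sub a v, .top =>
    Or.inr (Or.inr (Or.inl ⟨_, List.mem_ofFn.2 ⟨a, rfl⟩, v.infix_leaves.subset⟩))
  | .node _ c, h, .sub a v, .sub b w => by
    by_cases hab : a = b
    · subst hab
      rcases UTree.Vert.trichotomy (consec_of_mem h (List.mem_ofFn.2 ⟨a, rfl⟩)) v w with h | h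
      · exact Or.inl (by rw [h])
      · exact Or.inr h
    · refine Or.inr (Or.inr (Or.inr fun i hi hj => ?_))
      exact disjoint_ofFn h hab (v.infix_leaves.subset hi) (w.infix_leaves.subset hj)

/-- `l'` is the level of a vertex below a vertex of level `l`. -/
def Level.Below : Level → Level → Prop
  | .above, .above => True
  | .colored, .above => True
  | .below, _ => True
  | _, _ => False

/-- The leaf sets of vertices are laminar. Keeping track of levels shows in addition that no colored
vertex lies below a colored one and that levels never rise towards the leaves. -/
theorem CTree.Vert.trichotomy : ∀ {T : CTree}, Consec T.leaves → ∀ v w : T.Vert,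
    v = w ∨ (Nested w.branches v.branches ∧ w.level.Below v.level) ∨
      (Nested v.branches w.branches ∧ v.level.Below w.level) ∨
      List.Disjoint v.branches.flatten w.branches.flatten
  | .colored _ c, _, .seam, .seam => Or.inl rfl
  | .colored _ c, _, .seam, .inner a w =>
    Or.inr (Or.inl ⟨⟨_, List.mem_ofFn.2 ⟨a, rfl⟩, w.infix_leaves.subset⟩, trivial⟩)
  | .colored _ c, _, .inner a v, .seam =>
    Or.inr (Or.inr (Or.inl ⟨⟨_, List.mem_ofFn.2 ⟨a, rfl⟩, v.infix_leaves.subset⟩, trivial⟩))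
  | .colored _ c, h, .inner a v, .inner b w => by
    by_cases hab : a = b
    · subst hab
      rcases UTree.Vert.trichotomy (consec_of_mem h (List.mem_ofFn.2 ⟨a, rfl⟩)) v w with
        h | h | h | h
      · exact Or.inl (by rw [h])
      · exact Or.inr (Or.inl ⟨h, trivial⟩)
      · exact Or.inr (Or.inr (Or.inl ⟨h, trivial⟩))
      · exact Or.inr (Or.inr (Or.inr h))
    · refine Or.inr (Or.inr (Or.inr fun i hi hj => ?_))
      exact disjoint_ofFn h hab (v.infix_leaves.subset hi) (w.infix_leaves.subset hj)
  | .node _ c, _, .top, .top => Or.inl rfl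
  | .node _ c, _, .top, .sub a w =>
    Or.inr (Or.inl ⟨⟨_, List.mem_ofFn.2 ⟨a, rfl⟩, w.infix_leaves.subset⟩, by
      show w.level.Below Level.above
      cases w.level <;> trivial⟩)
  | .node _ c, _, .sub a v, .top =>
    Or.inr (Or.inr (Or.inl ⟨⟨_, List.mem_ofFn.2 ⟨a, rfl⟩, v.infix_leaves.subset⟩, by
      show v.level.Below Level.above
      cases v.level <;> trivial⟩))
  | .node _ c, h, .sub a v, .sub b w => by
    by_cases hab : a = b
    · subst hab
      rcases CTree.Vert.trichotomy (consec_of_mem h (List.mem_ofFn.2 ⟨a, rfl⟩)) v w with h | h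
      · exact Or.inl (by rw [h])
      · exact Or.inr h
    · refine Or.inr (Or.inr (Or.inr fun i hi hj => ?_))
      exact disjoint_ofFn h hab (v.infix_leaves.subset hi) (w.infix_leaves.subset hj)

theorem CTree.Vert.consec {T : CTree} (h : Consec T.leaves) (v : T.Vert) :
    Consec v.branches.flatten := h.infix v.infix_leaves

/-- A vertex that has two leaves below it either separates them or lies above the vertex that
does. -/
theorem CTree.Vert.eq_or_nested {T : CTree} (h : Consec T.leaves) {v w : T.Vert} {i j : ℕ}
    (hi : i ∈ v.branches.flatten) (hj : j ∈ v.branches.flatten) (hw : Sep w.branches i j) :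
    v = w ∨ (¬ Sep v.branches i j ∧ Nested w.branches v.branches ∧ w.level.Below v.level) := by
  rcases CTree.Vert.trichotomy h v w with h1 | h1 | h1 | h1
  · exact Or.inl h1
  · refine Or.inr ⟨fun hv => ?_, h1⟩
    obtain ⟨l, hl, hl'⟩ := h1.1
    exact hv.2.2 l hl ⟨hl' hw.1, hl' hw.2.1⟩
  · obtain ⟨l, hl, hl'⟩ := h1.1
    exact absurd ⟨hl' hi, hl' hj⟩ (hw.2.2 l hl)
  · exact absurd hw.1 (h1 hi)

theorem CTree.Vert.eq_of_sep {T : CTree} (h : Consec T.leaves) {v w : T.Vert} {i j : ℕ}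
    (hv : Sep v.branches i j) (hw : Sep w.branches i j) : v = w :=
  (CTree.Vert.eq_or_nested h hv.1 hv.2.1 hw).resolve_right fun h' => h'.1 hv

/-- An order-preserving height function on the vertices. -/
def CTree.Vert.height {T : CTree} (v : T.Vert) : ℝ :=
  match v.level with
  | .above => v.branches.flatten.toFinset.card + 1
  | .colored => 0
  | .below => - (v.branches.flatten.toFinset.card + 1 : ℝ)⁻¹

/-- The lower vertex has fewer leaves, since it misses one of `i`, `j`. On the root side the height
is the number of leaves plus one, on the leaf side minus the inverse of this; both increase with
that number, and the sign settles the comparison between different levels. -/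
theorem CTree.Vert.height_lt {T : CTree} {v w : T.Vert} {i j : ℕ} (hv : Sep v.branches i j)
    (hwv : Nested w.branches v.branches) (hl : w.level.Below v.level) : w.height < v.height := by
  obtain ⟨l, hl', hsub⟩ := hwv
  have hcard : w.branches.flatten.toFinset.card < v.branches.flatten.toFinset.card := by
    refine Finset.card_lt_card ((Finset.ssubset_iff_of_subset ?_).2 ?_)
    · intro k hk
      rw [List.mem_toFinset] at hk ⊢
      exact List.mem_flatten.2 ⟨l, hl', hsub hk⟩
    · by_cases hi : i ∈ l
      · refine ⟨j, List.mem_toFinset.2 hv.2.1, fun hj => ?_⟩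
        exact hv.2.2 l hl' ⟨hi, hsub (List.mem_toFinset.1 hj)⟩
      · exact ⟨i, List.mem_toFinset.2 hv.1, fun hi' => hi (hsub (List.mem_toFinset.1 hi'))⟩
  have hcard' : (w.branches.flatten.toFinset.card : ℝ) < v.branches.flatten.toFinset.card := by
    exact_mod_cast hcard
  have h1 : (0 : ℝ) < w.branches.flatten.toFinset.card + 1 := by positivity
  have h2 : (0 : ℝ) < v.branches.flatten.toFinset.card + 1 := by positivity
  have h3 := inv_pos.2 h1
  unfold CTree.Vert.height
  cases hw : w.level <;> cases hv : v.level <;> rw [hw, hv] at hl <;> simp only [Level.Below] at hl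
  all_goals dsimp only
  · linarith
  · exact h2
  · linarith
  · linarith
  · exact neg_lt_neg (inv_strictAnti₀ h1 (by linarith))

/-! ### Trees and height functions -/

/-- The breaks of `L` are the places at which `u` is maximal. -/
def Adapted (u : ℕ → ℝ) (L : List (List ℕ)) : Prop :=
  ∀ g h, Sep L g (g + 1) → h ∈ L.flatten → h + 1 ∈ L.flatten →
    u h ≤ u g ∧ (u h = u g ↔ Sep L h (h + 1))

/-- The relation between the height of a break at a vertex and the height of the seam. -/
def Level.Compat : Level → ℝ → ℝ → Prop
  | .above, x, y => y < x
  | .colored, x, y => x = y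
  | .below, x, y => x < y

/-- `T` is the tree determined by the heights `u` of the gaps and the height `y` of the seams. -/
def CTree.Realizes (T : CTree) (u : ℕ → ℝ) (y : ℝ) : Prop :=
  ∀ v : T.Vert, Adapted u v.branches ∧
    ∀ g, Sep v.branches g (g + 1) → v.level.Compat (u g) y

/-- Each gap receives the height of the vertex at which its two neighbouring leaves meet. Seams have
height 0. -/
theorem CTree.exists_realizes {T : CTree} (hT : Consec T.leaves) : ∃ u, T.Realizes u 0 := by
  classical
  let u : ℕ → ℝ := fun g =>
    if h : ∃ v : T.Vert, Sep v.branches g (g + 1) then h.choose.height else 0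
  have hu : ∀ (v : T.Vert) g, Sep v.branches g (g + 1) → u g = v.height := by
    intro v g hv
    have h : ∃ v : T.Vert, Sep v.branches g (g + 1) := ⟨v, hv⟩
    simp only [u, dif_pos h]
    rw [CTree.Vert.eq_of_sep hT h.choose_spec hv]
  refine ⟨u, fun v => ⟨fun g h hg hh hh' => ?_, fun g hg => ?_⟩⟩
  · obtain ⟨w, hw⟩ := CTree.exists_sep hT (v.infix_leaves.subset hh) (v.infix_leaves.subset hh')
      (Nat.succ_ne_self h).symm
    rw [hu v g hg, hu w h hw]
    rcases CTree.Vert.eq_or_nested hT hh hh' hw with rfl | ⟨h1, h2, h3⟩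
    · exact ⟨le_rfl, iff_of_true rfl hw⟩
    · have := CTree.Vert.height_lt hg h2 h3
      exact ⟨this.le, iff_of_false this.ne h1⟩
  · rw [hu v g hg]
    unfold CTree.Vert.height
    cases v.level <;> simp only [Level.Compat]
    · positivity
    · rw [neg_lt_zero]
      positivity

/-- The breaks at the root vertex must be the gaps at which `u` is maximal, so the decomposition
there is forced; the same then holds on each branch. -/
theorem UTree.eq_of_adapted {u : ℕ → ℝ} : ∀ {T T' : UTree}, Consec T.leaves →
    T.leaves = T'.leaves → (∀ v : T.Vert, Adapted u v.branches) →
    (∀ v : T'.Vert, Adapted u v.branches) → T = T'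
  | .leaf i, .leaf j, _, h, _, _ => by
    simp only [UTree.leaves, List.cons.injEq, and_true] at h
    rw [h]
  | .leaf i, .node k c, hc, h, _, _ => by
    obtain ⟨g, h1, h2, -⟩ := exists_break (L := (UTree.Vert.top (c := c)).branches)
      (by rw [h] at hc; exact hc) (UTree.Vert.nil_notMem_branches _) (UTree.Vert.two_le_length _)
    change g ∈ (UTree.node k c).leaves at h1
    change g + 1 ∈ (UTree.node k c).leaves at h2
    rw [← h, UTree.leaves, List.mem_singleton] at h1 h2
    omega
  | .node k c, .leaf i, hc, h, _, _ => by
    obtain ⟨g, h1, h2, -⟩ := exists_break (L := (UTree.Vert.top (c := c)).branches)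
      hc (UTree.Vert.nil_notMem_branches _) (UTree.Vert.two_le_length _)
    change g ∈ (UTree.node k c).leaves at h1
    change g + 1 ∈ (UTree.node k c).leaves at h2
    rw [h, UTree.leaves, List.mem_singleton] at h1 h2
    omega
  | .node k c, .node k' c', hc, h, hT, hT' => by
    have hfl : (UTree.Vert.top (c := c)).branches.flatten =
      (UTree.Vert.top (c := c')).branches.flatten := h
    obtain ⟨g, hg⟩ := exists_break (L := (UTree.Vert.top (c := c)).branches)
      hc (UTree.Vert.nil_notMem_branches _) (UTree.Vert.two_le_length _)
    obtain ⟨g', hg'⟩ := exists_break (L := (UTree.Vert.top (c := c')).branches)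
      (by rw [h] at hc; exact hc) (UTree.Vert.nil_notMem_branches _) (UTree.Vert.two_le_length _)
    have h1 := hT .top
    have h2 := hT' .top
    have heq : u g = u g' := le_antisymm (h2 g' g hg' (hfl ▸ hg.1) (hfl ▸ hg.2.1)).1
      (h1 g g' hg (hfl ▸ hg'.1) (hfl ▸ hg'.2.1)).1
    have hL : (UTree.Vert.top (c := c)).branches = (UTree.Vert.top (c := c')).branches := by
      refine eq_of_sep_iff hc (UTree.Vert.nil_notMem_branches _)
        (UTree.Vert.nil_notMem_branches _) hfl fun m => ?_
      constructor
      · intro hm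
        have h3 := (h2 g' m hg' (hfl ▸ hm.1) (hfl ▸ hm.2.1)).2
        rw [← h3, ← heq, (h1 g m hg hm.1 hm.2.1).2]
        exact hm
      · intro hm
        have h3 := (h1 g m hg (hfl ▸ hm.1) (hfl ▸ hm.2.1)).2
        rw [← h3, heq, (h2 g' m hg' hm.1 hm.2.1).2]
        exact hm
    simp only [UTree.Vert.branches] at hL
    have hk := congrArg List.length hL
    simp only [List.length_ofFn, Nat.add_right_cancel_iff] at hk
    subst hk
    rw [List.ofFn_inj] at hL
    congr 1
    funext a
    exact UTree.eq_of_adapted (consec_of_mem hc (List.mem_ofFn.2 ⟨a, rfl⟩)) (congrFun hL a)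
      (fun v => hT (.sub a v)) fun v => hT' (.sub a v)

/-- The root vertex is colored precisely when no gap exceeds the seam height `y`. Its breaks are
then the gaps of height `y`; otherwise they are the highest gaps. Either way they are forced. -/
theorem CTree.eq_of_realizes {u : ℕ → ℝ} {y : ℝ} : ∀ {T T' : CTree}, Consec T.leaves →
    T.leaves = T'.leaves → T.Realizes u y → T'.Realizes u y → T = T' := by
  -- the gaps of a tree with a seam at the root are not higher than the seam
  have key : ∀ {k : ℕ} {c : Fin (k + 1) → UTree}, Consec (CTree.colored k c).leaves →
      (CTree.colored k c).Realizes u y → ∀ g ∈ (CTree.colored k c).leaves,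
      g + 1 ∈ (CTree.colored k c).leaves → u g ≤ y ∧
        (u g = y ↔ Sep (CTree.Vert.seam (c := c)).branches g (g + 1)) := by
    intro k c hc hT g hg hg'
    obtain ⟨v, hv⟩ := CTree.exists_sep hc hg hg' (Nat.succ_ne_self g).symm
    cases v with
    | seam =>
      have h1 : u g = y := (hT .seam).2 g hv
      exact ⟨h1.le, iff_of_true h1 hv⟩
    | inner a v =>
      have h1 : u g < y := (hT (.inner a v)).2 g hv
      refine ⟨h1.le, iff_of_false h1.ne fun h2 => ?_⟩
      have := CTree.Vert.eq_of_sep hc hv h2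
      cases this
  have node_ne : ∀ {k : ℕ} {c : Fin (k + 1) → UTree} {k' : ℕ} {c' : Fin (k' + 2) → CTree},
      Consec (CTree.colored k c).leaves → (CTree.colored k c).leaves = (CTree.node k' c').leaves →
      (CTree.colored k c).Realizes u y → (CTree.node k' c').Realizes u y → False := by
    intro k c k' c' hc h hT hT'
    obtain ⟨g, hg⟩ := exists_break (L := (CTree.Vert.top (c := c')).branches)
      (by rw [h] at hc; exact hc) (CTree.Vert.nil_notMem_branches _) (CTree.Vert.two_le_arity _ (by simp [CTree.Vert.level]))
    have h1 : y < u g := (hT' .top).2 g hg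
    exact absurd (key hc hT g (h ▸ hg.1) (h ▸ hg.2.1)).1 (not_le.2 h1)
  intro T
  induction T with
  | colored k c =>
    intro T' hc h hT hT'
    cases T' with
    | node k' c' => exact (node_ne hc h hT hT').elim
    | colored k' c' =>
      have hL : (CTree.Vert.seam (c := c)).branches = (CTree.Vert.seam (c := c')).branches := by
        refine eq_of_sep_iff hc (CTree.Vert.nil_notMem_branches _)
          (CTree.Vert.nil_notMem_branches _) h fun m => ?_
        constructor
        · intro hm
          have h1 : m ∈ (CTree.colored k' c').leaves := h ▸ hm.1
          have h2 : m + 1 ∈ (CTree.colored k' c').leaves := h ▸ hm.2.1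
          rw [← (key (h ▸ hc) hT' m h1 h2).2, (key hc hT m hm.1 hm.2.1).2]
          exact hm
        · intro hm
          have h1 : m ∈ (CTree.colored k c).leaves := h ▸ hm.1
          have h2 : m + 1 ∈ (CTree.colored k c).leaves := h ▸ hm.2.1
          rw [← (key hc hT m h1 h2).2, (key (h ▸ hc) hT' m hm.1 hm.2.1).2]
          exact hm
      simp only [CTree.Vert.branches] at hL
      have hk := congrArg List.length hL
      simp only [List.length_ofFn, Nat.add_right_cancel_iff] at hk
      subst hk
      rw [List.ofFn_inj] at hL
      congr 1
      funext a
      exact UTree.eq_of_adapted (consec_of_mem hc (List.mem_ofFn.2 ⟨a, rfl⟩)) (congrFun hL a)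
        (fun v => (hT (.inner a v)).1) fun v => (hT' (.inner a v)).1
  | node k c ih =>
    intro T' hc h hT hT'
    cases T' with
    | colored k' c' => exact (node_ne (h ▸ hc) h.symm hT' hT).elim
    | node k' c' =>
      have hfl : (CTree.Vert.top (c := c)).branches.flatten =
        (CTree.Vert.top (c := c')).branches.flatten := h
      obtain ⟨g, hg⟩ := exists_break (L := (CTree.Vert.top (c := c)).branches)
        hc (CTree.Vert.nil_notMem_branches _) (CTree.Vert.two_le_arity _ (by simp [CTree.Vert.level]))
      obtain ⟨g', hg'⟩ := exists_break (L := (CTree.Vert.top (c := c')).branches)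
        (by rw [h] at hc; exact hc) (CTree.Vert.nil_notMem_branches _)
        (CTree.Vert.two_le_arity _ (by simp [CTree.Vert.level]))
      have h1 := (hT .top).1
      have h2 := (hT' .top).1
      have heq : u g = u g' := le_antisymm (h2 g' g hg' (hfl ▸ hg.1) (hfl ▸ hg.2.1)).1
        (h1 g g' hg (hfl ▸ hg'.1) (hfl ▸ hg'.2.1)).1
      have hL : (CTree.Vert.top (c := c)).branches = (CTree.Vert.top (c := c')).branches := by
        refine eq_of_sep_iff hc (CTree.Vert.nil_notMem_branches _)
          (CTree.Vert.nil_notMem_branches _) hfl fun m => ?_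
        constructor
        · intro hm
          have h3 := (h2 g' m hg' (hfl ▸ hm.1) (hfl ▸ hm.2.1)).2
          rw [← h3, ← heq, (h1 g m hg hm.1 hm.2.1).2]
          exact hm
        · intro hm
          have h3 := (h1 g m hg (hfl ▸ hm.1) (hfl ▸ hm.2.1)).2
          rw [← h3, heq, (h2 g' m hg' hm.1 hm.2.1).2]
          exact hm
      simp only [CTree.Vert.branches] at hL
      have hk := congrArg List.length hL
      simp only [List.length_ofFn, Nat.add_right_cancel_iff] at hk
      subst hk
      rw [List.ofFn_inj] at hL
      congr 1
      funext a
      exact ih a (consec_of_mem hc (List.mem_ofFn.2 ⟨a, rfl⟩)) (congrFun hL a)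
        (fun v => hT (.sub a v)) fun v => hT' (.sub a v)

/-! ### Construction of trees -/

theorem length_lt_of_mem {L : List (List ℕ)} {g : ℕ}
    (hg : Sep L g (g + 1)) {l : List ℕ} (hl : l ∈ L) : l.length < L.flatten.length := by
  have hsub := (List.infix_of_mem_flatten hl).sublist
  refine lt_of_le_of_ne hsub.length_le fun heq => ?_
  have := hsub.eq_of_length heq
  exact hg.2.2 l hl ⟨this ▸ hg.1, this ▸ hg.2.1⟩

theorem exists_ofFn_eq {α : Type*} (f : α → List ℕ) {L : List (List ℕ)}
    (h : ∀ l ∈ L, ∃ x, f x = l) {k : ℕ} (hk : L.length = k) :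
    ∃ c : Fin k → α, (List.ofFn fun a => f (c a)) = L := by
  subst hk
  choose c hc using fun a : Fin L.length => h L[a] (List.getElem_mem _)
  refine ⟨c, List.ext_getElem (by simp) fun i h1 h2 => ?_⟩
  simpa using hc ⟨i, h2⟩

theorem two_le_length_of_sep {L : List (List ℕ)} {i j : ℕ} (h : Consec L.flatten) (hs : Sep L i j) :
    2 ≤ L.length := by
  obtain ⟨a, b, ha, hb, hab, -⟩ := (sep_iff h).1 hs
  omega

/-- A decomposition of an interval at the highest gaps. -/
theorem exists_adapted_decomposition {l : List ℕ} (hl : Consec l) (u : ℕ → ℝ)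
    (h : ∃ g, g ∈ l ∧ g + 1 ∈ l) : ∃ L : List (List ℕ), L.flatten = l ∧ [] ∉ L ∧
      (∃ g, Sep L g (g + 1)) ∧ Adapted u L := by
  classical
  have hne : (l.toFinset.filter fun g => g + 1 ∈ l).Nonempty := by
    obtain ⟨g, hg, hg'⟩ := h
    exact ⟨g, Finset.mem_filter.2 ⟨List.mem_toFinset.2 hg, hg'⟩⟩
  obtain ⟨m, hm, hmax⟩ := Finset.exists_max_image _ u hne
  obtain ⟨L, h1, h2, h3⟩ := exists_decomposition hl fun g => u g = u m
  rw [Finset.mem_filter, List.mem_toFinset] at hm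
  refine ⟨L, h1, h2, ⟨m, (h3 m).2 ⟨hm.1, hm.2, rfl⟩⟩, fun g k hg hk hk' => ?_⟩
  rw [h1] at hk hk'
  rw [((h3 g).1 hg).2.2]
  refine ⟨hmax k (Finset.mem_filter.2 ⟨List.mem_toFinset.2 hk, hk'⟩), ?_⟩
  rw [h3]
  exact ⟨fun h => ⟨hk, hk', h⟩, fun h => h.2.2⟩

/-- Cut the interval at its highest gaps and recurse on the pieces; `m` bounds the length for the
induction. -/
theorem UTree.exists_adapted (u : ℕ → ℝ) (m : ℕ) : ∀ l : List ℕ, l.length ≤ m → Consec l → l ≠ [] →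
    ∃ T : UTree, T.leaves = l ∧ ∀ v : T.Vert, Adapted u v.branches := by
  induction m with
  | zero => exact fun l h _ hn => absurd (List.length_eq_zero_iff.1 (Nat.le_zero.1 h)) hn
  | succ m ih =>
    intro l hlen hl hn
    by_cases h : ∃ g, g ∈ l ∧ g + 1 ∈ l
    · obtain ⟨L, rfl, h2, ⟨g, hg⟩, h4⟩ := exists_adapted_decomposition hl u h
      obtain ⟨k, hk⟩ := Nat.exists_eq_add_of_le' (two_le_length_of_sep hl hg)
      obtain ⟨c, hc⟩ := exists_ofFn_eq
        (fun T : {T : UTree // ∀ v : T.Vert, Adapted u v.branches} => T.1.leaves) (L := L)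
        (fun l' hl' => by
          obtain ⟨T, hT, hT'⟩ := ih l' (by have := length_lt_of_mem hg hl'; omega)
            (consec_of_mem hl hl') (fun h' => h2 (h' ▸ hl'))
          exact ⟨⟨T, hT'⟩, hT⟩) hk
      refine ⟨.node k fun a => (c a).1, congrArg List.flatten hc, fun v => ?_⟩
      cases v with
      | top =>
        show Adapted u (List.ofFn fun a => (c a).1.leaves)
        rwa [hc]
      | sub a v => exact (c a).2 v
    · cases l with
      | nil => exact absurd rfl hn
      | cons i l =>
        cases l with
        | nil => exact ⟨.leaf i, rfl, fun v => by cases v⟩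
        | cons j l =>
          refine absurd ⟨i, ?_, ?_⟩ h
          · simp
          · simp [(List.isChain_cons_cons.1 hl).1]

/-- While some gap is higher than `y`, cut at the highest gaps. When none is left, place a colored
vertex with breaks at the gaps of height exactly `y`, possibly none, and continue with uncolored
trees. -/
theorem CTree.exists_realizes_of_height (u : ℕ → ℝ) (y : ℝ) (m : ℕ) : ∀ l : List ℕ,
    l.length ≤ m → Consec l → l ≠ [] → ∃ T : CTree, T.leaves = l ∧ T.Realizes u y := by
  induction m with
  | zero => exact fun l h _ hn => absurd (List.length_eq_zero_iff.1 (Nat.le_zero.1 h)) hn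
  | succ m ih =>
    intro l hlen hl hn
    by_cases h : ∃ g, g ∈ l ∧ g + 1 ∈ l ∧ y < u g
    · obtain ⟨m', hm, hm', hy⟩ := h
      obtain ⟨L, rfl, h2, ⟨g, hg⟩, h4⟩ := exists_adapted_decomposition hl u ⟨m', hm, hm'⟩
      obtain ⟨k, hk⟩ := Nat.exists_eq_add_of_le' (two_le_length_of_sep hl hg)
      obtain ⟨c, hc⟩ := exists_ofFn_eq
        (fun T : {T : CTree // T.Realizes u y} => T.1.leaves) (L := L)
        (fun l' hl' => by
          obtain ⟨T, hT, hT'⟩ := ih l' (by have := length_lt_of_mem hg hl'; omega)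
            (consec_of_mem hl hl') (fun h' => h2 (h' ▸ hl'))
          exact ⟨⟨T, hT'⟩, hT⟩) hk
      refine ⟨.node k fun a => (c a).1, congrArg List.flatten hc, fun v => ?_⟩
      cases v with
      | top =>
        show Adapted u (List.ofFn fun a => (c a).1.leaves) ∧
          ∀ g, Sep (List.ofFn fun a => (c a).1.leaves) g (g + 1) → y < u g
        rw [hc]
        exact ⟨h4, fun g' hg' => hy.trans_le (h4 g' m' hg' hm hm').1⟩
      | sub a v => exact (c a).2 v
    · push Not at h
      obtain ⟨L, rfl, h2, h3⟩ := exists_decomposition hl fun g => u g = y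
      have hL : L ≠ [] := fun h' => hn (by rw [h']; rfl)
      obtain ⟨k, hk⟩ := Nat.exists_eq_add_of_le' (List.length_pos_iff.2 hL)
      -- The condition `T.leaves ∈ L` records that a gap inside a branch is not a break at the seam,
      -- so that its height is strictly less than `y`.
      obtain ⟨c, hc⟩ := exists_ofFn_eq
        (fun T : {T : UTree // (∀ v : T.Vert, Adapted u v.branches) ∧ T.leaves ∈ L} => T.1.leaves)
        (L := L) (fun l' hl' => by
          obtain ⟨T, hT, hT'⟩ := UTree.exists_adapted u _ l' le_rfl
            (consec_of_mem hl hl') (fun h' => h2 (h' ▸ hl'))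
          exact ⟨⟨T, hT', hT ▸ hl'⟩, hT⟩) hk
      refine ⟨.colored k fun a => (c a).1, congrArg List.flatten hc, fun v => ?_⟩
      cases v with
      | seam =>
        show Adapted u (List.ofFn fun a => (c a).1.leaves) ∧
          ∀ g, Sep (List.ofFn fun a => (c a).1.leaves) g (g + 1) → u g = y
        rw [hc]
        refine ⟨fun g g' hg hg' hg'' => ?_, fun g hg => ((h3 g).1 hg).2.2⟩
        rw [((h3 g).1 hg).2.2, h3]
        exact ⟨h g' hg' hg'', fun h' => ⟨hg', hg'', h'⟩, fun h' => h'.2.2⟩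
      | inner a v =>
        refine ⟨(c a).2.1 v, fun g hg => ?_⟩
        have hsub := v.infix_leaves.subset
        have hmem : ∀ i, i ∈ v.branches.flatten → i ∈ L.flatten := fun i hi =>
          List.mem_flatten.2 ⟨_, (c a).2.2, hsub hi⟩
        refine lt_of_le_of_ne (h g (hmem _ hg.1) (hmem _ hg.2.1)) fun heq => ?_
        exact ((h3 g).2 ⟨hmem _ hg.1, hmem _ hg.2.1, heq⟩).2.2 _ (c a).2.2
          ⟨hsub hg.1, hsub hg.2.1⟩

/-- Any heights of the gaps determine a combinatorial type. -/
theorem exists_combType_realizes {n : ℕ} (hn : 0 < n) (u : ℕ → ℝ) (y : ℝ) :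
    ∃ T : CombType n, T.1.Realizes u y := by
  obtain ⟨T, hT, hT'⟩ := CTree.exists_realizes_of_height u y _ (List.range' 1 n) le_rfl
    (consec_range' 1 n) (by simp; omega)
  exact ⟨⟨T, hT⟩, hT'⟩

theorem CombType.consec {n : ℕ} (T : CombType n) : Consec T.1.leaves := by
  rw [T.2]
  exact consec_range' 1 n

theorem CombType.mem_leaves {n : ℕ} (T : CombType n) {i : ℕ} :
    i ∈ T.1.leaves ↔ 1 ≤ i ∧ i ≤ n := by
  rw [T.2, List.mem_range'_1]
  omega

/-! ### Positions of the markings -/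

section Branch

variable {T : CTree}

theorem CTree.Vert.branchOf_eq_some (h : Consec T.leaves) {v : T.Vert} {j : ℕ} {a : Fin v.arity} :
    v.branchOf j = some a ↔ j ∈ v.branches.get a := by
  unfold CTree.Vert.branchOf
  constructor
  · intro h'
    split_ifs at h' with hj
    rw [← Option.some_inj.1 h']
    exact hj.choose_spec
  · intro hj
    have hex : ∃ a : Fin v.arity, j ∈ v.branches.get a := ⟨a, hj⟩
    rw [dif_pos hex]
    congr 1
    exact Fin.ext (eq_of_mem_getElem (v.consec h) _ _ hex.choose_spec hj)

theorem CTree.Vert.exists_branchOf (h : Consec T.leaves) {v : T.Vert} {j : ℕ}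
    (hj : j ∈ v.branches.flatten) : ∃ a, v.branchOf j = some a := by
  obtain ⟨a, ha, hj⟩ := mem_flatten_iff_getElem.1 hj
  exact ⟨⟨a, ha⟩, (CTree.Vert.branchOf_eq_some h).2 hj⟩

theorem CTree.Vert.mem_of_branchOf (h : Consec T.leaves) {v : T.Vert} {j : ℕ} {a : Fin v.arity}
    (hj : v.branchOf j = some a) : j ∈ v.branches.flatten :=
  mem_flatten_iff_getElem.2 ⟨a, a.2, (CTree.Vert.branchOf_eq_some h).1 hj⟩

theorem CTree.Vert.branchOf_eq_none (h : Consec T.leaves) {v : T.Vert} {j : ℕ} :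
    v.branchOf j = none ↔ j ∉ v.branches.flatten := by
  constructor
  · intro h' hj
    obtain ⟨a, ha⟩ := CTree.Vert.exists_branchOf h hj
    rw [h'] at ha
    cases ha
  · intro hj
    cases h' : v.branchOf j with
    | none => rfl
    | some a => exact absurd (CTree.Vert.mem_of_branchOf h h') hj

theorem CTree.Vert.branchOf_le (h : Consec T.leaves) {v : T.Vert} {i j : ℕ} {a b : Fin v.arity}
    (hi : v.branchOf i = some a) (hj : v.branchOf j = some b) (hij : i ≤ j) : a ≤ b :=
  le_of_mem_getElem (v.consec h) a.2 b.2 ((CTree.Vert.branchOf_eq_some h).1 hi)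
    ((CTree.Vert.branchOf_eq_some h).1 hj) hij

theorem CTree.Vert.sep_iff_branchOf (h : Consec T.leaves) {v : T.Vert} {i j : ℕ} :
    Sep v.branches i j ↔ ∃ a b, v.branchOf i = some a ∧ v.branchOf j = some b ∧ a ≠ b := by
  rw [sep_iff (v.consec h)]
  constructor
  · rintro ⟨a, b, ha, hb, hab, hi, hj⟩
    exact ⟨⟨a, ha⟩, ⟨b, hb⟩, (CTree.Vert.branchOf_eq_some h).2 hi,
      (CTree.Vert.branchOf_eq_some h).2 hj, fun h' => hab (Fin.mk.inj h')⟩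
  · rintro ⟨a, b, hi, hj, hab⟩
    exact ⟨a, b, a.2, b.2, fun h' => hab (Fin.ext h'), (CTree.Vert.branchOf_eq_some h).1 hi,
      (CTree.Vert.branchOf_eq_some h).1 hj⟩

theorem CTree.Vert.separates_iff (h : Consec T.leaves) {v : T.Vert} {i j : ℕ} :
    v.Separates i j ↔ Sep v.branches i j := by
  rw [CTree.Vert.sep_iff_branchOf h, CTree.Vert.Separates]
  cases v.branchOf i <;> cases v.branchOf j <;> simp

theorem CTree.meet_eq_some (h : Consec T.leaves) {v : T.Vert} {i j : ℕ}
    (hv : Sep v.branches i j) : T.meet i j = some v := by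
  have hex : ∃ v : T.Vert, v.Separates i j := ⟨v, (CTree.Vert.separates_iff h).2 hv⟩
  rw [CTree.meet, dif_pos hex]
  congr 1
  exact CTree.Vert.eq_of_sep h ((CTree.Vert.separates_iff h).1 hex.choose_spec) hv

namespace NodalQuiltedDisk

/-- The position of the marking `j` in the component `v`. -/
def pos (S : NodalQuiltedDisk T) (v : T.Vert) (j : ℕ) : ℝ := ((v.branchOf j).map (S.z v)).getD 0

variable {S : NodalQuiltedDisk T} {v : T.Vert} {i j : ℕ}

theorem pos_of_branchOf {a : Fin v.arity} (hj : v.branchOf j = some a) : S.pos v j = S.z v a := by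
  simp [pos, hj]

theorem image_of_mem (h : Consec T.leaves) (hj : j ∈ v.branches.flatten) :
    S.image v j = ((S.pos v j : ℝ) : OnePoint ℝ) := by
  obtain ⟨a, ha⟩ := CTree.Vert.exists_branchOf h hj
  rw [pos_of_branchOf ha, image, ha]
  rfl

theorem image_of_notMem (h : Consec T.leaves) (hj : j ∉ v.branches.flatten) :
    S.image v j = OnePoint.infty := by
  rw [image, (CTree.Vert.branchOf_eq_none h).2 hj]
  rfl

theorem pos_le (h : Consec T.leaves) (hi : i ∈ v.branches.flatten) (hj : j ∈ v.branches.flatten)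
    (hij : i ≤ j) : S.pos v i ≤ S.pos v j := by
  obtain ⟨a, ha⟩ := CTree.Vert.exists_branchOf h hi
  obtain ⟨b, hb⟩ := CTree.Vert.exists_branchOf h hj
  rw [pos_of_branchOf ha, pos_of_branchOf hb]
  exact (S.strictMono v).monotone (CTree.Vert.branchOf_le h ha hb hij)

theorem pos_eq_iff (h : Consec T.leaves) (hi : i ∈ v.branches.flatten)
    (hj : j ∈ v.branches.flatten) : S.pos v i = S.pos v j ↔ ¬ Sep v.branches i j := by
  obtain ⟨a, ha⟩ := CTree.Vert.exists_branchOf h hi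
  obtain ⟨b, hb⟩ := CTree.Vert.exists_branchOf h hj
  rw [pos_of_branchOf ha, pos_of_branchOf hb, (S.strictMono v).injective.eq_iff,
    CTree.Vert.sep_iff_branchOf h]
  simp [ha, hb]

theorem pos_lt (h : Consec T.leaves) (hv : Sep v.branches i j) (hij : i < j) :
    S.pos v i < S.pos v j :=
  lt_of_le_of_ne (pos_le h hv.1 hv.2.1 hij.le) fun h' => (pos_eq_iff h hv.1 hv.2.1).1 h' hv

theorem pos_iso {S' : NodalQuiltedDisk T} {a b : ℝ} (hz : ∀ m, S'.z v m = a * S.z v m + b)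
    (h : Consec T.leaves) (hi : i ∈ v.branches.flatten) : S'.pos v i = a * S.pos v i + b := by
  obtain ⟨m, hm⟩ := CTree.Vert.exists_branchOf h hi
  rw [pos_of_branchOf hm, pos_of_branchOf hm, hz]

end NodalQuiltedDisk

end Branch

/-! ### Gaps -/

section Gaps

variable (n : ℕ)

/-- The gaps between the leaves `i` and `j`; the element `m : Fin n` stands for the gap between the
leaves `m + 1` and `m + 2`, the last one for the height of the seam. -/
def gaps (i j : ℕ) : Finset (Fin n) := Finset.univ.filter fun m => i ≤ m + 1 ∧ (m : ℕ) + 1 < j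

/-- The gaps between the leaves `i` and `j`, and the height of the seam. -/
def seamGaps (i j : ℕ) : Finset (Fin n) :=
  Finset.univ.filter fun m => (i ≤ m + 1 ∧ (m : ℕ) + 1 < j) ∨ (m : ℕ) + 1 = n

/-- The vector with the given values at the gaps and at the seam. -/
def vec (u : ℕ → ℝ) (y : ℝ) (m : Fin n) : ℝ := if (m : ℕ) + 1 = n then y else u (m + 1)

variable {n}

theorem mem_gaps {i j : ℕ} {m : Fin n} : m ∈ gaps n i j ↔ i ≤ m + 1 ∧ (m : ℕ) + 1 < j := by
  simp [gaps]

theorem mem_seamGaps {i j : ℕ} {m : Fin n} :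
    m ∈ seamGaps n i j ↔ (i ≤ m + 1 ∧ (m : ℕ) + 1 < j) ∨ (m : ℕ) + 1 = n := by
  simp [seamGaps]

theorem gaps_subset (i j : ℕ) : gaps n i j ⊆ seamGaps n i j := fun _ hm =>
  mem_seamGaps.2 (Or.inl (mem_gaps.1 hm))

theorem gaps_subset_gaps {i i' j j' : ℕ} (hi : i' ≤ i) (hj : j ≤ j') :
    gaps n i j ⊆ gaps n i' j' := fun _ hm => by
  rw [mem_gaps] at hm ⊢
  omega

theorem gaps_nonempty {i j : ℕ} (hi : 1 ≤ i) (hij : i < j) (hj : j ≤ n) : (gaps n i j).Nonempty :=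
  ⟨⟨i - 1, by omega⟩, mem_gaps.2 (by simp only; omega)⟩

theorem seamGaps_nonempty {i j : ℕ} (hi : 1 ≤ i) (hij : i < j) (hj : j ≤ n) :
    (seamGaps n i j).Nonempty := (gaps_nonempty hi hij hj).mono (gaps_subset i j)

theorem vec_gap {u : ℕ → ℝ} {y : ℝ} {m : Fin n} (hm : (m : ℕ) + 1 ≠ n) : vec n u y m = u (m + 1) :=
  if_neg hm

theorem vec_seam {u : ℕ → ℝ} {y : ℝ} {m : Fin n} (hm : (m : ℕ) + 1 = n) : vec n u y m = y :=
  if_pos hm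

theorem vec_pos {t : ℕ → ℝ} {y : ℝ} (ht : ∀ g, 0 < t g) (hy : 0 < y) (m : Fin n) :
    0 < vec n t y m := by
  unfold vec
  split_ifs
  exacts [hy, ht _]

theorem exists_eq_vec (hn : 0 < n) (u : Fin n → ℝ) : ∃ u' y, u = vec n u' y := by
  refine ⟨fun g => if h : g - 1 < n then u ⟨g - 1, h⟩ else 0, u ⟨n - 1, by omega⟩, ?_⟩
  funext m
  unfold vec
  split_ifs with h1
  · congr 1
    exact Fin.ext (by simp only; omega)
  · simp

theorem sum_gaps {M : Type*} [AddCommMonoid M] (f : ℕ → M) {i j : ℕ} (hi : 1 ≤ i) (hj : j ≤ n) :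
    ∑ m ∈ gaps n i j, f (m + 1) = ∑ g ∈ Finset.Ico i j, f g := by
  refine Finset.sum_bij (fun m _ => (m : ℕ) + 1) ?_ ?_ ?_ fun _ _ => rfl
  · intro m hm
    exact Finset.mem_Ico.2 (mem_gaps.1 hm)
  · intro m _ m' _ h
    exact Fin.ext (Nat.succ_injective h)
  · intro g hg
    rw [Finset.mem_Ico] at hg
    refine ⟨⟨g - 1, by omega⟩, mem_gaps.2 (by simp only; omega), by simp only; omega⟩

theorem sum_gaps_sub (f : ℕ → ℝ) {i j : ℕ} (hi : 1 ≤ i) (hij : i ≤ j) (hj : j ≤ n) :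
    ∑ m ∈ gaps n i j, (f (m + 2) - f (m + 1)) = f j - f i := by
  rw [sum_gaps (fun g => f (g + 1) - f g) hi hj]
  exact Finset.sum_Ico_sub f hij

theorem sum_seamGaps (f : Fin n → ℝ) {i j : ℕ} (hj : j ≤ n) {l : Fin n} (hl : (l : ℕ) + 1 = n) :
    ∑ m ∈ seamGaps n i j, f m = ∑ m ∈ gaps n i j, f m + f l := by
  classical
  have : seamGaps n i j = insert l (gaps n i j) := by
    ext m
    rw [Finset.mem_insert, mem_seamGaps, mem_gaps, Fin.ext_iff]
    omega
  rw [this, Finset.sum_insert (by rw [mem_gaps]; omega), add_comm]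

variable {T : CombType n} {u : ℕ → ℝ} {y : ℝ} {v : T.1.Vert} {i j : ℕ}

theorem bounds_of_sep (hv : Sep v.branches i j) : 1 ≤ i ∧ j ≤ n := by
  have h1 := T.mem_leaves.1 (v.infix_leaves.subset hv.1)
  have h2 := T.mem_leaves.1 (v.infix_leaves.subset hv.2.1)
  omega

theorem mem_flatten_of_sep (hv : Sep v.branches i j) {k : ℕ} (hik : i ≤ k) (hkj : k ≤ j) :
    k ∈ v.branches.flatten :=
  (v.consec T.consec).mem_of_le hv.1 hv.2.1 hik hkj

/-- The highest gaps between two leaves are the breaks at the vertex where they meet. -/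
theorem mem_top_gaps (hu : T.1.Realizes u y) (hv : Sep v.branches i j) (hij : i < j) {m : Fin n}
    (hm : m ∈ gaps n i j) :
    m ∈ top (vec n u y) (gaps n i j) ↔ Sep v.branches (m + 1) (m + 2) := by
  have hb := bounds_of_sep hv
  have hmem : ∀ m : Fin n, m ∈ gaps n i j →
      (m : ℕ) + 1 ∈ v.branches.flatten ∧ (m : ℕ) + 1 + 1 ∈ v.branches.flatten := fun m hm => by
    rw [mem_gaps] at hm
    exact ⟨mem_flatten_of_sep hv (by omega) (by omega),
      mem_flatten_of_sep hv (by omega) (by omega)⟩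
  have hvec : ∀ m : Fin n, m ∈ gaps n i j → vec n u y m = u (m + 1) := fun _ hm => by
    rw [mem_gaps] at hm
    exact vec_gap (by omega)
  have hA := (hu v).1
  rw [mem_top]
  constructor
  · rintro ⟨-, hmax⟩
    obtain ⟨g, hg1, hg2, hg⟩ := exists_sep_succ (v.consec T.consec) hij.le hv
    have hg' : (⟨g - 1, by omega⟩ : Fin n) ∈ gaps n i j := mem_gaps.2 (by simp only; omega)
    have h1 := hmax _ hg'
    rw [hvec _ hg', hvec _ hm] at h1
    simp only [Nat.sub_add_cancel (hb.1.trans hg1)] at h1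
    have h2 := hA g (m + 1) hg (hmem m hm).1 (hmem m hm).2
    exact h2.2.1 (le_antisymm h2.1 h1)
  · refine fun hs => ⟨hm, fun k hk => ?_⟩
    rw [hvec _ hk, hvec _ hm]
    exact (hA (m + 1) (k + 1) hs (hmem k hk).1 (hmem k hk).2).1

/-- The highest gap between the two leaves competes with the seam: if they meet on the root side the
gaps win, at a colored vertex there is a tie, and on the leaf side the seam alone is highest. -/
theorem mem_top_seamGaps (hu : T.1.Realizes u y) (hv : Sep v.branches i j) (hij : i < j) {m : Fin n}
    (hm : m ∈ seamGaps n i j) :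
    m ∈ top (vec n u y) (seamGaps n i j) ↔
      ((m : ℕ) + 1 ≠ n ∧ v.level ≠ .below ∧ Sep v.branches (m + 1) (m + 2)) ∨
        ((m : ℕ) + 1 = n ∧ v.level ≠ .above) := by
  have hb := bounds_of_sep hv
  obtain ⟨g, hg1, hg2, hg⟩ := exists_sep_succ (v.consec T.consec) hij.le hv
  have hg' : (⟨g - 1, by omega⟩ : Fin n) ∈ gaps n i j := mem_gaps.2 (by simp only; omega)
  have hgtop : (⟨g - 1, by omega⟩ : Fin n) ∈ top (vec n u y) (gaps n i j) := by
    rw [mem_top_gaps hu hv hij hg']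
    convert hg using 1 <;> simp only <;> omega
  have hug : vec n u y ⟨g - 1, by omega⟩ = u g := by
    rw [vec_gap (by simp only; omega)]
    congr 1
    simp only
    omega
  have hle : ∀ k ∈ gaps n i j, vec n u y k ≤ u g := fun k hk => hug ▸ (mem_top.1 hgtop).2 k hk
  have hiff : ∀ k ∈ gaps n i j, vec n u y k = u g ↔ Sep v.branches (k + 1) (k + 2) := by
    intro k hk
    rw [← mem_top_gaps hu hv hij hk, mem_top]
    constructor
    · exact fun h => ⟨hk, fun k' hk' => h ▸ hle k' hk'⟩
    · exact fun h => le_antisymm (hle k hk) (hug ▸ h.2 _ hg')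
  have hC := (hu v).2 g hg
  have hl : (⟨n - 1, by omega⟩ : Fin n) ∈ seamGaps n i j :=
    mem_seamGaps.2 (Or.inr (by simp only; omega))
  have hlv : vec n u y ⟨n - 1, by omega⟩ = y := vec_seam (by simp only; omega)
  have hmax : (∀ k ∈ seamGaps n i j, vec n u y k ≤ vec n u y m) ↔
      u g ≤ vec n u y m ∧ y ≤ vec n u y m := by
    constructor
    · exact fun h => ⟨hug.ge.trans (h _ (gaps_subset i j hg')), hlv.ge.trans (h _ hl)⟩
    · rintro ⟨h1, h2⟩ k hk
      rcases mem_seamGaps.1 hk with hk | hk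
      · exact (hle k (mem_gaps.2 hk)).trans h1
      · rwa [vec_seam hk]
  rw [mem_top, hmax]
  simp only [hm, true_and]
  by_cases hmn : (m : ℕ) + 1 = n
  · rw [vec_seam hmn]
    cases hlev : v.level <;> rw [hlev] at hC <;> simp only [Level.Compat] at hC <;>
      simp [hmn] <;> linarith
  · have hm' : m ∈ gaps n i j := mem_gaps.2 ((mem_seamGaps.1 hm).resolve_right hmn)
    have h1 := hle m hm'
    have h2 := hiff m hm'
    rw [← h2]
    cases hlev : v.level <;> rw [hlev] at hC <;> simp only [Level.Compat] at hC <;>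
      simp only [hmn, ne_eq, not_false_eq_true, true_and, false_and, or_false, reduceCtorEq,
        not_true_eq_false]
    · exact ⟨fun h => le_antisymm h1 h.1, fun h => ⟨h.ge, h ▸ hC.le⟩⟩
    · exact ⟨fun h => le_antisymm h1 h.1, fun h => ⟨h.ge, h ▸ hC.ge⟩⟩
    · exact iff_false_intro fun h => by linarith [h.2]

end Gaps

/-! ### The conditional system of a nodal quilted disk -/

section Fits

variable {n : ℕ}

/-- The heights `u`, `y` determine the combinatorial type, and the weights `t`, `s` the disk. -/
structure Fits {T : CombType n} (S : NodalQuiltedDisk T.1) (u t : ℕ → ℝ) (y s : ℝ) : Prop where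
  realizes : T.1.Realizes u y
  pos : ∀ g, 0 < t g
  seam_pos : 0 < s
  exists_scale : ∀ v : T.1.Vert, ∃ c : ℝ, 0 < c ∧
    (∀ g, Sep v.branches g (g + 1) → S.pos v (g + 1) - S.pos v g = c * t g) ∧
    ∀ hv, S.y v hv = c * s

variable {T : CombType n} {S : NodalQuiltedDisk T.1} {u t : ℕ → ℝ} {y s : ℝ} {v : T.1.Vert}
  {i j : ℕ}

theorem Fits.vec_pos (h : Fits S u t y s) (m : Fin n) : 0 < vec n t s m :=
  Multiplihedron.vec_pos h.pos h.seam_pos m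

/-- In the component where the leaves meet, positions jump only across breaks, which are the highest
gaps, and the jumps are proportional to `t` there. The distribution is thus the normalised list of
spacings. -/
theorem Fits.cond_gaps (h : Fits S u t y s) (hv : Sep v.branches i j) (hij : i < j) {m : Fin n}
    (hm : m ∈ gaps n i j) : cond (vec n u y) (vec n t s) (gaps n i j) m =
      (S.pos v (m + 2) - S.pos v (m + 1)) / (S.pos v j - S.pos v i) := by
  have hb := bounds_of_sep hv
  obtain ⟨c, hc, h1, -⟩ := h.exists_scale v
  rw [cond_eq_div (w := fun m : Fin n => S.pos v (m + 2) - S.pos v (m + 1)) hc ?_ ?_ hm,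
    sum_gaps_sub (S.pos v) hb.1 hij.le hb.2]
  · intro k hk
    have hk' := top_subset _ _ hk
    have hs := (mem_top_gaps h.realizes hv hij hk').1 hk
    rw [mem_gaps] at hk'
    rw [vec_gap (by omega)]
    exact h1 _ hs
  · intro k hk hk'
    rw [mem_top_gaps h.realizes hv hij hk] at hk'
    rw [mem_gaps] at hk
    rw [sub_eq_zero, eq_comm, NodalQuiltedDisk.pos_eq_iff T.consec]
    · exact hk'
    · exact mem_flatten_of_sep hv (by omega) (by omega)
    · exact mem_flatten_of_sep hv (by omega) (by omega)

theorem Fits.sum_cond_gaps (h : Fits S u t y s) (hv : Sep v.branches i j) (hij : i < j) {k l : ℕ}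
    (hik : i ≤ k) (hkl : k ≤ l) (hlj : l ≤ j) :
    ∑ m ∈ gaps n k l, cond (vec n u y) (vec n t s) (gaps n i j) m =
      (S.pos v l - S.pos v k) / (S.pos v j - S.pos v i) := by
  have hb := bounds_of_sep hv
  rw [Finset.sum_congr rfl fun m hm => h.cond_gaps hv hij (gaps_subset_gaps hik hlj hm),
    ← Finset.sum_div, sum_gaps_sub (S.pos v) (hb.1.trans hik) hkl (hlj.trans hb.2)]

variable {l : Fin n}

theorem mem_seamGaps_last (hl : (l : ℕ) + 1 = n) : l ∈ seamGaps n i j :=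
  mem_seamGaps.2 (Or.inr hl)

theorem Fits.cond_seam_above (h : Fits S u t y s) (hv : Sep v.branches i j) (hij : i < j)
    (hl : (l : ℕ) + 1 = n) (hlev : v.level = .above) :
    cond (vec n u y) (vec n t s) (seamGaps n i j) l = 0 := by
  refine cond_of_notMem ?_
  rw [mem_top_seamGaps h.realizes hv hij (mem_seamGaps_last hl)]
  simp [hl, hlev]

theorem Fits.sum_cond_seamGaps (h : Fits S u t y s) (hi : 1 ≤ i) (hij : i < j) (hj : j ≤ n)
    (hl : (l : ℕ) + 1 = n) :
    ∑ m ∈ gaps n i j, cond (vec n u y) (vec n t s) (seamGaps n i j) m =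
      1 - cond (vec n u y) (vec n t s) (seamGaps n i j) l := by
  have := sum_cond (u := vec n u y) h.vec_pos (seamGaps_nonempty hi hij hj)
  rw [sum_seamGaps _ hj hl] at this
  linarith

theorem Fits.cond_seam_below (h : Fits S u t y s) (hv : Sep v.branches i j) (hij : i < j)
    (hl : (l : ℕ) + 1 = n) (hlev : v.level = .below) :
    cond (vec n u y) (vec n t s) (seamGaps n i j) l = 1 := by
  have hb := bounds_of_sep hv
  have := h.sum_cond_seamGaps hb.1 hij hb.2 hl
  rw [Finset.sum_eq_zero] at this
  · linarith
  · intro m hm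
    refine cond_of_notMem ?_
    rw [mem_top_seamGaps h.realizes hv hij (gaps_subset i j hm)]
    rw [mem_gaps] at hm
    simp only [hlev, ne_eq, not_true_eq_false, false_and, and_false, false_or, not_and]
    omega

theorem Fits.cond_seam_colored (h : Fits S u t y s) (hv : Sep v.branches i j) (hij : i < j)
    (hl : (l : ℕ) + 1 = n) (hlev : v.level = .colored) :
    cond (vec n u y) (vec n t s) (seamGaps n i j) l =
      S.y v hlev / (S.pos v j - S.pos v i + S.y v hlev) := by
  have hb := bounds_of_sep hv
  obtain ⟨c, hc, h1, h2⟩ := h.exists_scale v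
  -- At a colored vertex gaps and seam are on the same level, so the spacings together with the seam
  -- height form one weight vector proportional to the given weights.
  rw [cond_eq_div (w := fun m : Fin n => if (m : ℕ) + 1 = n then S.y v hlev else
    S.pos v (m + 2) - S.pos v (m + 1)) hc ?_ ?_ (mem_seamGaps_last hl), sum_seamGaps _ hb.2 hl,
    if_pos hl, ← sum_gaps_sub (S.pos v) hb.1 hij.le hb.2]
  · congr 2
    refine Finset.sum_congr rfl fun m hm => if_neg ?_
    rw [mem_gaps] at hm
    omega
  · intro k hk
    rcases (mem_top_seamGaps h.realizes hv hij (top_subset _ _ hk)).1 hk with h3 | h3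
    · rw [if_neg h3.1, vec_gap h3.1]
      exact h1 _ h3.2.2
    · rw [if_pos h3.1, vec_seam h3.1, h2]
  · intro k hk hk'
    rw [mem_top_seamGaps h.realizes hv hij hk] at hk'
    rcases mem_seamGaps.1 hk with h3 | h3
    · rw [if_neg (by omega), sub_eq_zero, eq_comm, NodalQuiltedDisk.pos_eq_iff T.consec]
      · intro hs
        exact hk' (Or.inl ⟨by omega, by simp [hlev], hs⟩)
      · exact mem_flatten_of_sep hv (by omega) (by omega)
      · exact mem_flatten_of_sep hv (by omega) (by omega)
    · exact absurd (Or.inr ⟨h3, by simp [hlev]⟩) hk'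

/-- A distribution with seam carries only one number beyond the gap distribution, namely its value
at the seam. -/
theorem Fits.cond_seam_gap (h : Fits S u t y s) (hi : 1 ≤ i) (hij : i < j) (hj : j ≤ n)
    (hl : (l : ℕ) + 1 = n) {m : Fin n} (hm : m ∈ gaps n i j) :
    cond (vec n u y) (vec n t s) (seamGaps n i j) m =
      (1 - cond (vec n u y) (vec n t s) (seamGaps n i j) l) *
        cond (vec n u y) (vec n t s) (gaps n i j) m := by
  rw [cond_consistent h.vec_pos (gaps_subset i j) hm, h.sum_cond_seamGaps hi hij hj hl]

theorem CombType.exists_sep (T : CombType n) (hi : 1 ≤ i) (hij : i < j) (hj : j ≤ n) :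
    ∃ v : T.1.Vert, Sep v.branches i j :=
  CTree.exists_sep T.consec (T.mem_leaves.2 ⟨hi, by omega⟩) (T.mem_leaves.2 ⟨by omega, hj⟩) hij.ne

/-- The conditional system does not depend on the choice of heights and weights. -/
theorem Fits.cond_unique {u' t' : ℕ → ℝ} {y' s' : ℝ} (h : Fits S u t y s) (h' : Fits S u' t' y' s')
    (hi : 1 ≤ i) (hij : i < j) (hj : j ≤ n) :
    cond (vec n u y) (vec n t s) (gaps n i j) = cond (vec n u' y') (vec n t' s') (gaps n i j) ∧
    cond (vec n u y) (vec n t s) (seamGaps n i j) =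
      cond (vec n u' y') (vec n t' s') (seamGaps n i j) := by
  obtain ⟨v, hv⟩ := T.exists_sep hi hij hj
  have h1 : ∀ m ∈ gaps n i j, cond (vec n u y) (vec n t s) (gaps n i j) m =
      cond (vec n u' y') (vec n t' s') (gaps n i j) m := fun m hm => by
    rw [h.cond_gaps hv hij hm, h'.cond_gaps hv hij hm]
  have h2 : ∀ l : Fin n, (l : ℕ) + 1 = n → cond (vec n u y) (vec n t s) (seamGaps n i j) l =
      cond (vec n u' y') (vec n t' s') (seamGaps n i j) l := by
    intro l hl
    cases hlev : v.level
    · rw [h.cond_seam_above hv hij hl hlev, h'.cond_seam_above hv hij hl hlev]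
    · rw [h.cond_seam_colored hv hij hl hlev, h'.cond_seam_colored hv hij hl hlev]
    · rw [h.cond_seam_below hv hij hl hlev, h'.cond_seam_below hv hij hl hlev]
  constructor
  · funext m
    by_cases hm : m ∈ gaps n i j
    · exact h1 m hm
    · rw [cond_of_notMem_set hm, cond_of_notMem_set hm]
  · funext m
    by_cases hm : m ∈ seamGaps n i j
    swap
    · rw [cond_of_notMem_set hm, cond_of_notMem_set hm]
    have hl : ((⟨n - 1, by omega⟩ : Fin n) : ℕ) + 1 = n := by simp only; omega
    rcases mem_seamGaps.1 hm with hm' | hm'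
    · rw [h.cond_seam_gap hi hij hj hl (mem_gaps.2 hm'),
        h'.cond_seam_gap hi hij hj hl (mem_gaps.2 hm'), h1 m (mem_gaps.2 hm'), h2 _ hl]
    · exact h2 m hm'

theorem Fits.iso (h : Fits S u t y s) {S' : NodalQuiltedDisk T.1} (hS : S.Iso S') :
    Fits S' u t y s where
  realizes := h.realizes
  pos := h.pos
  seam_pos := h.seam_pos
  exists_scale v := by
    obtain ⟨c, hc, h1, h2⟩ := h.exists_scale v
    obtain ⟨a, b, ha, hz, hy⟩ := hS v
    refine ⟨a * c, mul_pos ha hc, fun g hg => ?_, fun hv => ?_⟩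
    · rw [NodalQuiltedDisk.pos_iso hz T.consec hg.1, NodalQuiltedDisk.pos_iso hz T.consec hg.2.1]
      linear_combination a * h1 g hg
    · rw [hy, h2, mul_assoc]

/-- Every gap is a break at a single vertex, so its weight can be read off there. Dividing by the
seam height at colored vertices normalises all seams to the common weight 1. -/
theorem exists_fits (S : NodalQuiltedDisk T.1) : ∃ u t, Fits S u t 0 1 := by
  classical
  obtain ⟨u, hu⟩ := CTree.exists_realizes T.consec
  let c : T.1.Vert → ℝ := fun v => if hv : v.level = .colored then S.y v hv else 1
  have hc : ∀ v, 0 < c v := by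
    intro v
    simp only [c]
    split_ifs with h
    · exact S.y_pos v h
    · exact one_pos
  let t : ℕ → ℝ := fun g => if h : ∃ v : T.1.Vert, Sep v.branches g (g + 1) then
    (S.pos h.choose (g + 1) - S.pos h.choose g) / c h.choose else 1
  refine ⟨u, t, hu, fun g => ?_, one_pos, fun v => ⟨c v, hc v, fun g hg => ?_, fun hv => ?_⟩⟩
  · simp only [t]
    split_ifs with h
    · exact div_pos (sub_pos.2 (NodalQuiltedDisk.pos_lt T.consec h.choose_spec
        (Nat.lt_succ_self g))) (hc _)
    · exact one_pos
  · have h : ∃ v : T.1.Vert, Sep v.branches g (g + 1) := ⟨v, hg⟩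
    simp only [t, dif_pos h]
    rw [CTree.Vert.eq_of_sep T.consec h.choose_spec hg, mul_div_cancel₀ _ (hc v).ne']
  · simp only [c, dif_pos hv, mul_one]

/-- Any heights and weights arise from a nodal quilted disk. -/
theorem exists_disk_fits (hn : 0 < n) (u : ℕ → ℝ) {t : ℕ → ℝ} (y : ℝ) {s : ℝ} (ht : ∀ g, 0 < t g)
    (hs : 0 < s) : ∃ (T : CombType n) (S : NodalQuiltedDisk T.1), Fits S u t y s := by
  classical
  obtain ⟨T, hT⟩ := exists_combType_realizes hn u y
  -- In the component `v`, the leaf `k` is placed at the total weight of the breaks at `v` to its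
  -- left, so it jumps by `t g` across a break `g` and is constant on branches.
  let Z : T.1.Vert → ℕ → ℝ := fun v k =>
    ∑ g ∈ Finset.range k, if Sep v.branches g (g + 1) then t g else 0
  have hZlt : ∀ v i j, i < j → Sep v.branches i j → Z v i < Z v j := by
    intro v i j hij hv
    obtain ⟨g, h1, h2, h3⟩ := exists_sep_succ (v.consec T.consec) hij.le hv
    refine Finset.sum_lt_sum_of_subset (Finset.range_subset_range.2 hij.le)
      (Finset.mem_range.2 h2) (by simp; omega) ?_ fun k _ _ => ?_
    · rw [if_pos h3]
      exact ht g
    · split_ifs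
      · exact (ht k).le
      · exact le_rfl
  have hex : ∀ (v : T.1.Vert) (m : Fin v.arity), ∃ i, v.branchOf i = some m := by
    intro v m
    obtain ⟨i, hi⟩ := List.exists_mem_of_ne_nil (v.branches.get m)
      fun h' => v.nil_notMem_branches (h' ▸ List.getElem_mem m.2)
    exact ⟨i, (CTree.Vert.branchOf_eq_some T.consec).2 hi⟩
  choose r hr using hex
  have hmono : ∀ v, StrictMono fun m => Z v (r v m) := by
    intro v m m' hmm
    have hs : Sep v.branches (r v m) (r v m') :=
      (CTree.Vert.sep_iff_branchOf T.consec).2 ⟨m, m', hr v m, hr v m', hmm.ne⟩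
    refine hZlt v _ _ ?_ hs
    by_contra hle
    exact absurd (CTree.Vert.branchOf_le T.consec (hr v m') (hr v m) (not_lt.1 hle)) (not_le.2 hmm)
  let S : NodalQuiltedDisk T.1 :=
    { z := fun v m => Z v (r v m)
      strictMono := hmono
      y := fun _ _ => s
      y_pos := fun _ _ => hs }
  have hconst : ∀ (v : T.1.Vert) i j, i ≤ j → i ∈ v.branches.flatten → j ∈ v.branches.flatten →
      ¬ Sep v.branches i j → Z v i = Z v j := by
    intro v i j hij hi hj hs
    refine Finset.sum_subset (Finset.range_subset_range.2 hij) fun g hg hg' => if_neg fun h3 => ?_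
    rw [Finset.mem_range] at hg hg'
    rw [CTree.Vert.sep_iff_branchOf T.consec] at h3 hs
    obtain ⟨a, b, ha, hb, hab⟩ := h3
    obtain ⟨a', ha'⟩ := CTree.Vert.exists_branchOf T.consec hi
    obtain ⟨b', hb'⟩ := CTree.Vert.exists_branchOf T.consec hj
    have h4 : a' = b' := by_contra fun hne => hs ⟨a', b', ha', hb', hne⟩
    have h5 := CTree.Vert.branchOf_le T.consec ha' ha (not_lt.1 hg')
    have h6 := CTree.Vert.branchOf_le T.consec hb hb' hg
    have h7 := CTree.Vert.branchOf_le T.consec ha hb (Nat.le_succ g)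
    exact hab (le_antisymm h7 (h6.trans (h4 ▸ h5)))
  have hpos : ∀ (v : T.1.Vert) i, i ∈ v.branches.flatten → S.pos v i = Z v i := by
    intro v i hi
    obtain ⟨a, ha⟩ := CTree.Vert.exists_branchOf T.consec hi
    rw [NodalQuiltedDisk.pos_of_branchOf ha]
    show Z v (r v a) = Z v i
    have hra := CTree.Vert.mem_of_branchOf T.consec (hr v a)
    have hns : ¬ Sep v.branches (r v a) i := by
      rw [CTree.Vert.sep_iff_branchOf T.consec]
      rintro ⟨b, b', hb, hb', hne⟩
      rw [hr v a] at hb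
      rw [ha] at hb'
      exact hne ((Option.some_inj.1 hb).symm.trans (Option.some_inj.1 hb'))
    rcases le_total (r v a) i with h | h
    · exact hconst v _ _ h hra hi hns
    · exact (hconst v _ _ h hi hra fun h' => hns h'.symm).symm
  refine ⟨T, S, hT, ht, hs, fun v => ⟨1, one_pos, fun g hg => ?_, fun hv => (one_mul s).symm⟩⟩
  rw [hpos v _ hg.1, hpos v _ hg.2.1]
  simp only [Z]
  rw [Finset.sum_range_succ, add_sub_cancel_left, if_pos hg, one_mul]

/-- Disks of the same type with the same conditional systems are isomorphic. -/
theorem iso_of_cond_eq {S S' : NodalQuiltedDisk T.1} {u t u' t' : ℕ → ℝ} {y s y' s' : ℝ}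
    (h : Fits S u t y s) (h' : Fits S' u' t' y' s')
    (heq : ∀ i j, 1 ≤ i → i < j → j ≤ n →
      cond (vec n u y) (vec n t s) (gaps n i j) = cond (vec n u' y') (vec n t' s') (gaps n i j) ∧
      cond (vec n u y) (vec n t s) (seamGaps n i j) =
        cond (vec n u' y') (vec n t' s') (seamGaps n i j)) : S.Iso S' := by
  intro v
  have hex : ∀ m : Fin v.arity, ∃ i, v.branchOf i = some m := by
    intro m
    obtain ⟨i, hi⟩ := List.exists_mem_of_ne_nil (v.branches.get m)
      fun h' => v.nil_notMem_branches (h' ▸ List.getElem_mem m.2)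
    exact ⟨i, (CTree.Vert.branchOf_eq_some T.consec).2 hi⟩
  choose r hr using hex
  have hrmono : ∀ m m', m < m' → r m < r m' := by
    intro m m' hmm
    by_contra hle
    exact absurd (CTree.Vert.branchOf_le T.consec (hr m') (hr m) (not_lt.1 hle)) (not_le.2 hmm)
  have hpos := v.arity_pos
  -- A component with one branch is quilted: a dilation matches the seams and a translation the
  -- special point. With more branches, the affine map is fixed by the first and the last special
  -- point, and the distributions between leaves on these two branches show that it matches the
  -- remaining points and the seam.
  by_cases hone : v.arity = 1
  · have hsub : ∀ m : Fin v.arity, m = ⟨0, hpos⟩ := fun m => Fin.ext (by simp only; omega)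
    by_cases hlev : v.level = .colored
    · refine ⟨S'.y v hlev / S.y v hlev, S'.z v ⟨0, hpos⟩ -
        S'.y v hlev / S.y v hlev * S.z v ⟨0, hpos⟩, div_pos (S'.y_pos v hlev) (S.y_pos v hlev),
        fun m => ?_, fun _ => ?_⟩
      · rw [hsub m]; ring
      · rw [div_mul_cancel₀ _ (S.y_pos v hlev).ne']
    · have := v.two_le_arity hlev
      omega
  · have hlt : (⟨0, hpos⟩ : Fin v.arity) < ⟨v.arity - 1, by omega⟩ :=
      Fin.lt_def.2 (by simp only; omega)
    set a : Fin v.arity := ⟨0, hpos⟩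
    set b : Fin v.arity := ⟨v.arity - 1, by omega⟩
    have hsep : Sep v.branches (r a) (r b) :=
      (CTree.Vert.sep_iff_branchOf T.consec).2 ⟨a, b, hr a, hr b, hlt.ne⟩
    have hab := hrmono a b hlt
    have hbd := bounds_of_sep hsep
    obtain ⟨h1, h2⟩ := heq (r a) (r b) hbd.1 hab hbd.2
    have hz := S.strictMono v hlt
    have hz' := S'.strictMono v hlt
    have hD : 0 < S.z v b - S.z v a := sub_pos.2 hz
    have hD' : 0 < S'.z v b - S'.z v a := sub_pos.2 hz'
    refine ⟨(S'.z v b - S'.z v a) / (S.z v b - S.z v a), S'.z v a -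
      (S'.z v b - S'.z v a) / (S.z v b - S.z v a) * S.z v a, div_pos hD' hD, fun m => ?_,
      fun hv => ?_⟩
    · have ham : r a ≤ r m := by
        rcases (show a ≤ m from Fin.le_def.2 (Nat.zero_le _)).lt_or_eq with h | h
        · exact (hrmono _ _ h).le
        · rw [h]
      have hmb : r m ≤ r b := by
        rcases (show m ≤ b from Fin.le_def.2 (Nat.le_sub_one_of_lt m.2)).lt_or_eq with h | h
        · exact (hrmono _ _ h).le
        · rw [h]
      have e1 := h.sum_cond_gaps hsep hab le_rfl ham hmb
      have e2 := h'.sum_cond_gaps hsep hab le_rfl ham hmb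
      rw [h1, e2] at e1
      simp only [NodalQuiltedDisk.pos_of_branchOf (hr _)] at e1
      rw [div_eq_div_iff hD'.ne' hD.ne'] at e1
      field_simp
      linear_combination e1
    · have hl : ((⟨n - 1, by omega⟩ : Fin n) : ℕ) + 1 = n := by simp only; omega
      have e1 := h.cond_seam_colored hsep hab hl hv
      have e2 := h'.cond_seam_colored hsep hab hl hv
      rw [h2, e2] at e1
      simp only [NodalQuiltedDisk.pos_of_branchOf (hr _)] at e1
      have hy := S.y_pos v hv
      have hy' := S'.y_pos v hv
      rw [div_eq_div_iff (by positivity) (by positivity)] at e1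
      field_simp
      linear_combination e1

/-- The combinatorial type is determined by the supports of the conditional system. -/
theorem realizes_congr {u u' : ℕ → ℝ} {y y' : ℝ} (h : T.1.Realizes u' y')
    (heq : ∀ i j, 1 ≤ i → i < j → j ≤ n →
      top (vec n u y) (gaps n i j) = top (vec n u' y') (gaps n i j) ∧
      top (vec n u y) (seamGaps n i j) = top (vec n u' y') (seamGaps n i j)) :
    T.1.Realizes u y := by
  refine fun v => ⟨fun g k hg hk hk' => ?_, fun g hg => ?_⟩
  · have hA := (h v).1
    have hb := bounds_of_sep hg
    have hk1 := (T.mem_leaves.1 (v.infix_leaves.subset hk)).1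
    have hk2 := (T.mem_leaves.1 (v.infix_leaves.subset hk')).2
    -- The smallest interval that contains both gaps `g` and `k`.
    obtain ⟨h1, -⟩ := heq (min g k) (max g k + 1) (by omega) (by omega) (by omega)
    have hmem : ∀ m ∈ gaps n (min g k) (max g k + 1), (m : ℕ) + 1 ∈ v.branches.flatten ∧
        (m : ℕ) + 1 + 1 ∈ v.branches.flatten := by
      intro m hm
      rw [mem_gaps] at hm
      have hc := v.consec T.consec
      have hmin : min g k ∈ v.branches.flatten := by rcases min_choice g k with h | h <;> rw [h]
                                                     exacts [hg.1, hk]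
      have hmax : max g k + 1 ∈ v.branches.flatten := by
        rcases max_choice g k with h | h <;> rw [h]
        exacts [hg.2.1, hk']
      exact ⟨hc.mem_of_le hmin hmax (by omega) (by omega),
        hc.mem_of_le hmin hmax (by omega) (by omega)⟩
    have hvec : ∀ (u : ℕ → ℝ) (y : ℝ), ∀ m ∈ gaps n (min g k) (max g k + 1),
        vec n u y m = u (m + 1) := fun u y m hm => by
      rw [mem_gaps] at hm
      exact vec_gap (by omega)
    have hgm : (⟨g - 1, by omega⟩ : Fin n) ∈ gaps n (min g k) (max g k + 1) :=
      mem_gaps.2 (by simp only; omega)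
    have hkm : (⟨k - 1, by omega⟩ : Fin n) ∈ gaps n (min g k) (max g k + 1) :=
      mem_gaps.2 (by simp only; omega)
    have hg1 : g - 1 + 1 = g := by omega
    have hk1 : k - 1 + 1 = k := by omega
    have hgtop : (⟨g - 1, by omega⟩ : Fin n) ∈
        top (vec n u' y') (gaps n (min g k) (max g k + 1)) := by
      refine mem_top.2 ⟨hgm, fun m hm => ?_⟩
      rw [hvec _ _ _ hm, hvec _ _ _ hgm]
      simp only [hg1]
      exact (hA g (m + 1) hg (hmem m hm).1 (hmem m hm).2).1
    have hgtop' := hgtop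
    rw [← h1] at hgtop'
    have hle := (mem_top.1 hgtop').2 _ hkm
    rw [hvec _ _ _ hkm, hvec _ _ _ hgm] at hle
    simp only [hg1, hk1] at hle
    refine ⟨hle, ?_⟩
    rw [← (hA g k hg hk hk').2]
    have hiff : ∀ (u : ℕ → ℝ) (y : ℝ), (⟨g - 1, by omega⟩ : Fin n) ∈
        top (vec n u y) (gaps n (min g k) (max g k + 1)) → (u k = u g ↔
        (⟨k - 1, by omega⟩ : Fin n) ∈ top (vec n u y) (gaps n (min g k) (max g k + 1))) := by
      intro u y hgt
      have h3 := hvec u y _ hkm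
      have h4 := hvec u y _ hgm
      simp only [hg1, hk1] at h3 h4
      constructor
      · intro heq
        refine mem_top.2 ⟨hkm, fun m hm => ?_⟩
        rw [h3, heq, ← h4]
        exact (mem_top.1 hgt).2 m hm
      · intro hkt
        have h5 := (mem_top.1 hgt).2 _ hkm
        have h6 := (mem_top.1 hkt).2 _ hgm
        rw [h3, h4] at h5
        rw [h3, h4] at h6
        exact le_antisymm h5 h6
    rw [hiff u y hgtop', hiff u' y' hgtop, h1]
  · have hb := bounds_of_sep hg
    have hC := (h v).2 g hg
    obtain ⟨-, h1⟩ := heq g (g + 1) hb.1 (Nat.lt_succ_self g) hb.2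
    have hg1 : g - 1 + 1 = g := by omega
    -- This set consists of the gap `g` and the seam only, so its support tells how `u g` compares
    -- with `y`.
    have hmem : ∀ m : Fin n, m ∈ seamGaps n g (g + 1) ↔ m = ⟨g - 1, by omega⟩ ∨
        m = ⟨n - 1, by omega⟩ := by
      intro m
      rw [mem_seamGaps, Fin.ext_iff, Fin.ext_iff]
      simp only
      omega
    have hg' : ∀ (u : ℕ → ℝ) (y : ℝ), vec n u y ⟨g - 1, by omega⟩ = u g := fun u y => by
      rw [vec_gap (by simp only; omega)]
      simp only [hg1]
    have hl' : ∀ (u : ℕ → ℝ) (y : ℝ), vec n u y ⟨n - 1, by omega⟩ = y := fun u y =>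
      vec_seam (by simp only; omega)
    have hgt : ∀ (u : ℕ → ℝ) (y : ℝ), (⟨g - 1, by omega⟩ : Fin n) ∈
        top (vec n u y) (seamGaps n g (g + 1)) ↔ y ≤ u g := by
      intro u y
      simp only [mem_top, hmem, true_or, true_and, forall_eq_or_imp, forall_eq, hg', hl', le_refl]
    have hlt : ∀ (u : ℕ → ℝ) (y : ℝ), (⟨n - 1, by omega⟩ : Fin n) ∈
        top (vec n u y) (seamGaps n g (g + 1)) ↔ u g ≤ y := by
      intro u y
      simp only [mem_top, hmem, or_true, true_and, forall_eq_or_imp, forall_eq, hg', hl', le_refl,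
        and_true]
    have e1 := hgt u y
    have e2 := hlt u y
    rw [h1, hgt u' y'] at e1
    rw [h1, hlt u' y'] at e2
    cases hlev : v.level <;> rw [hlev] at hC <;> simp only [Level.Compat] at hC ⊢
    · exact not_le.1 fun h => absurd (e2.2 h) (not_le.2 hC)
    · exact le_antisymm (e2.1 hC.le) (e1.1 hC.ge)
    · exact not_le.1 fun h => absurd (e1.2 h) (not_le.2 hC)

end Fits

/-! ### The moduli space as a set of conditional systems -/

section System

variable {n : ℕ}

/-- Pairs of leaves, with the seam (`true`) or without (`false`). -/
abbrev Idx (n : ℕ) : Type := {p : Fin (n + 1) × Fin (n + 1) // 0 < p.1 ∧ p.1 < p.2} × Bool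

/-- The intervals of gaps between two leaves, with or without the seam. -/
def family (n : ℕ) (α : Idx n) : Finset (Fin n) :=
  if α.2 then seamGaps n α.1.1.1 α.1.1.2 else gaps n α.1.1.1 α.1.1.2

theorem Idx.bounds (α : Idx n) : 1 ≤ (α.1.1.1 : ℕ) ∧ (α.1.1.1 : ℕ) < α.1.1.2 ∧
    (α.1.1.2 : ℕ) ≤ n :=
  ⟨Fin.lt_def.1 α.1.2.1, Fin.lt_def.1 α.1.2.2, Nat.lt_succ_iff.1 α.1.1.2.2⟩

/-- The index given by a pair of leaves. -/
def Idx.mk {i j : ℕ} (hi : 1 ≤ i) (hij : i < j) (hj : j ≤ n) (b : Bool) : Idx n :=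
  (⟨(⟨i, by omega⟩, ⟨j, by omega⟩), Fin.lt_def.2 hi, Fin.lt_def.2 hij⟩, b)

theorem family_mk_true {i j : ℕ} (hi : 1 ≤ i) (hij : i < j) (hj : j ≤ n) :
    family n (Idx.mk hi hij hj true) = seamGaps n i j := rfl

theorem family_nonempty (α : Idx n) : (family n α).Nonempty := by
  obtain ⟨h1, h2, h3⟩ := α.bounds
  unfold family
  split_ifs
  exacts [seamGaps_nonempty h1 h2 h3, gaps_nonempty h1 h2 h3]

theorem forall_family {P : Finset (Fin n) → Prop} : (∀ α, P (family n α)) ↔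
    ∀ i j, 1 ≤ i → i < j → j ≤ n → P (gaps n i j) ∧ P (seamGaps n i j) := by
  constructor
  · intro h i j hi hij hj
    exact ⟨h (Idx.mk hi hij hj false), h (Idx.mk hi hij hj true)⟩
  · intro h α
    obtain ⟨h1, h2, h3⟩ := α.bounds
    unfold family
    split_ifs
    exacts [(h _ _ h1 h2 h3).2, (h _ _ h1 h2 h3).1]

theorem Fits.cond_family_unique {T : CombType n} {S : NodalQuiltedDisk T.1} {u t u' t' : ℕ → ℝ}
    {y s y' s' : ℝ} (h : Fits S u t y s) (h' : Fits S u' t' y' s') (α : Idx n) :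
    cond (vec n u y) (vec n t s) (family n α) = cond (vec n u' y') (vec n t' s') (family n α) :=
  forall_family (P := fun s' => cond _ _ s' = cond _ _ s').2
    (fun _ _ hi hij hj => h.cond_unique h' hi hij hj) α

/-- The conditional system of a point of the moduli space. -/
def Mbar.system (X : Mbar n) (α : Idx n) : Fin n → ℝ :=
  cond (vec n (exists_fits X.2.out).choose 0)
    (vec n (exists_fits X.2.out).choose_spec.choose 1) (family n α)

/-- The point of the moduli space given by a disk. -/
def Mbar.mk {T : CombType n} (S : NodalQuiltedDisk T.1) : Mbar n :=
  ⟨T, Quotient.mk (NodalQuiltedDisk.setoid T.1) S⟩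

theorem Mbar.exists_eq_mk (X : Mbar n) : ∃ S : NodalQuiltedDisk X.1.1, X = Mbar.mk S :=
  ⟨X.2.out, Sigma.ext rfl (heq_of_eq (Quotient.out_eq X.2).symm)⟩

theorem Mbar.system_mk {T : CombType n} {S : NodalQuiltedDisk T.1} {u t : ℕ → ℝ} {y s : ℝ}
    (h : Fits S u t y s) :
    (Mbar.mk S).system = fun α => cond (vec n u y) (vec n t s) (family n α) := by
  have hiso : NodalQuiltedDisk.Iso S (Mbar.mk S).2.out :=
    (NodalQuiltedDisk.setoid T.1).symm (Quotient.mk_out (s := NodalQuiltedDisk.setoid T.1) S)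
  funext α
  exact Fits.cond_family_unique (exists_fits (Mbar.mk S).2.out).choose_spec.choose_spec
    (h.iso hiso) α

theorem Mbar.range_system (hn : 0 < n) : range (Mbar.system (n := n)) = systems (family n) := by
  apply Subset.antisymm
  · rintro _ ⟨X, rfl⟩
    obtain ⟨S, hS⟩ := X.exists_eq_mk
    obtain ⟨u, t, h⟩ := exists_fits S
    rw [hS, Mbar.system_mk h]
    exact ⟨_, _, h.vec_pos, rfl⟩
  · rintro _ ⟨u, t, ht, rfl⟩
    obtain ⟨u, y, rfl⟩ := exists_eq_vec hn u
    obtain ⟨t, s, h'⟩ := exists_eq_vec hn t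
    -- `vec` reads only the values at 1, …, n-1, whereas `Fits` asks for positive weights at all
    -- indices.
    let t' : ℕ → ℝ := fun g => if 0 < t g then t g else 1
    have ht' : ∀ g, 0 < t' g := by
      intro g
      simp only [t']
      split_ifs with h
      exacts [h, one_pos]
    have hs : 0 < s := by
      have := ht ⟨n - 1, by omega⟩
      rwa [h', vec_seam (by simp only; omega)] at this
    have hvec : vec n t s = vec n t' s := by
      funext m
      have := ht m
      unfold vec
      split_ifs with h
      · rfl
      · rw [h', vec_gap h] at this
        simp only [t', if_pos this]
    obtain ⟨T, S, hS⟩ := exists_disk_fits hn u y ht' hs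
    refine ⟨Mbar.mk S, ?_⟩
    rw [Mbar.system_mk hS, h', hvec]

/-- The supports are described by the breaks and levels of the vertices where leaves meet.
Conversely they determine all comparisons of heights that enter `Realizes`, and a tree is determined
by the heights it realizes. -/
theorem combType_eq_iff {T T' : CombType n} {u u' : ℕ → ℝ} {y y' : ℝ} (h : T.1.Realizes u y)
    (h' : T'.1.Realizes u' y') : T = T' ↔
      ∀ α, top (vec n u y) (family n α) = top (vec n u' y') (family n α) := by
  constructor
  · rintro rfl
    refine (forall_family (P := fun s => top (vec n u y) s = top (vec n u' y') s)).2
      fun i j hi hij hj => ?_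
    obtain ⟨v, hv⟩ := T.exists_sep hi hij hj
    constructor
    · ext m
      by_cases hm : m ∈ gaps n i j
      · rw [mem_top_gaps h hv hij hm, mem_top_gaps h' hv hij hm]
      · exact iff_of_false (fun h => hm (top_subset _ _ h)) fun h => hm (top_subset _ _ h)
    · ext m
      by_cases hm : m ∈ seamGaps n i j
      · rw [mem_top_seamGaps h hv hij hm, mem_top_seamGaps h' hv hij hm]
      · exact iff_of_false (fun h => hm (top_subset _ _ h)) fun h => hm (top_subset _ _ h)
  · intro heq
    have heq' := (forall_family (P := fun s => top (vec n u y) s = top (vec n u' y') s)).1 heq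
    exact Subtype.ext (CTree.eq_of_realizes T.consec (T.2.trans T'.2.symm) h
      (realizes_congr h' heq'))

theorem top_eq_of_cond_eq {ι : Type*} {u t u' t' : ι → ℝ} {s : Finset ι} (ht : ∀ g, 0 < t g)
    (ht' : ∀ g, 0 < t' g) (h : cond u t s = cond u' t' s) : top u s = top u' s := by
  ext g
  rw [← cond_pos_iff ht, ← cond_pos_iff ht', h]

/-- The supports give the combinatorial type; after identifying the types, the values give an
isomorphism of disks. -/
theorem Mbar.system_injective : Function.Injective (Mbar.system (n := n)) := by
  intro X X' hX
  obtain ⟨S, hS⟩ := X.exists_eq_mk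
  obtain ⟨S', hS'⟩ := X'.exists_eq_mk
  obtain ⟨T, X⟩ := X
  obtain ⟨T', X'⟩ := X'
  simp only at S S'
  obtain ⟨u, t, h⟩ := exists_fits S
  obtain ⟨u', t', h'⟩ := exists_fits S'
  rw [hS, hS', Mbar.system_mk h, Mbar.system_mk h'] at hX
  have hc := congrFun hX
  obtain rfl := (combType_eq_iff h.realizes h'.realizes).2 fun α =>
    top_eq_of_cond_eq h.vec_pos h'.vec_pos (hc α)
  rw [hS, hS']
  have hiso : S.Iso S' :=
    iso_of_cond_eq h h' (forall_family (P := fun s => cond _ _ s = cond _ _ s).1 hc)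
  exact Sigma.ext rfl (heq_of_eq (Quotient.sound hiso))

end System

/-! ### Cross-ratios as functions of the conditional system -/

section Theta

/-- The function `1 - 1 / s`, with value `-∞` at `s ≤ 0`. -/
def theta (s : ℝ) : EReal := -((ENNReal.ofReal s)⁻¹ : ENNReal) + (1 : ℝ)

theorem continuous_theta : Continuous theta := by
  -- Addition on `EReal` is continuous where one summand is finite; inversion in `ENNReal` takes
  -- care of the pole at 0.
  have h : Continuous fun a : EReal => a + (1 : ℝ) := continuous_iff_continuousAt.2 fun a =>
    (EReal.continuousAt_add (p := (a, ((1 : ℝ) : EReal))) (Or.inr (EReal.coe_ne_bot 1))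
      (Or.inr (EReal.coe_ne_top 1))).comp (f := fun a => (a, ((1 : ℝ) : EReal)))
        (by fun_prop)
  exact h.comp (continuous_neg.comp (continuous_coe_ennreal_ereal.comp
    (continuous_inv.comp ENNReal.continuous_ofReal)))

theorem theta_of_nonpos {s : ℝ} (hs : s ≤ 0) : theta s = ⊥ := by
  simp [theta, ENNReal.ofReal_of_nonpos hs]

theorem theta_of_pos {s : ℝ} (hs : 0 < s) : theta s = ((1 - 1 / s : ℝ) : EReal) := by
  rw [theta, ← ENNReal.ofReal_inv_of_pos hs, EReal.coe_ennreal_ofReal,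
    max_eq_left (inv_pos.2 hs).le, ← EReal.coe_neg, ← EReal.coe_add]
  congr 1
  rw [one_div]
  ring

theorem theta_one : theta 1 = 0 := by
  rw [theta_of_pos one_pos]
  simp

theorem theta_injOn : InjOn theta (Ici 0) := by
  intro s hs s' hs' h
  rcases (mem_Ici.1 hs).eq_or_lt with h0 | h0 <;> rcases (mem_Ici.1 hs').eq_or_lt with h0' | h0'
  · rw [← h0, ← h0']
  · rw [theta_of_nonpos h0.ge, theta_of_pos h0'] at h
    exact absurd h.symm (EReal.coe_ne_bot _)
  · rw [theta_of_nonpos h0'.ge, theta_of_pos h0] at h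
    exact absurd h (EReal.coe_ne_bot _)
  · rw [theta_of_pos h0, theta_of_pos h0', EReal.coe_eq_coe_iff] at h
    have : 1 / s = 1 / s' := by linarith
    rwa [one_div, one_div, inv_inj] at this

end Theta

/-! ### Recovering a conditional system from its cross-ratios -/

section Invariants

variable {n : ℕ}

/-- The mass that the distribution on the gaps between `i` and `j` gives to the gaps between `k` and
`l`; it is `1` by convention if `i` is not a leaf. -/
def mass (x : Idx n → Fin n → ℝ) (i j k l : ℕ) : ℝ :=
  if h : 1 ≤ i ∧ i < j ∧ j ≤ n then ∑ m ∈ gaps n k l, x (Idx.mk h.1 h.2.1 h.2.2 false) m else 1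

theorem mass_eq {x : Idx n → Fin n → ℝ} {i j k l : ℕ} (hi : 1 ≤ i) (hij : i < j) (hj : j ≤ n) :
    mass x i j k l = ∑ m ∈ gaps n k l, x (Idx.mk hi hij hj false) m := dif_pos ⟨hi, hij, hj⟩

/-- Marking 0 sits at infinity; the value 1 is the limit of the factor (b - a) / (c - a) of the
cross-ratio when a tends to infinity. -/
theorem mass_zero {x : Idx n → Fin n → ℝ} {j k l : ℕ} : mass x 0 j k l = 1 :=
  dif_neg fun h => absurd h.1 (by decide)

theorem continuous_mass (i j k l : ℕ) :
    Continuous fun x : Idx n → Fin n → ℝ => mass x i j k l := by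
  unfold mass
  split_ifs
  · exact continuous_finsetSum _ fun m _ => (continuous_apply m).comp (continuous_apply _)
  · exact continuous_const

/-- The cross-ratios expressed in terms of the conditional system. -/
def invariants (x : Idx n → Fin n → ℝ) : ((Fin 4 ↪o Fin (n + 1)) → EReal) ×
    ({p : Fin (n + 1) × Fin (n + 1) // 0 < p.1 ∧ p.1 < p.2} → EReal) :=
  (fun p => theta (mass x (p 0) (p 2) (p 0) (p 1) * mass x (p 1) (p 3) (p 2) (p 3)),
    fun p => - theta (∑ m ∈ gaps n p.1.1 p.1.2, x (p, true) m))

theorem continuous_invariants : Continuous (invariants (n := n)) := by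
  refine Continuous.prodMk (continuous_pi fun p => ?_) (continuous_pi fun p => ?_)
  · exact continuous_theta.comp ((continuous_mass _ _ _ _).mul (continuous_mass _ _ _ _))
  · exact (continuous_theta.comp (continuous_finsetSum _ fun m _ =>
      (continuous_apply m).comp (continuous_apply _))).neg

theorem mass_nonneg {x : Idx n → Fin n → ℝ} (hx : x ∈ systems (family n)) (i j k l : ℕ) :
    0 ≤ mass x i j k l := by
  obtain ⟨u, t, ht, rfl⟩ := hx
  unfold mass
  split_ifs
  · exact Finset.sum_nonneg fun m _ => cond_nonneg ht
  · exact zero_le_one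

/-- An order embedding of four elements. -/
def quadruple {j k l : ℕ} (hj : 1 ≤ j) (hjk : j < k) (hkl : k < l) (hl : l ≤ n) :
    Fin 4 ↪o Fin (n + 1) :=
  OrderEmbedding.ofStrictMono ![⟨0, by omega⟩, ⟨j, by omega⟩, ⟨k, by omega⟩, ⟨l, by omega⟩] <| by
    rw [Fin.strictMono_iff_lt_succ]
    intro a
    fin_cases a
    · exact Fin.lt_def.2 hj
    · exact Fin.lt_def.2 hjk
    · exact Fin.lt_def.2 hkl

theorem sum_gaps_eq_add (f : Fin n → ℝ) {j l : ℕ} {m : Fin n} (hm : m ∈ gaps n j l) :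
    ∑ k ∈ gaps n (m + 1) l, f k = f m + ∑ k ∈ gaps n (m + 2) l, f k := by
  classical
  rw [mem_gaps] at hm
  have : gaps n (m + 1) l = insert m (gaps n (m + 2) l) := by
    ext k
    rw [Finset.mem_insert, mem_gaps, mem_gaps, Fin.ext_iff]
    omega
  rw [this, Finset.sum_insert]
  rw [mem_gaps]
  omega

/-- Quadruples 0 < j < k < l have first factor 1 and give the tail masses of all gap distributions;
differences of tails are the single values. The pairs give the total mass of the gaps in a
distribution with seam, and compatibility distributes it over the gaps. -/
theorem invariants_injOn : InjOn (invariants (n := n)) (systems (family n)) := by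
  intro x hx x' hx' h
  obtain ⟨h1, h2⟩ := Prod.ext_iff.1 h
  have hnn : ∀ p : Fin 4 ↪o Fin (n + 1), mass x (p 0) (p 2) (p 0) (p 1) *
      mass x (p 1) (p 3) (p 2) (p 3) = mass x' (p 0) (p 2) (p 0) (p 1) *
      mass x' (p 1) (p 3) (p 2) (p 3) := fun p =>
    theta_injOn (mem_Ici.2 (mul_nonneg (mass_nonneg hx _ _ _ _) (mass_nonneg hx _ _ _ _)))
      (mem_Ici.2 (mul_nonneg (mass_nonneg hx' _ _ _ _) (mass_nonneg hx' _ _ _ _))) (congrFun h1 p)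
  have htail : ∀ {j k l : ℕ} (hj : 1 ≤ j) (hjk : j < k) (hkl : k < l) (hl : l ≤ n),
      ∑ m ∈ gaps n k l, x (Idx.mk hj (hjk.trans hkl) hl false) m =
        ∑ m ∈ gaps n k l, x' (Idx.mk hj (hjk.trans hkl) hl false) m := by
    intro j k l hj hjk hkl hl
    have := hnn (quadruple hj hjk hkl hl)
    simp only [quadruple, OrderEmbedding.coe_ofStrictMono, Matrix.cons_val_zero,
      Matrix.cons_val_one, Matrix.cons_val] at this
    rwa [mass_zero, mass_zero, one_mul, one_mul, mass_eq hj (hjk.trans hkl) hl,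
      mass_eq hj (hjk.trans hkl) hl] at this
  have hq : ∀ p, ∑ m ∈ gaps n p.1.1 p.1.2, x (p, true) m = ∑ m ∈ gaps n p.1.1 p.1.2, x' (p, true) m := by
    intro p
    obtain ⟨u, t, ht, rfl⟩ := hx
    obtain ⟨u', t', ht', rfl⟩ := hx'
    exact theta_injOn (mem_Ici.2 (Finset.sum_nonneg fun m _ => cond_nonneg ht))
      (mem_Ici.2 (Finset.sum_nonneg fun m _ => cond_nonneg ht')) (neg_injective (congrFun h2 p))
  obtain ⟨u, t, ht, rfl⟩ := hx
  obtain ⟨u', t', ht', rfl⟩ := hx'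
  have hgap : ∀ {i j : ℕ}, 1 ≤ i → i < j → j ≤ n →
      cond u t (gaps n i j) = cond u' t' (gaps n i j) := by
    intro i j hi hij hj
    have htail' : ∀ k, i ≤ k → k ≤ j → ∑ m ∈ gaps n k j, cond u t (gaps n i j) m =
        ∑ m ∈ gaps n k j, cond u' t' (gaps n i j) m := by
      intro k hik hkj
      rcases hik.eq_or_lt with rfl | hik
      · rw [sum_cond ht (gaps_nonempty hi hij hj), sum_cond ht' (gaps_nonempty hi hij hj)]
      rcases hkj.eq_or_lt with rfl | hkj
      · have : gaps n k k = ∅ := by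
          ext m
          simp only [mem_gaps, Finset.notMem_empty, iff_false]
          omega
        rw [this, Finset.sum_empty, Finset.sum_empty]
      · exact htail hi hik hkj hj
    funext m
    by_cases hm : m ∈ gaps n i j
    · have e1 := sum_gaps_eq_add (cond u t (gaps n i j)) hm
      have e2 := sum_gaps_eq_add (cond u' t' (gaps n i j)) hm
      rw [mem_gaps] at hm
      rw [htail' _ hm.1 (by omega), htail' _ (by omega) (by omega)] at e1
      linarith
    · rw [cond_of_notMem_set hm, cond_of_notMem_set hm]
  funext α
  refine (forall_family (P := fun s => cond u t s = cond u' t' s)).2 (fun i j hi hij hj =>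
    ⟨hgap hi hij hj, ?_⟩) α
  have hq' : ∑ m ∈ gaps n i j, cond u t (seamGaps n i j) m =
      ∑ m ∈ gaps n i j, cond u' t' (seamGaps n i j) m := hq (Idx.mk hi hij hj true).1
  have hl : ((⟨n - 1, by omega⟩ : Fin n) : ℕ) + 1 = n := by simp only; omega
  funext m
  by_cases hm : m ∈ gaps n i j
  · rw [cond_consistent ht (gaps_subset i j) hm, cond_consistent ht' (gaps_subset i j) hm, hq',
      hgap hi hij hj]
  by_cases hm' : m ∈ seamGaps n i j
  · have hm2 : (m : ℕ) + 1 = n := (mem_seamGaps.1 hm').resolve_left fun h' => hm (mem_gaps.2 h')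
    have e1 := sum_cond (u := u) ht (seamGaps_nonempty hi hij hj)
    have e2 := sum_cond (u := u') ht' (seamGaps_nonempty hi hij hj)
    rw [sum_seamGaps _ hj hm2] at e1 e2
    linarith
  · rw [cond_of_notMem_set hm', cond_of_notMem_set hm']

end Invariants

/-! ### Evaluation of the cross-ratios of a disk -/

section CrossRatios

variable {n : ℕ} {T : CombType n} {S : NodalQuiltedDisk T.1} {u t : ℕ → ℝ} {y s : ℝ} {v : T.1.Vert}
  {i j k l : ℕ}

/-- A vertex separating `i` and `j` is `v` or lies below `v`, so it cannot carry the leaf `k`. -/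
theorem not_sep_of_notMem (hi : i ∈ v.branches.flatten) (hj : j ∈ v.branches.flatten)
    (hk : k ∉ v.branches.flatten) {w : T.1.Vert} (hw : k ∈ w.branches.flatten) :
    ¬ Sep w.branches i j := by
  intro h
  rcases CTree.Vert.eq_or_nested T.consec hi hj h with rfl | ⟨-, ⟨L, hL, hsub⟩, -⟩
  · exact hk hw
  · exact hk (List.mem_flatten.2 ⟨L, hL, hsub hw⟩)

theorem Fits.mass_eq_div (h : Fits S u t y s) (hv : Sep v.branches i j) (hij : i < j)
    (hik : i ≤ k) (hkl : k ≤ l) (hlj : l ≤ j) : mass (Mbar.mk S).system i j k l =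
      (S.pos v l - S.pos v k) / (S.pos v j - S.pos v i) := by
  have hb := bounds_of_sep hv
  rw [mass_eq hb.1 hij hb.2, Mbar.system_mk h]
  exact h.sum_cond_gaps hv hij hik hkl hlj

/-- If the node at `v` separates the leaves `i < j` from the leaf `l`, then the distribution on the
gaps between `i` and `l` vanishes between `i` and `j`. -/
theorem Fits.mass_left (h : Fits S u t y s) (hi : i ∈ v.branches.flatten)
    (hj : j ∈ v.branches.flatten) (hij : i < j) (hl : l ∉ v.branches.flatten) (hjl : j < l)
    (hln : l ≤ n) : mass (Mbar.mk S).system i l i j = 0 ∧ mass (Mbar.mk S).system i l j l = 1 := by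
  have hi1 := (T.mem_leaves.1 (v.infix_leaves.subset hi)).1
  have hil := hij.trans hjl
  obtain ⟨w, hw⟩ := T.exists_sep hi1 hil hln
  have hns := not_sep_of_notMem hi hj hl hw.2.1
  have hpos := (NodalQuiltedDisk.pos_eq_iff (S := S) T.consec hw.1
    (mem_flatten_of_sep hw hij.le hjl.le)).2 hns
  rw [h.mass_eq_div hw hil le_rfl hij.le hjl.le, h.mass_eq_div hw hil hij.le hjl.le le_rfl, ← hpos]
  exact ⟨by rw [sub_self, zero_div],
    div_self (sub_pos.2 (NodalQuiltedDisk.pos_lt T.consec hw hil)).ne'⟩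

/-- Mirror image of `Fits.mass_left`, except that `l` may be the marking 0. The second claim then
holds by the convention for `mass`, while the first would fail. -/
theorem Fits.mass_right (h : Fits S u t y s) (hi : i ∈ v.branches.flatten)
    (hj : j ∈ v.branches.flatten) (hij : i < j) (hl : l ∉ v.branches.flatten) (hli : l < i) :
    (1 ≤ l → mass (Mbar.mk S).system l j i j = 0) ∧ mass (Mbar.mk S).system l j l i = 1 := by
  have hlj := hli.trans hij
  have hjn := (T.mem_leaves.1 (v.infix_leaves.subset hj)).2
  rcases Nat.eq_zero_or_pos l with rfl | hl1
  · exact ⟨fun h => absurd h (by decide), mass_zero⟩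
  obtain ⟨w, hw⟩ := T.exists_sep hl1 hlj hjn
  have hns := not_sep_of_notMem hi hj hl hw.1
  have hpos := (NodalQuiltedDisk.pos_eq_iff (S := S) T.consec
    (mem_flatten_of_sep hw hli.le hij.le) hw.2.1).2 hns
  rw [h.mass_eq_div hw hlj hli.le hij.le le_rfl, h.mass_eq_div hw hlj le_rfl hli.le hij.le, hpos]
  exact ⟨fun _ => by rw [sub_self, zero_div],
    div_self (sub_pos.2 (NodalQuiltedDisk.pos_lt T.consec hw hlj)).ne'⟩

theorem noThreeEqual_iff {α : Type*} {w : Fin 4 → α} : NoThreeEqual w ↔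
    ¬ (w 0 = w 1 ∧ w 1 = w 2) ∧ ¬ (w 0 = w 1 ∧ w 1 = w 3) ∧ ¬ (w 0 = w 2 ∧ w 2 = w 3) ∧
      ¬ (w 1 = w 2 ∧ w 2 = w 3) := by
  constructor
  · exact fun h => ⟨h 0 1 2 (by decide) (by decide) (by decide),
      h 0 1 3 (by decide) (by decide) (by decide), h 0 2 3 (by decide) (by decide) (by decide),
      h 1 2 3 (by decide) (by decide) (by decide)⟩
  · rintro ⟨h1, h2, h3, h4⟩ a b c hab hac hbc ⟨e1, e2⟩
    fin_cases a <;> fin_cases b <;> fin_cases c <;> simp_all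

theorem sep_of_le (h : Sep v.branches i j) (hij : i ≤ j) (hjk : j ≤ k)
    (hk : k ∈ v.branches.flatten) : Sep v.branches i k := by
  rw [CTree.Vert.sep_iff_branchOf T.consec] at h ⊢
  obtain ⟨a, b, ha, hb, hab⟩ := h
  obtain ⟨c, hc⟩ := CTree.Vert.exists_branchOf T.consec hk
  refine ⟨a, c, ha, hc, ((lt_of_le_of_ne (CTree.Vert.branchOf_le T.consec ha hb hij) hab).trans_le
    (CTree.Vert.branchOf_le T.consec hb hc hjk)).ne⟩

theorem branchOf_ne (h : Sep v.branches i j) : v.branchOf i ≠ v.branchOf j := by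
  obtain ⟨a, b, ha, hb, hab⟩ := (CTree.Vert.sep_iff_branchOf T.consec).1 h
  rw [ha, hb]
  exact fun h' => hab (Option.some_inj.1 h')

theorem branchOf_ne_of_notMem (hi : i ∈ v.branches.flatten) (hj : j ∉ v.branches.flatten) :
    v.branchOf i ≠ v.branchOf j := by
  obtain ⟨a, ha⟩ := CTree.Vert.exists_branchOf T.consec hi
  rw [ha, (CTree.Vert.branchOf_eq_none T.consec).2 hj]
  exact Option.some_ne_none a

/-- Four markings always have a component where no three of them coincide. -/
theorem exists_noThreeEqual {p : Fin 4 → ℕ} (hp : StrictMono p) (hn : p 3 ≤ n) :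
    ∃ v : T.1.Vert, NoThreeEqual fun m => v.branchOf (p m) := by
  have h01 : p 0 < p 1 := hp (by decide)
  have h12 : p 1 < p 2 := hp (by decide)
  have h23 : p 2 < p 3 := hp (by decide)
  have h1 : 1 ≤ p 1 := by omega
  -- Candidates are the meeting vertex `w` of `p 1`, `p 3` and, if `p 0` lies below `w`, the meeting
  -- vertex `v` of `p 0`, `p 2`. Either `p 3` is on the root side of `v` and `v` works, or the two
  -- vertices coincide.
  obtain ⟨w, hw⟩ := T.exists_sep h1 (h12.trans h23) hn
  by_cases h0w : p 0 ∈ w.branches.flatten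
  swap
  · refine ⟨w, noThreeEqual_iff.2 ⟨fun h => ?_, fun h => ?_, fun h => ?_, fun h => ?_⟩⟩
    · exact branchOf_ne_of_notMem hw.1 h0w h.1.symm
    · exact branchOf_ne_of_notMem hw.1 h0w h.1.symm
    · exact branchOf_ne_of_notMem hw.2.1 h0w (h.1.trans h.2).symm
    · exact branchOf_ne hw (h.1.trans h.2)
  have h00 := (T.mem_leaves.1 (w.infix_leaves.subset h0w)).1
  obtain ⟨v, hv⟩ := T.exists_sep h00 (h01.trans h12) (h23.le.trans hn)
  by_cases h3v : p 3 ∈ v.branches.flatten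
  swap
  · refine ⟨v, noThreeEqual_iff.2 ⟨fun h => ?_, fun h => ?_, fun h => ?_, fun h => ?_⟩⟩
    · exact branchOf_ne hv (h.1.trans h.2)
    · exact branchOf_ne_of_notMem hv.1 h3v (h.1.trans h.2)
    · exact branchOf_ne hv h.1
    · exact branchOf_ne_of_notMem hv.2.1 h3v h.2
  have hvw : v = w := by
    refine (CTree.Vert.eq_or_nested T.consec (mem_flatten_of_sep hv h01.le h12.le) h3v
      hw).resolve_right ?_
    rintro ⟨-, ⟨L, hL, hsub⟩, -⟩
    exact hv.2.2 L hL ⟨hsub h0w, hsub (mem_flatten_of_sep hw h12.le h23.le)⟩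
  subst hvw
  have h03 := sep_of_le hv (h01.trans h12).le h23.le h3v
  refine ⟨v, noThreeEqual_iff.2 ⟨fun h => ?_, fun h => ?_, fun h => ?_, fun h => ?_⟩⟩
  · exact branchOf_ne hv (h.1.trans h.2)
  · exact branchOf_ne h03 (h.1.trans h.2)
  · exact branchOf_ne hv h.1
  · exact branchOf_ne hw (h.1.trans h.2)

/-- The cross-ratio of four distinct or partly coinciding real points. -/
theorem crossRatio_coe {a b c d : ℝ} (hab : a ≤ b) (hbc : b ≤ c) (hcd : c ≤ d) (hac : a < c)
    (hbd : b < d) : crossRatio (a : OnePoint ℝ) (b : OnePoint ℝ) (c : OnePoint ℝ) (d : OnePoint ℝ) =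
      theta ((b - a) / (c - a) * ((d - c) / (d - b))) := by
  have h1 := sub_pos.2 hac
  have h2 := sub_pos.2 hbd
  unfold crossRatio
  simp only [OnePoint.coe_eq_coe]
  split_ifs with c1 c2 c3
  · rw [theta_of_nonpos]
    rcases c1 with rfl | rfl <;> simp
  · rcases c2 with rfl | rfl
    · rw [div_self h1.ne', div_self h2.ne', one_mul, theta_one]
    · linarith
  · rcases c3 with rfl | rfl <;> linarith
  · push Not at c1
    have h3 : 0 < b - a := sub_pos.2 (lt_of_le_of_ne hab c1.1)
    have h4 : 0 < d - c := sub_pos.2 (lt_of_le_of_ne hcd c1.2)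
    rw [theta_of_pos (by positivity)]
    congr 1
    show (b - c) * (d - a) / ((a - b) * (c - d)) = _
    rw [show (a - b) * (c - d) = (b - a) * (d - c) by ring]
    field_simp
    ring

theorem crossRatio_infty_left {b c d : ℝ} (hcd : c ≤ d) (hbd : b < d) :
    crossRatio OnePoint.infty (b : OnePoint ℝ) (c : OnePoint ℝ) (d : OnePoint ℝ) =
      theta (1 * ((d - c) / (d - b))) := by
  have h2 := sub_pos.2 hbd
  unfold crossRatio
  simp only [OnePoint.coe_eq_coe, OnePoint.infty_ne_coe, false_or, or_false]
  split_ifs with c1 c2 c3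
  · rw [theta_of_nonpos]
    rw [c1]; simp
  · rw [c2, div_self (c2 ▸ h2.ne'), one_mul, theta_one]
  · linarith
  · have h4 : 0 < d - c := sub_pos.2 (lt_of_le_of_ne hcd c1)
    rw [theta_of_pos (by positivity)]
    congr 1
    show (b - c) * (-1) / (1 * (c - d)) = _
    rw [show 1 * (c - d) = -(d - c) by ring]
    field_simp
    ring

theorem crossRatio_infty_right {a b c : ℝ} (hab : a ≤ b) (hac : a < c) :
    crossRatio (a : OnePoint ℝ) (b : OnePoint ℝ) (c : OnePoint ℝ) OnePoint.infty =
      theta ((b - a) / (c - a) * 1) := by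
  have h1 := sub_pos.2 hac
  unfold crossRatio
  simp only [OnePoint.coe_eq_coe, OnePoint.coe_ne_infty, or_false]
  split_ifs with c1 c2 c3
  · rw [theta_of_nonpos]
    rw [c1]; simp
  · rw [c2, div_self h1.ne', one_mul, theta_one]
  · linarith
  · have h3 : 0 < b - a := sub_pos.2 (lt_of_le_of_ne hab c1)
    rw [theta_of_pos (by positivity)]
    congr 1
    show (b - c) * 1 / ((a - b) * (-1)) = _
    rw [show (a - b) * (-1) = b - a by ring]
    field_simp
    ring

theorem image_eq_of_branchOf_eq (h : v.branchOf i = v.branchOf j) : S.image v i = S.image v j := by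
  unfold NodalQuiltedDisk.image
  rw [h]

/-- The cases record which markings lie on the root side of `v`, where their image is ∞. If only `p
0` or only `p 3` does, the corresponding factor is 1; if both and no others do, both factors are 1.
If two neighbouring markings at an end coincide at ∞, one factor is 0 and the cross-ratio is -∞. -/
theorem Fits.crossRatio_eq (h : Fits S u t y s) {p : Fin 4 → ℕ} (hp : StrictMono p) (hn : p 3 ≤ n)
    (hv : NoThreeEqual fun m => v.branchOf (p m)) :
    crossRatio (S.image v (p 0)) (S.image v (p 1)) (S.image v (p 2)) (S.image v (p 3)) =
      theta (mass (Mbar.mk S).system (p 0) (p 2) (p 0) (p 1) *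
        mass (Mbar.mk S).system (p 1) (p 3) (p 2) (p 3)) := by
  have h01 : p 0 < p 1 := hp (by decide)
  have h12 : p 1 < p 2 := hp (by decide)
  have h23 : p 2 < p 3 := hp (by decide)
  have h1 : 1 ≤ p 1 := by omega
  obtain ⟨n1, n2, n3, n4⟩ := noThreeEqual_iff.1 hv
  have hnone : ∀ m, p m ∉ v.branches.flatten → v.branchOf (p m) = none := fun m hm =>
    (CTree.Vert.branchOf_eq_none T.consec).2 hm
  have hle : ∀ {i j}, i ∈ v.branches.flatten → j ∈ v.branches.flatten → i ≤ j →
      S.pos v i ≤ S.pos v j := fun hi hj hij => NodalQuiltedDisk.pos_le T.consec hi hj hij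
  have hsep : ∀ {i j k}, i ∈ v.branches.flatten → k ∈ v.branches.flatten → i ≤ j → j ≤ k →
      ¬ (v.branchOf i = v.branchOf j ∧ v.branchOf j = v.branchOf k) → Sep v.branches i k := by
    intro i j k hi hk hij hjk hne
    obtain ⟨a, ha⟩ := CTree.Vert.exists_branchOf T.consec hi
    obtain ⟨c, hc⟩ := CTree.Vert.exists_branchOf T.consec hk
    obtain ⟨b, hb⟩ := CTree.Vert.exists_branchOf T.consec
      ((v.consec T.consec).mem_of_le hi hk hij hjk)
    refine (CTree.Vert.sep_iff_branchOf T.consec).2 ⟨a, c, ha, hc, ?_⟩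
    rintro rfl
    have h1 := CTree.Vert.branchOf_le T.consec ha hb hij
    have h2 := CTree.Vert.branchOf_le T.consec hb hc hjk
    exact hne ⟨by rw [ha, hb, le_antisymm h1 h2], by rw [hb, hc, le_antisymm h2 h1]⟩
  have hinf : ∀ {w₁ w₂ w₃ w₄ : OnePoint ℝ}, (w₁ = w₂ ∨ w₃ = w₄) → crossRatio w₁ w₂ w₃ w₄ = ⊥ :=
    fun h => if_pos h
  by_cases m0 : p 0 ∈ v.branches.flatten
  · by_cases m3 : p 3 ∈ v.branches.flatten
    · have m1 := (v.consec T.consec).mem_of_le m0 m3 h01.le (h12.trans h23).le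
      have m2 := (v.consec T.consec).mem_of_le m0 m3 (h01.trans h12).le h23.le
      have s02 := hsep m0 m2 h01.le h12.le n1
      have s13 := hsep m1 m3 h12.le h23.le n4
      rw [h.mass_eq_div s02 (h01.trans h12) le_rfl h01.le h12.le,
        h.mass_eq_div s13 (h12.trans h23) h12.le h23.le le_rfl,
        NodalQuiltedDisk.image_of_mem T.consec m0, NodalQuiltedDisk.image_of_mem T.consec m1,
        NodalQuiltedDisk.image_of_mem T.consec m2, NodalQuiltedDisk.image_of_mem T.consec m3]
      exact crossRatio_coe (hle m0 m1 h01.le) (hle m1 m2 h12.le) (hle m2 m3 h23.le)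
        (NodalQuiltedDisk.pos_lt T.consec s02 (h01.trans h12))
        (NodalQuiltedDisk.pos_lt T.consec s13 (h12.trans h23))
    · by_cases m2 : p 2 ∈ v.branches.flatten
      · have m1 := (v.consec T.consec).mem_of_le m0 m2 h01.le h12.le
        have s02 := hsep m0 m2 h01.le h12.le n1
        rw [h.mass_eq_div s02 (h01.trans h12) le_rfl h01.le h12.le,
          (h.mass_left m1 m2 h12 m3 h23 hn).2,
          NodalQuiltedDisk.image_of_mem T.consec m0, NodalQuiltedDisk.image_of_mem T.consec m1,
          NodalQuiltedDisk.image_of_mem T.consec m2, NodalQuiltedDisk.image_of_notMem T.consec m3]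
        exact crossRatio_infty_right (hle m0 m1 h01.le)
          (NodalQuiltedDisk.pos_lt T.consec s02 (h01.trans h12))
      · have m1 : p 1 ∈ v.branches.flatten := by
          by_contra m1
          exact n4 ⟨by rw [hnone 1 m1, hnone 2 m2], by rw [hnone 2 m2, hnone 3 m3]⟩
        rw [(h.mass_left m0 m1 h01 m2 h12 (h23.le.trans hn)).1, zero_mul, theta_of_nonpos le_rfl]
        exact hinf (Or.inr (image_eq_of_branchOf_eq (by rw [hnone 2 m2, hnone 3 m3])))
  · by_cases m3 : p 3 ∈ v.branches.flatten
    · by_cases m1 : p 1 ∈ v.branches.flatten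
      · have m2 := (v.consec T.consec).mem_of_le m1 m3 h12.le h23.le
        have s13 := hsep m1 m3 h12.le h23.le n4
        rw [(h.mass_right m1 m2 h12 m0 h01).2,
          h.mass_eq_div s13 (h12.trans h23) h12.le h23.le le_rfl,
          NodalQuiltedDisk.image_of_notMem T.consec m0, NodalQuiltedDisk.image_of_mem T.consec m1,
          NodalQuiltedDisk.image_of_mem T.consec m2, NodalQuiltedDisk.image_of_mem T.consec m3]
        exact crossRatio_infty_left (hle m2 m3 h23.le)
          (NodalQuiltedDisk.pos_lt T.consec s13 (h12.trans h23))
      · have m2 : p 2 ∈ v.branches.flatten := by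
          by_contra m2
          exact n1 ⟨by rw [hnone 0 m0, hnone 1 m1], by rw [hnone 1 m1, hnone 2 m2]⟩
        rw [(h.mass_right m2 m3 h23 m1 h12).1 h1, mul_zero, theta_of_nonpos le_rfl]
        exact hinf (Or.inl (image_eq_of_branchOf_eq (by rw [hnone 0 m0, hnone 1 m1])))
    · have m1 : p 1 ∈ v.branches.flatten := by
        by_contra m1
        exact n2 ⟨by rw [hnone 0 m0, hnone 1 m1], by rw [hnone 1 m1, hnone 3 m3]⟩
      have m2 : p 2 ∈ v.branches.flatten := by
        by_contra m2
        exact n3 ⟨by rw [hnone 0 m0, hnone 2 m2], by rw [hnone 2 m2, hnone 3 m3]⟩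
      rw [(h.mass_right m1 m2 h12 m0 h01).2, (h.mass_left m1 m2 h12 m3 h23 hn).2, one_mul, theta_one,
        NodalQuiltedDisk.image_of_notMem T.consec m0, NodalQuiltedDisk.image_of_mem T.consec m1,
        NodalQuiltedDisk.image_of_mem T.consec m2, NodalQuiltedDisk.image_of_notMem T.consec m3]
      simp [crossRatio]

theorem Fits.rhoFour_eq (h : Fits S u t y s) {p : Fin 4 → ℕ} (hp : StrictMono p) (hn : p 3 ≤ n) :
    S.rhoFour p = theta (mass (Mbar.mk S).system (p 0) (p 2) (p 0) (p 1) *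
        mass (Mbar.mk S).system (p 1) (p 3) (p 2) (p 3)) := by
  have hex := exists_noThreeEqual (T := T) hp hn
  rw [NodalQuiltedDisk.rhoFour, dif_pos hex]
  exact h.crossRatio_eq hp hn hex.choose_spec

theorem Fits.rhoTwo_eq (h : Fits S u t y s) (hi : 1 ≤ i) (hij : i < j) (hj : j ≤ n) :
    S.rhoTwo i j = - theta (∑ m ∈ gaps n i j, cond (vec n u y) (vec n t s) (seamGaps n i j) m) := by
  obtain ⟨v, hv⟩ := T.exists_sep hi hij hj
  have hl : ((⟨n - 1, by omega⟩ : Fin n) : ℕ) + 1 = n := by simp only; omega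
  rw [h.sum_cond_seamGaps hi hij hj hl, NodalQuiltedDisk.rhoTwo, CTree.meet_eq_some T.consec hv]
  dsimp only
  split
  · rename_i hlev
    rw [h.cond_seam_above hv hij hl hlev, sub_zero, theta_one, neg_zero]
  · rename_i hlev
    rw [h.cond_seam_below hv hij hl hlev, sub_self, theta_of_nonpos le_rfl, EReal.neg_bot]
  · rename_i hlev
    have h1 := sub_pos.2 (NodalQuiltedDisk.pos_lt (S := S) T.consec hv hij)
    have h2 := S.y_pos v hlev
    rw [h.cond_seam_colored hv hij hl hlev, NodalQuiltedDisk.image_of_mem T.consec hv.1,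
      NodalQuiltedDisk.image_of_mem T.consec hv.2.1]
    have h3 : 1 - S.y v hlev / (S.pos v j - S.pos v i + S.y v hlev) =
        (S.pos v j - S.pos v i) / (S.pos v j - S.pos v i + S.y v hlev) := by
      field_simp
      ring
    rw [h3, theta_of_pos (by positivity), ← EReal.coe_neg]
    congr 1
    show S.y v hlev / (S.pos v j - S.pos v i) = _
    field_simp
    ring

theorem Mbar.crossRatios_eq (X : Mbar n) : X.crossRatios = invariants X.system := by
  obtain ⟨S, hS⟩ := X.exists_eq_mk
  obtain ⟨T, X⟩ := X
  simp only at S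
  obtain ⟨u, t, h⟩ := exists_fits S
  rw [hS]
  refine Prod.ext (funext fun p => ?_) (funext fun p => ?_)
  · exact h.rhoFour_eq (p := fun m => p m) (fun a b hab => Fin.lt_def.1 (p.strictMono hab))
      (Nat.lt_succ_iff.1 (p 3).2)
  · have hb := Idx.bounds (p, true)
    show S.rhoTwo _ _ = -theta (∑ m ∈ gaps n p.1.1 p.1.2, (Mbar.mk S).system (p, true) m)
    rw [Mbar.system_mk h, h.rhoTwo_eq hb.1 hb.2.1 hb.2.2]
    rfl

/-- The moduli space carries the topology of the space of conditional systems. -/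
theorem Mbar.isInducing_system (hn : 0 < n) : IsInducing (Mbar.system (n := n)) := by
  have hmem : ∀ X : Mbar n, X.system ∈ systems (family n) := fun X => by
    rw [← Mbar.range_system hn]
    exact mem_range_self X
  have : CompactSpace (systems (family n)) := isCompact_iff_compactSpace.1 (isCompact_systems _)
  -- A continuous injection from a compact space to a Hausdorff space: pulling back along the
  -- cross-ratios or along the system gives the same topology.
  have hemb : IsClosedEmbedding fun x : systems (family n) => invariants x.1 :=
    (continuous_invariants.comp continuous_subtype_val).isClosedEmbedding
      fun x x' h => Subtype.ext (invariants_injOn x.2 x'.2 h)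
  have hc : IsInducing ((fun x : systems (family n) => invariants x.1) ∘
      fun X : Mbar n => ⟨X.system, hmem X⟩) := by
    have : ((fun x : systems (family n) => invariants x.1) ∘
      fun X : Mbar n => ⟨X.system, hmem X⟩) = Mbar.crossRatios := by
      funext X
      exact X.crossRatios_eq.symm
    rw [this]
    exact ⟨rfl⟩
  exact IsInducing.subtypeVal.comp (hemb.isInducing.of_comp_iff.1 hc)

end CrossRatios

/-! ### Weight vectors -/

section Weights

variable {n : ℕ} {T : CombType n} {S : NodalQuiltedDisk T.1} {u t : ℕ → ℝ} {y s : ℝ} {v : T.1.Vert}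
  {i j : ℕ}

theorem cond_of_top_eq_singleton {ι : Type*} [DecidableEq ι] {u t : ι → ℝ} {s : Finset ι} {b : ι}
    (ht : ∀ g, 0 < t g) (h : top u s = {b}) : cond u t s = Pi.single b 1 := by
  funext g
  by_cases hg : g = b
  · subst hg
    rw [cond_of_mem (by rw [h]; exact Finset.mem_singleton_self g), h, Finset.sum_singleton,
      div_self (ht g).ne', Pi.single_eq_same]
  · rw [cond_of_notMem (by rw [h, Finset.mem_singleton]; exact hg), Pi.single_eq_of_ne hg]

theorem branchOf_lt_of_sep (hv : Sep v.branches i j) (hij : i < j) :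
    ∃ a b, v.branchOf i = some a ∧ v.branchOf j = some b ∧ a < b := by
  obtain ⟨a, b, ha, hb, hab⟩ := (CTree.Vert.sep_iff_branchOf T.consec).1 hv
  exact ⟨a, b, ha, hb, lt_of_le_of_ne (CTree.Vert.branchOf_le T.consec ha hb hij.le) hab⟩

theorem arity_eq_two (hT : T.1.IsMaximal) (hv : Sep v.branches i j) :
    v.arity = 2 ∧ v.level ≠ .colored := by
  obtain ⟨a, b, -, -, hab⟩ := (CTree.Vert.sep_iff_branchOf T.consec).1 hv
  have hne : v.level ≠ .colored := fun h => hab (Fin.ext (by have := (hT v).1 h; omega))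
  exact ⟨(hT v).2 hne, hne⟩

theorem branchOf_of_sep (hT : T.1.IsMaximal) (hv : Sep v.branches i j) (hij : i < j)
    {a b : Fin v.arity} (ha : (a : ℕ) = 0) (hb : (b : ℕ) = 1) :
    v.branchOf i = some a ∧ v.branchOf j = some b := by
  have h2 := (arity_eq_two hT hv).1
  obtain ⟨a', b', ha', hb', hab⟩ := branchOf_lt_of_sep hv hij
  rw [Fin.lt_def] at hab
  rw [ha', hb', Option.some_inj, Option.some_inj, Fin.ext_iff, Fin.ext_iff]
  omega

/-- In a maximal tree, the vertex at which two leaves meet has a single break. -/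
theorem exists_break_of_isMaximal (hT : T.1.IsMaximal) (hv : Sep v.branches i j) (hij : i < j) :
    ∃ b ∈ gaps n i j, Sep v.branches (b + 1) (b + 2) ∧
      ∀ g, Sep v.branches g (g + 1) → g = b + 1 := by
  obtain ⟨g, h1, h2, h3⟩ := exists_sep_succ (v.consec T.consec) hij.le hv
  have hb := bounds_of_sep hv
  have hg : g - 1 + 1 = g := by omega
  have h4 := (arity_eq_two hT hv).1
  refine ⟨⟨g - 1, by omega⟩, mem_gaps.2 (by simp only; omega), ?_, fun k hk => ?_⟩
  · show Sep v.branches (g - 1 + 1) (g - 1 + 1 + 1)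
    rwa [hg]
  · show k = g - 1 + 1
    rw [hg]
    have key : ∀ g k, Sep v.branches g (g + 1) → Sep v.branches k (k + 1) → ¬ g < k := by
      intro g k hg hk hlt
      obtain ⟨a, b, ha, hb, hab⟩ := branchOf_lt_of_sep hg (Nat.lt_succ_self g)
      obtain ⟨a', b', ha', hb', hab'⟩ := branchOf_lt_of_sep hk (Nat.lt_succ_self k)
      have := CTree.Vert.branchOf_le T.consec hb ha' hlt
      rw [Fin.lt_def] at hab hab'
      rw [Fin.le_def] at this
      omega
    exact le_antisymm (not_lt.1 (key g k h3 hk)) (not_lt.1 (key k g hk h3))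

/-- Pairs of leaves. -/
abbrev Pair (n : ℕ) : Type := {p : Fin (n + 1) × Fin (n + 1) // 0 < p.1 ∧ p.1 < p.2}

theorem Pair.bounds (p : Pair n) : 1 ≤ (p.1.1 : ℕ) ∧ (p.1.1 : ℕ) < p.1.2 ∧ (p.1.2 : ℕ) ≤ n :=
  Idx.bounds (p, true)

theorem exists_breaks (hT : T.1.IsMaximal) : ∃ b : Pair n → Fin n, ∀ p : Pair n,
    (b p : ℕ) + 1 < n ∧ ∀ v : T.1.Vert, Sep v.branches p.1.1 p.1.2 →
      b p ∈ gaps n p.1.1 p.1.2 ∧ Sep v.branches (b p + 1) (b p + 2) ∧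
        ∀ g, Sep v.branches g (g + 1) → g = b p + 1 := by
  have : ∀ p : Pair n, ∃ b : Fin n, (b : ℕ) + 1 < n ∧ ∀ v : T.1.Vert, Sep v.branches p.1.1 p.1.2 →
      b ∈ gaps n p.1.1 p.1.2 ∧ Sep v.branches (b + 1) (b + 2) ∧
        ∀ g, Sep v.branches g (g + 1) → g = b + 1 := by
    intro p
    obtain ⟨h1, h2, h3⟩ := p.bounds
    obtain ⟨v, hv⟩ := T.exists_sep h1 h2 h3
    obtain ⟨b, hb, h4, h5⟩ := exists_break_of_isMaximal hT hv h2
    refine ⟨b, by rw [mem_gaps] at hb; omega, fun w hw => ?_⟩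
    obtain rfl := CTree.Vert.eq_of_sep T.consec hv hw
    exact ⟨hb, h4, h5⟩
  choose b hb using this
  exact ⟨b, hb⟩

/-- The vertex has two branches, and it separates exactly the pairs with one leaf on each. -/
theorem card_sep (hT : T.1.IsMaximal) {g : ℕ} (hv : Sep v.branches g (g + 1)) :
    {p : Pair n | Sep v.branches p.1.1 p.1.2}.ncard = v.leafCount g * v.leafCount (g + 1) := by
  classical
  have h2 := (arity_eq_two hT hv).1
  set a : Fin v.arity := ⟨0, by omega⟩ with ha
  set b : Fin v.arity := ⟨1, by omega⟩ with hb
  obtain ⟨hga, hgb⟩ := branchOf_of_sep hT hv (Nat.lt_succ_self g) (a := a) (b := b) rfl rfl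
  have hnd : ∀ c : Fin v.arity, (v.branches.get c).Nodup := fun c =>
    (Consec.pairwise ((v.consec T.consec).infix
      (List.infix_of_mem_flatten (List.getElem_mem c.2)))).imp fun h => h.ne
  unfold CTree.Vert.leafCount
  rw [hga, hgb]
  dsimp only
  rw [← List.toFinset_card_of_nodup (hnd a), ← List.toFinset_card_of_nodup (hnd b),
    ← Finset.card_product, Set.ncard_eq_toFinset_card']
  refine Finset.card_bij (fun p _ => ((p.1.1 : ℕ), (p.1.2 : ℕ))) ?_ ?_ ?_
  · intro p hp
    rw [Set.mem_toFinset] at hp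
    obtain ⟨h3, h4⟩ := branchOf_of_sep hT hp p.bounds.2.1 (a := a) (b := b) rfl rfl
    rw [Finset.mem_product, List.mem_toFinset, List.mem_toFinset]
    exact ⟨(CTree.Vert.branchOf_eq_some T.consec).1 h3, (CTree.Vert.branchOf_eq_some T.consec).1 h4⟩
  · intro p _ q _ h
    obtain ⟨h3, h4⟩ := Prod.mk.inj h
    exact Subtype.ext (Prod.ext (Fin.ext h3) (Fin.ext h4))
  · rintro ⟨i, j⟩ hij
    rw [Finset.mem_product, List.mem_toFinset, List.mem_toFinset] at hij
    have hi := (CTree.Vert.branchOf_eq_some T.consec).2 hij.1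
    have hj := (CTree.Vert.branchOf_eq_some T.consec).2 hij.2
    have hne : a ≠ b := by simp [ha, hb]
    have hsep := (CTree.Vert.sep_iff_branchOf T.consec).2 ⟨a, b, hi, hj, hne⟩
    have hlt : i < j := by
      by_contra hle
      have := Fin.le_def.1 (CTree.Vert.branchOf_le T.consec hj hi (not_lt.1 hle))
      simp [ha, hb] at this
    have hbd := bounds_of_sep hsep
    refine ⟨⟨(⟨i, by omega⟩, ⟨j, by omega⟩), Fin.lt_def.2 hbd.1, Fin.lt_def.2 hlt⟩, ?_, rfl⟩
    rw [Set.mem_toFinset]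
    exact hsep

/-- The translation vector: minus the number of pairs of leaves at the last coordinate. -/
def offset (n : ℕ) (m : Fin n) : ℝ := if (m : ℕ) + 1 < n then 0 else - (Fintype.card (Pair n) : ℝ)

theorem Fits.top_gaps_eq_singleton (h : Fits S u t y s)
    (hv : Sep v.branches i j) (hij : i < j) {b : Fin n} (hb : b ∈ gaps n i j)
    (hb1 : Sep v.branches (b + 1) (b + 2)) (hb2 : ∀ g, Sep v.branches g (g + 1) → g = b + 1) :
    top (vec n u y) (gaps n i j) = {b} := by
  ext m
  rw [Finset.mem_singleton]
  constructor
  · intro hm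
    rw [mem_top_gaps h.realizes hv hij (top_subset _ _ hm)] at hm
    exact Fin.ext (Nat.succ_injective (hb2 _ hm))
  · rintro rfl
    exact (mem_top_gaps h.realizes hv hij hb).2 hb1

theorem Fits.top_seamGaps_eq_singleton (hT : T.1.IsMaximal) (h : Fits S u t y s)
    (hv : Sep v.branches i j) (hij : i < j) {b l : Fin n} (hb : b ∈ gaps n i j)
    (hb1 : Sep v.branches (b + 1) (b + 2)) (hb2 : ∀ g, Sep v.branches g (g + 1) → g = b + 1)
    (hl : (l : ℕ) + 1 = n) :
    top (vec n u y) (seamGaps n i j) = {if T.1.delta (b + 1) = 1 then b else l} := by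
  have hdelta : T.1.delta (b + 1) = 1 ↔ v.level = .above := by
    have hm : T.1.meet (b + 1) (b + 1 + 1) = some v := CTree.meet_eq_some T.consec hb1
    rw [CTree.delta, hm]
    dsimp only
    cases v.level <;> simp
  have hbd := bounds_of_sep hv
  have hne := (arity_eq_two hT hv).2
  ext m
  rw [Finset.mem_singleton]
  constructor
  · intro hm
    rw [mem_top_seamGaps h.realizes hv hij (top_subset _ _ hm)] at hm
    rcases hm with ⟨h1, h2, h3⟩ | ⟨h1, h2⟩
    · have : v.level = .above := by cases hlev : v.level <;> simp_all
      rw [if_pos (hdelta.2 this)]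
      exact Fin.ext (Nat.succ_injective (hb2 _ h3))
    · rw [if_neg fun h => h2 (hdelta.1 h)]
      exact Fin.ext (by omega)
  · rintro rfl
    split_ifs with hlev <;> rw [hdelta] at hlev
    · refine (mem_top_seamGaps h.realizes hv hij (gaps_subset _ _ hb)).2 (Or.inl ⟨?_, ?_, hb1⟩)
      · rw [mem_gaps] at hb
        omega
      · rw [hlev]
        exact fun h => Level.noConfusion h
    · exact (mem_top_seamGaps h.realizes hv hij (mem_seamGaps_last hl)).2 (Or.inr ⟨hl, hlev⟩)

/-- The conditional system of a disk of maximal type is concentrated on single gaps. -/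
theorem Fits.system_eq_single (hT : T.1.IsMaximal) (h : Fits S u t y s) {b : Pair n → Fin n}
    (hb : ∀ p : Pair n, (b p : ℕ) + 1 < n ∧ ∀ v : T.1.Vert, Sep v.branches p.1.1 p.1.2 →
      b p ∈ gaps n p.1.1 p.1.2 ∧ Sep v.branches (b p + 1) (b p + 2) ∧
        ∀ g, Sep v.branches g (g + 1) → g = b p + 1) {l : Fin n} (hl : (l : ℕ) + 1 = n)
    (p : Pair n) : (Mbar.mk S).system (p, false) = Pi.single (b p) 1 ∧
      (Mbar.mk S).system (p, true) =
        Pi.single (if T.1.delta (b p + 1) = 1 then b p else l) 1 := by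
  rw [Mbar.system_mk h]
  obtain ⟨h1, h2, h3⟩ := p.bounds
  obtain ⟨v, hv⟩ := T.exists_sep h1 h2 h3
  obtain ⟨h4, h5, h6⟩ := (hb p).2 v hv
  refine ⟨cond_of_top_eq_singleton h.vec_pos (h.top_gaps_eq_singleton hv h2 h4 h5 h6), ?_⟩
  exact cond_of_top_eq_singleton h.vec_pos (h.top_seamGaps_eq_singleton hT hv h2 h4 h5 h6 hl)

theorem delta_eq_zero_or_one (T : CTree) (g : ℕ) : T.delta g = 0 ∨ T.delta g = 1 := by
  unfold CTree.delta
  rcases T.meet g (g + 1) with _ | v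
  · exact Or.inl rfl
  · dsimp only
    cases v.level <;> simp

/-- The pairs with break `m` are those that meet at the same vertex as the leaves `m + 1` and `m +
2`. -/
theorem card_break (hT : T.1.IsMaximal) {b : Pair n → Fin n}
    (hb : ∀ p : Pair n, (b p : ℕ) + 1 < n ∧ ∀ v : T.1.Vert, Sep v.branches p.1.1 p.1.2 →
      b p ∈ gaps n p.1.1 p.1.2 ∧ Sep v.branches (b p + 1) (b p + 2) ∧
        ∀ g, Sep v.branches g (g + 1) → g = b p + 1) {m : Fin n} (hm : (m : ℕ) + 1 < n) :
    ((Finset.univ.filter fun p => b p = m).card : ℤ) = T.1.leafProd (m + 1) := by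
  obtain ⟨v, hv⟩ := T.exists_sep (i := m + 1) (j := m + 1 + 1) (by omega) (by omega) (by omega)
  rw [CTree.leafProd, CTree.meet_eq_some T.consec hv]
  dsimp only
  rw [← Nat.cast_mul, ← card_sep hT hv, Set.ncard_eq_toFinset_card _ (Set.toFinite _)]
  congr 2
  ext p
  rw [Finset.mem_filter, Set.Finite.mem_toFinset, Set.mem_ofPred_eq]
  constructor
  · rintro ⟨-, rfl⟩
    obtain ⟨h1, h2, h3⟩ := p.bounds
    obtain ⟨w, hw⟩ := T.exists_sep h1 h2 h3
    rwa [← CTree.Vert.eq_of_sep T.consec ((hb p).2 w hw).2.1 hv]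
  · intro hp
    exact ⟨Finset.mem_univ p, Fin.ext (Nat.succ_injective (((hb p).2 v hp).2.2 _ hv).symm)⟩

/-- Every pair of leaves contributes a unit at its break and a second unit at its break or at the
seam, according to `delta`. The seam coordinate therefore counts the pairs with `delta` 0, and
`offset` subtracts the number of all pairs, leaving minus the number of those with `delta` 1. -/
theorem Fits.weight_eq (hT : T.1.IsMaximal) (h : Fits S u t y s) (m : Fin n) :
    moment (offset n) (Mbar.mk S).system m = weight T m := by
  classical
  have hl : ((⟨n - 1, by have := m.2; omega⟩ : Fin n) : ℕ) + 1 = n := by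
    have := m.2
    simp only
    omega
  set l : Fin n := ⟨n - 1, by have := m.2; omega⟩
  obtain ⟨b, hb⟩ := exists_breaks hT
  have hsum : ∀ m, ∑ α, (Mbar.mk S).system α m = ∑ p, ((if b p = m then 1 else 0) +
      if (if T.1.delta (b p + 1) = 1 then b p else l) = m then (1 : ℝ) else 0) := by
    intro m
    rw [Fintype.sum_prod_type]
    refine Finset.sum_congr rfl fun p _ => ?_
    rw [Fintype.sum_bool, (h.system_eq_single hT hb hl p).1, (h.system_eq_single hT hb hl p).2,
      add_comm, Pi.single_apply, Pi.single_apply]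
    simp only [eq_comm]
  rw [moment_apply, hsum, weight, offset]
  by_cases hm : (m : ℕ) + 1 < n
  · rw [if_pos hm, if_pos hm, zero_add, ← card_break hT hb hm, Finset.sum_add_distrib]
    have hlm : l ≠ m := fun h => by rw [← h] at hm; omega
    have : ∀ p, (if (if T.1.delta (b p + 1) = 1 then b p else l) = m then (1 : ℝ) else 0) =
        (if b p = m then 1 else 0) * T.1.delta (m + 1) := by
      intro p
      by_cases hp : b p = m
      · subst hp
        rcases delta_eq_zero_or_one T.1 (b p + 1) with h0 | h0 <;> simp [h0, hlm]
      · rw [if_neg hp, zero_mul, if_neg]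
        split_ifs <;> assumption
    rw [Finset.sum_congr rfl fun p _ => this p, ← Finset.sum_mul, Finset.sum_boole]
    push_cast
    ring
  · have hlm : m = l := Fin.ext (by have := m.2; omega)
    clear_value l
    subst hlm
    rw [if_neg hm, if_neg hm]
    have h1 : ∀ p, ((if b p = m then 1 else 0) +
        if (if T.1.delta (b p + 1) = 1 then b p else m) = m then (1 : ℝ) else 0) =
        1 - (T.1.delta (b p + 1) : ℝ) := by
      intro p
      have hbl : b p ≠ m := fun h => by have := (hb p).1; rw [h] at this; omega
      rcases delta_eq_zero_or_one T.1 (b p + 1) with h0 | h0 <;> simp [h0, hbl]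
    -- Pairs are grouped by their break; the seam index is never a break, so its group is empty.
    have h2 : ∑ p, T.1.delta (b p + 1) =
        ∑ i ∈ Finset.Ico 1 n, T.1.delta i * T.1.leafProd i := by
      rw [← Finset.sum_fiberwise Finset.univ b,
        ← sum_gaps (fun i => T.1.delta i * T.1.leafProd i) le_rfl le_rfl]
      symm
      refine Finset.sum_subset_zero_on_sdiff (Finset.subset_univ _) (fun k hk => ?_) fun k hk => ?_
      · refine Finset.sum_eq_zero fun p hp => absurd (hb p).1 ?_
        rw [(Finset.mem_filter.1 hp).2]
        have := (Finset.mem_sdiff.1 hk).2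
        rw [mem_gaps] at this
        omega
      · rw [mem_gaps] at hk
        rw [← card_break hT hb hk.2, Finset.sum_congr rfl fun p hp => by
          rw [(Finset.mem_filter.1 hp).2], Finset.sum_const, nsmul_eq_mul, mul_comm]
    rw [Finset.sum_congr rfl fun p _ => h1 p, Finset.sum_sub_distrib, ← h2]
    push_cast
    simp only [Finset.sum_const, Finset.card_univ, nsmul_eq_mul, mul_one]
    ring

end Weights

/-! ### The weight polytope as a Minkowski sum -/

section Polytope

variable {n : ℕ}

/-- The moduli space is homeomorphic to a Minkowski sum of simplices. -/
theorem exists_homeomorph (hn : 0 < n) (c : Fin n → ℝ) :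
    ∃ h : Mbar n ≃ₜ simplexSum c (family n), ∀ X, (h X : EuclideanSpace ℝ (Fin n)) =
      moment c X.system := by
  have hrange : range (fun X : Mbar n => moment c X.system) = simplexSum c (family n) := by
    rw [← moment_image_systems c family_nonempty, ← Mbar.range_system hn, ← range_comp]
    rfl
  have hmem : ∀ X : Mbar n, X.system ∈ systems (family n) := fun X => by
    rw [← Mbar.range_system hn]
    exact mem_range_self X
  have : CompactSpace (systems (family n)) := isCompact_iff_compactSpace.1 (isCompact_systems _)
  -- Compactness again turns the injectivity of the moment map into an embedding.
  have hemb : IsClosedEmbedding fun x : systems (family n) => moment c x.1 :=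
    ((continuous_moment c).comp continuous_subtype_val).isClosedEmbedding fun x x' h => by
      refine Subtype.ext (eq_of_sum_eq x.2 x'.2 ?_)
      have h' := WithLp.toLp_injective 2 h
      exact add_left_cancel h'
  have hsys : IsEmbedding fun X : Mbar n => (⟨X.system, hmem X⟩ : systems (family n)) :=
    ⟨IsInducing.subtypeVal.of_comp_iff.1 (Mbar.isInducing_system hn),
      fun X X' h => Mbar.system_injective (Subtype.ext_iff.1 h)⟩
  have h := hemb.isEmbedding.comp hsys
  exact ⟨h.toHomeomorph.trans (Homeomorph.setCongr hrange), fun X => rfl⟩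

theorem exists_break_of_lt {T : CombType n} {v : T.1.Vert} {a b : Fin v.arity} (hab : a < b) :
    ∃ i j, Sep v.branches i j ∧ i < j ∧ v.branchOf i = some a ∧ v.branchOf j = some b := by
  have hex : ∀ m : Fin v.arity, ∃ i, v.branchOf i = some m := by
    intro m
    obtain ⟨i, hi⟩ := List.exists_mem_of_ne_nil (v.branches.get m)
      fun h' => v.nil_notMem_branches (h' ▸ List.getElem_mem m.2)
    exact ⟨i, (CTree.Vert.branchOf_eq_some T.consec).2 hi⟩
  obtain ⟨i, hi⟩ := hex a
  obtain ⟨j, hj⟩ := hex b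
  refine ⟨i, j, (CTree.Vert.sep_iff_branchOf T.consec).2 ⟨a, b, hi, hj, hab.ne⟩, ?_, hi, hj⟩
  by_contra hle
  exact absurd (CTree.Vert.branchOf_le T.consec hj hi (not_lt.1 hle)) (not_le.2 hab)

/-- A colored vertex with two branches would make a gap tie with the seam, and an uncolored one with
three branches would make two gaps tie. -/
theorem isMaximal_of_card_top {T : CombType n} {u : ℕ → ℝ} {y : ℝ} (h : T.1.Realizes u y)
    (hcard : ∀ α, (top (vec n u y) (family n α)).card ≤ 1) : T.1.IsMaximal := by
  have hcard' := (forall_family (P := fun s => (top (vec n u y) s).card ≤ 1)).1 hcard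
  intro v
  have hpos := v.arity_pos
  constructor
  · intro hlev
    by_contra hne
    obtain ⟨i, j, hs, hij, -, -⟩ := exists_break_of_lt (T := T) (v := v) (a := ⟨0, by omega⟩)
      (b := ⟨1, by omega⟩) (Fin.lt_def.2 one_pos)
    obtain ⟨g, h1, h2, h3⟩ := exists_sep_succ (v.consec T.consec) hij.le hs
    have hb := bounds_of_sep hs
    have e := Finset.card_le_one.1 (hcard' i j hb.1 hij hb.2).2 ⟨g - 1, by omega⟩
      ((mem_top_seamGaps h hs hij (mem_seamGaps.2 (by simp only; omega))).2
        (Or.inl ⟨by simp only; omega, by simp [hlev], by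
          rw [show ((⟨g - 1, by omega⟩ : Fin n) : ℕ) + 2 = g + 1 by simp only; omega,
            show ((⟨g - 1, by omega⟩ : Fin n) : ℕ) + 1 = g by simp only; omega]
          exact h3⟩)) ⟨n - 1, by omega⟩
      ((mem_top_seamGaps h hs hij (mem_seamGaps.2 (by simp only; omega))).2
        (Or.inr ⟨by simp only; omega, by simp [hlev]⟩))
    have := Fin.mk.inj e
    omega
  · intro hlev
    have h2 := v.two_le_arity hlev
    by_contra hne
    obtain ⟨i, j, hs, hij, hi, hj⟩ := exists_break_of_lt (T := T) (v := v) (a := ⟨0, by omega⟩)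
      (b := ⟨1, by omega⟩) (Fin.lt_def.2 one_pos)
    obtain ⟨j', k, hs', hjk, hj', hk⟩ := exists_break_of_lt (T := T) (v := v) (a := ⟨1, by omega⟩)
      (b := ⟨2, by omega⟩) (Fin.lt_def.2 one_lt_two)
    obtain ⟨g, g1, g2, g3⟩ := exists_sep_succ (v.consec T.consec) hij.le hs
    obtain ⟨g', g1', g2', g3'⟩ := exists_sep_succ (v.consec T.consec) hjk.le hs'
    have hlt : g < g' := by
      by_contra hle
      obtain ⟨a, b, ha, hb, hab⟩ := branchOf_lt_of_sep g3' (Nat.lt_succ_self g')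
      have e1 := CTree.Vert.branchOf_le T.consec hb hj (by omega)
      have e2 := CTree.Vert.branchOf_le T.consec hj' ha g1'
      exact absurd (e2.trans_lt hab) (not_lt.2 e1)
    have hs3 : Sep v.branches g (g' + 1) := sep_of_le g3 (Nat.le_succ g) (by omega) g3'.2.1
    have hb := bounds_of_sep hs3
    have e := Finset.card_le_one.1 (hcard' g (g' + 1) hb.1 (by omega) hb.2).1 ⟨g - 1, by omega⟩
      ((mem_top_gaps h hs3 (by omega) (mem_gaps.2 (by simp only; omega))).2 (by
          rw [show ((⟨g - 1, by omega⟩ : Fin n) : ℕ) + 2 = g + 1 by simp only; omega,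
            show ((⟨g - 1, by omega⟩ : Fin n) : ℕ) + 1 = g by simp only; omega]
          exact g3)) ⟨g' - 1, by omega⟩
      ((mem_top_gaps h hs3 (by omega) (mem_gaps.2 (by simp only; omega))).2 (by
          rw [show ((⟨g' - 1, by omega⟩ : Fin n) : ℕ) + 2 = g' + 1 by simp only; omega,
            show ((⟨g' - 1, by omega⟩ : Fin n) : ℕ) + 1 = g' by simp only; omega]
          exact g3'))
    have := Fin.mk.inj e
    omega

/-- Every combinatorial type is the type of a disk. -/
instance (T : CTree) : Nonempty (NodalQuiltedDisk T) :=
  ⟨{  z := fun _ m => ((m : ℕ) : ℝ)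
      strictMono := fun _ _ _ h => Nat.cast_lt.2 (Fin.lt_def.1 h)
      y := fun _ _ => 1
      y_pos := fun _ _ => one_pos }⟩

theorem exists_of_mem_weightVectors {x : EuclideanSpace ℝ (Fin n)} (hx : x ∈ weightVectors n) :
    ∃ (T : CombType n) (S : NodalQuiltedDisk T.1), T.1.IsMaximal ∧
      x = moment (offset n) (Mbar.mk S).system := by
  obtain ⟨T, hT, hx⟩ := hx
  obtain ⟨S⟩ : Nonempty (NodalQuiltedDisk T.1) := inferInstance
  obtain ⟨u, t, h⟩ := exists_fits S
  refine ⟨T, S, hT, ?_⟩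
  ext m
  rw [hx, h.weight_eq hT]

/-- A weight vector is determined by the element of each set of `family n` that carries the point
mass, so there are finitely many. -/
theorem finite_weightVectors (hn : 0 < n) : (weightVectors n).Finite := by
  classical
  refine (finite_range fun f : Idx n → Fin n =>
    moment (offset n) fun α => (Pi.single (f α) 1 : Fin n → ℝ)).subset fun x hx => ?_
  obtain ⟨T, S, hT, rfl⟩ := exists_of_mem_weightVectors hx
  obtain ⟨u, t, h⟩ := exists_fits S
  obtain ⟨b, hb⟩ := exists_breaks hT
  have hl : ((⟨n - 1, by omega⟩ : Fin n) : ℕ) + 1 = n := by simp only; omega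
  refine ⟨fun α => if α.2 = true then
    (if T.1.delta (b α.1 + 1) = 1 then b α.1 else ⟨n - 1, by omega⟩) else b α.1, ?_⟩
  dsimp only
  congr 1
  funext α
  obtain ⟨p, _ | _⟩ := α
  · exact (h.system_eq_single hT hb hl p).1.symm
  · exact (h.system_eq_single hT hb hl p).2.symm

/-- Breaking the ties of a functional shrinks the face it exposes to a vertex of that face. -/
theorem exists_injective_refinement (w : Fin n → ℝ) :
    ∃ w' : Fin n → ℝ, Function.Injective w' ∧ ∀ i j, w' i ≤ w' j → w i ≤ w j := by
  refine ⟨fun i => (((Tuple.sort w).symm i : ℕ) : ℝ), fun i j h => ?_, fun i j h => ?_⟩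
  · exact (Tuple.sort w).symm.injective (Fin.ext (Nat.cast_injective h))
  · have := Tuple.monotone_sort w (Fin.le_def.2 (Nat.cast_le.1 h))
    simpa using this

/-- If a functional `w` strictly separated a point of the Minkowski sum from the weight vectors, the
maximal tree of a tie-free refinement of `w` would have its weight vector in the face where `w` is
maximal over the whole sum, a contradiction. -/
theorem weightPolytope_eq (hn : 0 < n) :
    weightPolytope n = simplexSum (offset n) (family n) := by
  apply Subset.antisymm
  · refine convexHull_min (fun x hx => ?_) (convex_simplexSum _ _)
    obtain ⟨T, S, -, rfl⟩ := exists_of_mem_weightVectors hx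
    obtain ⟨h, hh⟩ := exists_homeomorph hn (offset n)
    rw [← hh]
    exact (h _).2
  · intro p hp
    by_contra hp'
    have hcl : IsClosed (weightPolytope n) := (finite_weightVectors hn).isClosed_convexHull ℝ
    obtain ⟨f, r, h1, h2⟩ := geometric_hahn_banach_closed_point (convex_convexHull ℝ _) hcl hp'
    obtain ⟨w, rfl⟩ := exists_eq_functional f
    obtain ⟨w', hinj, hw'⟩ := exists_injective_refinement w
    have hsub : ∀ α, top w' (family n α) ⊆ top w (family n α) := fun α g hg =>
      mem_top.2 ⟨(mem_top.1 hg).1, fun k hk => hw' _ _ ((mem_top.1 hg).2 k hk)⟩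
    have hcard : ∀ α, (top w' (family n α)).card ≤ 1 := fun α =>
      Finset.card_le_one.2 fun a ha b hb => hinj (le_antisymm
        ((mem_top.1 hb).2 a (mem_top.1 ha).1) ((mem_top.1 ha).2 b (mem_top.1 hb).1))
    obtain ⟨u, y, rfl⟩ := exists_eq_vec hn w'
    obtain ⟨T, S, h⟩ := exists_disk_fits hn u y (t := fun _ => 1) (fun _ => one_pos) one_pos
    have hT := isMaximal_of_card_top h.realizes hcard
    have hmem : moment (offset n) (Mbar.mk S).system ∈ weightPolytope n :=
      subset_convexHull ℝ _ ⟨T, hT, fun m => h.weight_eq hT m⟩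
    have hsimp : ∀ α, (Mbar.mk S).system α ∈ simplex (top (vec n u y) (family n α)) := fun α => by
      rw [Mbar.system_mk h]
      exact cond_mem_simplex h.vec_pos (family_nonempty α)
    have hle := (moment_mem_face_iff (c := offset n) family_nonempty w fun α =>
      simplex_mono (top_subset _ _) (hsimp α)).2 (fun α => simplex_mono (hsub α) (hsimp α)) p hp
    exact absurd (h2.trans_le hle) (not_lt.2 (h1 _ hmem).le)

end Polytope

/-! ### The dimension of the Minkowski sum -/

section Dimension

variable {n : ℕ}

theorem sum_eq_one_of_mem_simplex {ι : Type*} [Fintype ι] {s : Finset ι} {y : ι → ℝ}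
    (hy : y ∈ simplex s) : ∑ g, y g = 1 := by
  rw [← hy.2.2]
  exact (Finset.sum_subset (Finset.subset_univ s) fun g _ hg => hy.2.1 g hg).symm

/-- A Minkowski sum of simplices one of which is the full simplex has codimension one. -/
theorem vectorSpan_simplexSum {ι A : Type*} [Fintype ι] [Fintype A] (c : ι → ℝ) {S : A → Finset ι}
    (hS : ∀ α, (S α).Nonempty) {β : A} (hβ : S β = Finset.univ) :
    vectorSpan ℝ (simplexSum c S) = LinearMap.ker (functional (1 : ι → ℝ)).toLinearMap := by
  classical
  apply le_antisymm
  · rw [vectorSpan_def, Submodule.span_le]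
    rintro _ ⟨_, ⟨y, hy, rfl⟩, _, ⟨z, hz, rfl⟩, rfl⟩
    have key : ∀ y : A → ι → ℝ, (∀ α, y α ∈ simplex (S α)) →
        functional 1 (moment c y) = ∑ g, c g + Fintype.card A := by
      intro y hy
      rw [functional_moment]
      simp [sum_eq_one_of_mem_simplex (hy _)]
    show functional 1 (moment c y -ᵥ moment c z) = 0
    rw [vsub_eq_sub, map_sub, key y hy, key z hz, sub_self]
  · choose m hm using hS
    have hβne : Nonempty ι := ⟨m β⟩
    -- Only the summand `β` is moved, from one vertex of the full simplex to another; these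
    -- differences span the vectors with coordinate sum zero.
    have hmem : ∀ i j : ι, EuclideanSpace.single i (1 : ℝ) - EuclideanSpace.single j 1 ∈
        vectorSpan ℝ (simplexSum c S) := by
      intro i j
      have h1 : ∀ i, moment c (fun α => (Pi.single (Function.update m β i α) 1 : ι → ℝ)) ∈
          simplexSum c S := by
        refine fun i => ⟨_, fun α => single_mem_simplex ?_, rfl⟩
        rcases eq_or_ne α β with rfl | h
        · rw [hβ]; exact Finset.mem_univ _
        · rw [Function.update_of_ne h]; exact hm α
      have := vsub_mem_vectorSpan ℝ (h1 i) (h1 j)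
      convert this using 1
      ext g
      simp only [vsub_eq_sub, PiLp.sub_apply, moment_apply, PiLp.single_apply]
      rw [add_sub_add_left_eq_sub, ← Finset.sum_sub_distrib, Finset.sum_eq_single β]
      · simp [Pi.single_apply]
      · intro α _ h
        rw [Function.update_of_ne h, Function.update_of_ne h, sub_self]
      · exact fun h => absurd (Finset.mem_univ β) h
    intro x hx
    have hx' : ∑ g, x g = 0 := by
      have : functional 1 x = 0 := hx
      simpa [functional_apply] using this
    have : x = ∑ i, x i • (EuclideanSpace.single i (1 : ℝ) - EuclideanSpace.single (m β) 1) := by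
      ext g
      simp only [WithLp.ofLp_sum, Finset.sum_apply, PiLp.smul_apply, PiLp.sub_apply, smul_eq_mul, mul_sub,
        Finset.sum_sub_distrib, ← Finset.sum_mul, hx', zero_mul, sub_zero, PiLp.single_apply]
      simp
    rw [this]
    exact Submodule.sum_mem _ fun i _ => Submodule.smul_mem _ _ (hmem i _)

theorem finrank_vectorSpan_simplexSum {ι A : Type*} [Fintype ι] [Fintype A] (c : ι → ℝ)
    {S : A → Finset ι} (hS : ∀ α, (S α).Nonempty) {β : A} (hβ : S β = Finset.univ) :
    Module.finrank ℝ (vectorSpan ℝ (simplexSum c S)) = Fintype.card ι - 1 := by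
  classical
  obtain ⟨g, -⟩ := hS β
  have hne : (functional (1 : ι → ℝ)).toLinearMap ≠ 0 := fun h => by
    have := LinearMap.congr_fun h (EuclideanSpace.single g 1)
    simp [functional_apply] at this
  have := Module.Dual.finrank_ker_add_one_of_ne_zero hne
  rw [finrank_euclideanSpace] at this
  rw [vectorSpan_simplexSum c hS hβ]
  omega

end Dimension

end Multiplihedron

end

/-! ### The main theorem -/

open Multiplihedron

theorem mainTheorem4 (n : ℕ) (hn : 2 ≤ n) :
    -- the convex hull of the weight vectors is a convex polytope of dimension `n - 1`
    (Multiplihedron.weightVectors n).Finite ∧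
    Module.finrank ℝ (vectorSpan ℝ (Multiplihedron.weightPolytope n)) = n - 1 ∧
    -- CW structures on the moduli space and on the polytope, and an isomorphism between them
    ∃ (K : Topology.CWComplex (Set.univ : Set (Multiplihedron.Mbar n)))
      (L : Topology.CWComplex (Multiplihedron.weightPolytope n))
      (h : Multiplihedron.Mbar n ≃ₜ Multiplihedron.weightPolytope n),
      -- the open cells of the moduli space are the sets of disks of a given combinatorial type
      (⋃ k, Multiplihedron.openCells K k) = Set.range Multiplihedron.Mbar.stratum ∧
      -- the open cells of the polytope are the relative interiors of its non-empty faces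
      (∀ k, Multiplihedron.openCells L k =
        {e | ∃ F, Multiplihedron.IsFaceOfDim (Multiplihedron.weightPolytope n) F k ∧
          e = intrinsicInterior ℝ F}) ∧
      -- `h` maps the open `k`-cells bijectively onto the open `k`-cells
      ∀ k, (fun e => (fun S => (h S : EuclideanSpace ℝ (Fin n))) '' e) ''
        Multiplihedron.openCells K k = Multiplihedron.openCells L k := by
  have hn0 : 0 < n := by omega
  refine ⟨finite_weightVectors hn0, ?_⟩
  have hle : ∀ F : Set (EuclideanSpace ℝ (Fin n)), IsExposed ℝ (weightPolytope n) F →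
      intrinsicInterior ℝ F ⊆ weightPolytope n := fun F hF =>
    intrinsicInterior_subset.trans hF.subset
  obtain ⟨h, hh⟩ := exists_homeomorph hn0 (offset n)
  have hc := faceComplex_simplexSum (offset n) (S := family n) family_nonempty
  have hexp := fun F => exposed_iff (c := offset n) (S := family n) family_nonempty (F := F)
  have hint := fun u w t ht => moment_cond_mem_intrinsicInterior_iff (c := offset n)
    (S := family n) family_nonempty (u := u) (w := w) (t := t) ht
  rw [weightPolytope_eq hn0] at hle ⊢
  refine ⟨?_, ?_⟩
  -- The interval from the first to the last leaf, with the seam, contains all n indices and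
  -- provides the full simplex.
  · rw [finrank_vectorSpan_simplexSum _ family_nonempty
      (β := Idx.mk le_rfl (show 1 < n by omega) le_rfl true), Fintype.card_fin]
    ext m
    rw [family_mk_true, mem_seamGaps]
    simp only [Finset.mem_univ, iff_true]
    omega
  -- One face complex is placed in the moduli space by the inverse homeomorphism and in Euclidean
  -- space by inclusion, so that corresponding cells have the same dimension by construction.
  obtain ⟨K, hK⟩ := hc.exists_cwComplex h.symm.isEmbedding (C := univ)
    (by rw [h.symm.surjective.range_eq])
  obtain ⟨L, hL⟩ := hc.exists_cwComplex IsEmbedding.subtypeVal Subtype.range_val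
  refine ⟨K, L, h, ?_, fun k => ?_, fun k => ?_⟩
  -- Lying in the relative interior of the face of `vec n u y` means having the same supports, and
  -- equal supports mean equal combinatorial type.
  · have hstratum : ∀ (T : CombType n) (u : ℕ → ℝ) (y : ℝ), T.1.Realizes u y →
        h.symm '' (Subtype.val ⁻¹' intrinsicInterior ℝ
          (simplexSum (offset n) fun α => top (vec n u y) (family n α))) = Mbar.stratum T := by
      intro T u y hT
      ext X
      rw [h.symm.image_eq_preimage_symm, h.symm_symm, mem_preimage, mem_preimage, hh]
      obtain ⟨S, hS⟩ := X.exists_eq_mk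
      obtain ⟨T', X⟩ := X
      simp only at S
      obtain ⟨u', t', hS'⟩ := exists_fits S
      rw [hS, Mbar.system_mk hS', hint _ _ _ hS'.vec_pos, ← combType_eq_iff hS'.realizes hT]
      rfl
    ext e
    simp only [mem_iUnion, hK, mem_range]
    constructor
    · rintro ⟨k, F, ⟨h1, h2, -⟩, rfl⟩
      obtain ⟨u, rfl⟩ := (hexp F).1 ⟨h1, h2⟩
      obtain ⟨u, y, rfl⟩ := exists_eq_vec hn0 u
      obtain ⟨T, hT⟩ := exists_combType_realizes hn0 u y
      exact ⟨T, (hstratum T u y hT).symm⟩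
    · rintro ⟨T, rfl⟩
      obtain ⟨u, hT⟩ := CTree.exists_realizes T.consec
      obtain ⟨h1, h2⟩ := (hexp _).2 ⟨vec n u 0, rfl⟩
      exact ⟨_, _, ⟨h1, h2, rfl⟩, (hstratum T u 0 hT).symm⟩
  · rw [hL]
    ext e
    constructor
    · rintro ⟨F, hF, rfl⟩
      exact ⟨F, hF, by rw [Subtype.image_preimage_coe, inter_eq_right.2 (hle F hF.2.1)]⟩
    · rintro ⟨F, hF, rfl⟩
      exact ⟨F, hF, by rw [Subtype.image_preimage_coe, inter_eq_right.2 (hle F hF.2.1)]⟩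
  · have himg : ∀ A : Set (simplexSum (offset n) (family n)),
        (fun S => (h S : EuclideanSpace ℝ (Fin n))) '' (h.symm '' A) = Subtype.val '' A := by
      intro A
      rw [image_image]
      simp
    rw [hK, hL]
    ext e
    constructor
    · rintro ⟨_, ⟨F, hF, rfl⟩, rfl⟩
      exact ⟨F, hF, himg _⟩
    · rintro ⟨F, hF, rfl⟩
      exact ⟨_, ⟨F, hF, rfl⟩, himg _⟩
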